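/- Consider an urn with $k$ balls, let $C$ be the number of distinct colors in it, and for an observed sample let $\Phi_j$ $(j\ge 1)$ be the number of colors seen exactly $j$ times and $\hat C_{\rm seen}=\sum_{j\ge1}\Phi_j$. In the Poisson sampling model, $N\sim\mathrm{Poi}(n)$ balls $(n>0)$ are drawn independently and uniformly with replacement, $N$ being independent of the draws, and their colors are observed. All logarithms are natural; $a\vee b=\max\{a,b\}$, $a\wedge b=\min\{a,b\}$. Given constants $\alpha,\beta>0$, let $L=\lfloor\alpha\log k\rfloor$, $M=\lceil\beta k\log k/n\rceil$, let $B$ be the $M\times L$ matrix with entries $B_{ij}=(i/M)^j$, $1\le i\le M$, $1\le j\le L$, and let $w^*\in\mathbb R^L$ be the minimizer of $\|Bw-\mathbf 1\|_2$ (the minimizer of least Euclidean norm if there are several, which happens only if $L>M$). Put $u_j=w^*_j\,j!\,\big(\tfrac{k}{nM}\big)^j$, $\tilde C=\hat C_{\rm seen}+\sum_{j=1}^L u_j\Phi_j$ and $\hat C=(\tilde C\vee\hat C_{\rm seen})\wedge k$. **Theorem.** (i) There are absolute constants $0<\alpha_0<\beta_0$ such that for all $0<\alpha\le\alpha_0$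 and $\beta\ge\beta_0$ there is a constant $c>0$, depending only on $\alpha$ and $\beta$, such that for all integers $k\ge1$, all real $n>0$ and every urn with $k$ balls, under Poisson sampling, $\mathbb E(\hat C-C)^2$ is well defined and at most $k^2$, and if moreover $n\log k\ge k$, then $$\mathbb E(\hat C-C)^2\le k^2\exp\Big(-c\Big(1\vee\Big(\frac{n\log k}{k}\wedge\log k\Big)\Big)\Big).$$ (ii) For all $\delta,c\in(0,\tfrac12)$ there is a constant $K>0$ such that for all integers $k\ge2$ and all real $\Delta$ with $k^{1/2+\delta}\le\Delta\le ck$, $$n^*(k,\Delta)\le K\,\frac{k}{\log k}\log\frac{k}{\Delta},$$ where $n^*(k,\Delta)$ is the least $m$ for which some integer-valued estimator $\hat C'$, based on the colors of $m$ balls drawn independently and uniformly with replacement, satisfies $\mathbb P[|\hat C'-C|\ge\Delta]\le 0.1$ for every urn with $k$ balls. -/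

import Mathlib

open MeasureTheory ProbabilityTheory
open scoped NNReal Nat Matrix

namespace DistinctElements

noncomputable section

/-! ### Urns and samples

An urn with `k` balls is a colouring `color : Fin k → ℕ` of the balls. -/

/-- The number `C` of distinct colours in the urn. -/
def numColors {k : ℕ} (color : Fin k → ℕ) : ℕ :=
  (Finset.univ.image color).card

/-- The Poisson sampling model: `N` has law `Poi(n)`, the balls `Y 0, Y 1, …` are drawn independently
and uniformly from the urn (with replacement), and `N` is independent of the sequence of draws.
The balls that are actually drawn are `Y 0, …, Y (N - 1)`. -/
structure IsPoissonSample {Ω : Type*} [MeasurableSpace Ω] (μ : Measure Ω) (k : ℕ) (n : ℝ≥0)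
    (N : Ω → ℕ) (Y : ℕ → Ω → Fin k) : Prop where
  measurable_size : Measurable N
  measurable_draw : ∀ t, Measurable (Y t)
  size_law : μ.map N = poissonMeasure n
  draw_law : ∀ t, μ.map (Y t) = uniformOn Set.univ
  indep_draws : iIndepFun Y μ
  indep_size : IndepFun N (fun ω t => Y t ω) μ

/-- The colours of the `N` balls that are drawn: all that the statistician observes. -/
def observed {Ω : Type*} {k : ℕ} (color : Fin k → ℕ) (N : Ω → ℕ) (Y : ℕ → Ω → Fin k) (ω : Ω) :
    Fin (N ω) → ℕ :=
  fun t => color (Y t ω)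

/-! ### Fingerprints -/

/-- The number of times that colour `a` appears in the sample `x`. -/
def histogram {m : ℕ} (x : Fin m → ℕ) (a : ℕ) : ℕ :=
  (Finset.univ.filter fun t => x t = a).card

/-- The fingerprint `Φ_j`, for `j ≥ 1`: the number of colours that appear exactly `j` times. -/
def fingerprint {m : ℕ} (x : Fin m → ℕ) (j : ℕ) : ℕ :=
  ((Finset.univ.image x).filter fun a => histogram x a = j).card

/-- `Ĉ_seen = ∑_{j ≥ 1} Φ_j`; in a sample of size `m` the terms with `j > m` vanish. -/
def seen {m : ℕ} (x : Fin m → ℕ) : ℕ :=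
  ∑ j ∈ Finset.Icc 1 m, fingerprint x j

/-! ### The discrete `ℓ₂`-approximation problem -/

/-- The `M × L` Vandermonde matrix `B` with entries `(i / M) ^ j`, `1 ≤ i ≤ M`, `1 ≤ j ≤ L`. -/
def vandermondeB (M L : ℕ) : Matrix (Fin M) (Fin L) ℝ :=
  Matrix.of fun i j => (((i : ℕ) + 1 : ℝ) / M) ^ ((j : ℕ) + 1)

/-- The Euclidean norm `‖B w - 1‖₂`. -/
def residual (M L : ℕ) (w : Fin L → ℝ) : ℝ :=
  ‖WithLp.toLp 2 (vandermondeB M L *ᵥ w - 1)‖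

/-- `w` attains `min_w ‖B w - 1‖₂`. -/
def IsMinimizer (M L : ℕ) (w : Fin L → ℝ) : Prop :=
  ∀ v : Fin L → ℝ, residual M L w ≤ residual M L v

/-- `w` is the minimizer of smallest Euclidean norm. If `L ≤ M` then the columns of `B` are linearly
independent and the minimizer is unique, so that the second condition is void. -/
def IsOptimal (M L : ℕ) (w : Fin L → ℝ) : Prop :=
  IsMinimizer M L w ∧ ∀ v : Fin L → ℝ, IsMinimizer M L v →
    ‖WithLp.toLp 2 w‖ ≤ ‖WithLp.toLp 2 v‖

theorem exists_isOptimal (M L : ℕ) : ∃ w : Fin L → ℝ, IsOptimal M L w := by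
  let T : EuclideanSpace ℝ (Fin L) →ₗ[ℝ] EuclideanSpace ℝ (Fin M) :=
    Matrix.toLpLin 2 2 (vandermondeB M L)
  let y : EuclideanSpace ℝ (Fin M) := WithLp.toLp 2 1
  have hres : ∀ w : EuclideanSpace ℝ (Fin L), residual M L (WithLp.ofLp w) = dist y (T w) := by
    intro w
    rw [dist_comm, dist_eq_norm]
    rfl
  have hT : Continuous T := T.continuous_of_finiteDimensional
  let S : Set (EuclideanSpace ℝ (Fin L)) := {w | ∀ v, dist y (T w) ≤ dist y (T v)}
  have hScl : IsClosed S := by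
    simp only [S, Set.ofPred_forall]
    exact isClosed_iInter fun v => isClosed_le (continuous_const.dist hT) continuous_const
  have hSne : S.Nonempty := by
    have hcl : IsClosed (LinearMap.range T : Set (EuclideanSpace ℝ (Fin M))) :=
      (LinearMap.range T).closed_of_finiteDimensional
    obtain ⟨p, ⟨w, rfl⟩, hp⟩ := hcl.exists_infDist_eq_dist ⟨T 0, ⟨0, rfl⟩⟩ y
    refine ⟨w, fun v => ?_⟩
    rw [← hp]
    exact Metric.infDist_le_dist_of_mem ⟨v, rfl⟩
  obtain ⟨w, hw, hd⟩ := hScl.exists_infDist_eq_dist hSne 0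
  refine ⟨WithLp.ofLp w, fun v => ?_, fun v hv => ?_⟩
  · have := hw (WithLp.toLp 2 v)
    rwa [← hres, ← hres] at this
  · have hmem : WithLp.toLp 2 v ∈ S := by
      intro z
      rw [← hres, ← hres]
      exact hv _
    have := Metric.infDist_le_dist_of_mem (x := 0) hmem
    rw [hd, dist_zero_left, dist_zero_left] at this
    exact this

/-- The coefficients `w*` of the `ℓ₂`-optimal polynomial `w*₁ x + ⋯ + w*_L x ^ L`; the entry with
index `i : Fin L` is the coefficient of `x ^ (i + 1)`. -/
def optimalW (M L : ℕ) : Fin L → ℝ :=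
  Classical.choose (exists_isOptimal M L)

/-! ### The estimator -/

/-- The degree `L = α log k`, rounded down to an integer. -/
def degreeL (α : ℝ) (k : ℕ) : ℕ :=
  ⌊α * Real.log k⌋₊

/-- The number of nodes `M = β k log k / n`, rounded up to an integer. -/
def nodesM (β : ℝ) (k : ℕ) (n : ℝ≥0) : ℕ :=
  ⌈β * k * Real.log k / n⌉₊

/-- The linear correction `Û = ∑_{j=1}^L u_j Φ_j` with `u_j = w*_j j! (k / (n M)) ^ j`. -/
def unseenEstimate (k : ℕ) (n : ℝ≥0) (M L : ℕ) {m : ℕ} (x : Fin m → ℕ) : ℝ :=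
  ∑ i : Fin L, optimalW M L i * ((i : ℕ) + 1)! * ((k : ℝ) / (n * M)) ^ ((i : ℕ) + 1) *
    fingerprint x ((i : ℕ) + 1)

/-- The estimator `Ĉ = ((Ĉ_seen + Û) ∨ Ĉ_seen) ∧ k`. -/
def estimator (α β : ℝ) (k : ℕ) (n : ℝ≥0) {m : ℕ} (x : Fin m → ℕ) : ℝ :=
  min (max (seen x + unseenEstimate k n (nodesM β k n) (degreeL α k) x) (seen x)) k

/-! ### Sample complexity -/

/-- `m` draws with replacement suffice: some integer-valued estimator that sees the colours of `m`
balls drawn independently and uniformly from the urn has `P[|Ĉ - C| ≥ Δ] ≤ 0.1` for every urn with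
`k` balls. The sample complexity `n*(k, Δ)` is the least such `m`. -/
def SampleSizeSuffices (k : ℕ) (Δ : ℝ) (m : ℕ) : Prop :=
  ∃ est : (Fin m → ℕ) → ℤ, ∀ color : Fin k → ℕ,
    (Measure.pi fun _ : Fin m => uniformOn (Set.univ : Set (Fin k))).real
      {y | Δ ≤ |(est fun t => color (y t) : ℝ) - numColors color|} ≤ 0.1

end

end DistinctElements

/-! Under Poisson sampling the counts of the colours are independent: a colour with k_a balls is
seen Poi(n k_a / k) times (`sum_poisson_smul_map_tally`). The unclamped estimator errs by a sum of
independent scores, -1 for an unseen colour and u_j for one seen j ≤ L times. The Poisson weights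
turn u_j into w_j x^j, so the mean error is -∑ exp(-n k_a / k) p(k_a / M) with p(x) = 1 - ∑ w_j x^j
(`integral_score`, `mul_colorRate`). The bias is thus governed by p on the grid 1/M, ..., 1 under
the constraint p(0) = 1, which is the least-squares problem. For colours with more than M balls the
exponential factor beats the growth of p (`exp_neg_mul_abs_eval_le`).

For L < M that problem has a closed solution. A Hahn-type polynomial Q of degree at most L
reproduces evaluation at 0: ∑_{y=1}^M Q(y) g(y) = g(0) for deg g ≤ L. Hence p(y/M) = Q(y)/Q(0) on
the grid and the minimum of the squared norm is 1/Q(0) (`IsMinimizer.eval_eq`,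
`IsMinimizer.sum_sq_eq`). Here Q(0) + 1 is a ratio of binomials that is at least exp((L+1)²/(2M)),
and (L+1)²/M is at least of order n log k / k. For M ≤ L the polynomial interpolates and only the
variance and the colours with more than M balls remain. A polynomial bounded on the grid has
coefficients of order exp(4L) (`sum_abs_optimalW_le`), so the variance is of order k^(1+8α) at most,
which is negligible for small α.

No constant is allowed in front of k², so a bounded exponent requires an error of at most (1-ε)k².
If C is small, so is the bias; if C is far from both 0 and k, clamping suffices; if C is close to k,
then most colours are singletons, for which p(1/M) is bounded below 1
(`exists_poissonMSE_le_one_sub_mul`). Small urns use that an error of size k requires an empty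
sample.

For part (ii) the Poissonized estimator is averaged over the random size N, rounded, and fed to
Markov's inequality. When log(k/Δ) is comparable to log k, linearly many draws are affordable and
put the estimator in the interpolating regime. -/

namespace DistinctElements

noncomputable section

section Approximation

open Polynomial

/-! ### Binomial convolutions and alternating sums -/

theorem sum_range_choose_right (n j : ℕ) :
    ∑ i ∈ Finset.range n, i.choose j = n.choose (j + 1) := by
  induction n with
  | zero => simp
  | succ n ih => rw [Finset.sum_range_succ, ih, Nat.choose_succ_succ, add_comm]

/-- The coefficient of x^n in (1-x)^(-(a+1)) (1-x)^(-(b+1)), obtained here from Pascal's rule by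
double induction. It evaluates the Hahn polynomial at 0. -/
theorem sum_antidiagonal_add_choose_mul_add_choose (n a b : ℕ) :
    ∑ p ∈ Finset.HasAntidiagonal.antidiagonal n, (p.1 + a).choose a * (p.2 + b).choose b =
      (n + a + b + 1).choose (a + b + 1) := by
  induction b generalizing n with
  | zero =>
    have := Nat.sum_range_add_choose n a
    rw [Finset.Nat.sum_antidiagonal_eq_sum_range_succ_mk]
    simpa using this
  | succ b ihb =>
    induction n with
    | zero => simp
    | succ n ihn =>
      have h1 := ihb (n + 1)
      rw [Finset.Nat.sum_antidiagonal_succ'] at h1 ⊢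
      have h2 : ∀ p : ℕ × ℕ, (p.1 + a).choose a * (p.2 + 1 + (b + 1)).choose (b + 1) =
          (p.1 + a).choose a * (p.2 + 1 + b).choose b +
            (p.1 + a).choose a * (p.2 + (b + 1)).choose (b + 1) := by
        intro p
        rw [← mul_add, show p.2 + 1 + (b + 1) = (p.2 + 1 + b) + 1 by ring, Nat.choose_succ_succ,
          show p.2 + 1 + b = p.2 + (b + 1) by ring]
      simp only [h2, Finset.sum_add_distrib, ihn]
      have h3 := Nat.choose_succ_succ (n + 1 + a + b + 1) (a + b + 1)
      rw [← h1] at h3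
      rw [show n + 1 + a + (b + 1) + 1 = (n + 1 + a + b + 1) + 1 by ring,
        show a + (b + 1) + 1 = (a + b + 1) + 1 by ring,
        show n + a + (b + 1) + 1 = n + 1 + a + b + 1 by ring, h3]
      simp
      ring

/-- The coefficient of x^n in x^j (1-x)^(-(j+2)) (1-x)^(-(s+1)). It computes the grid sums in the
orthogonality relation. -/
theorem sum_antidiagonal_succ_choose_mul_add_choose (n j s : ℕ) :
    ∑ p ∈ Finset.HasAntidiagonal.antidiagonal n, (p.1 + 1).choose (j + 1) * (p.2 + s).choose s =
      (n + s + 2).choose (j + s + 2) := by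
  induction s generalizing n with
  | zero =>
    have := Finset.sum_range_succ' (fun i => i.choose (j + 1)) (n + 1)
    rw [sum_range_choose_right] at this
    rw [Finset.Nat.sum_antidiagonal_eq_sum_range_succ_mk]
    simpa using this.symm
  | succ s ihs =>
    induction n with
    | zero =>
      rcases j with _ | j
      · simp
      · simp [Nat.choose_eq_zero_of_lt]
    | succ n ihn =>
      have h1 := ihs (n + 1)
      rw [Finset.Nat.sum_antidiagonal_succ'] at h1 ⊢
      have h2 : ∀ p : ℕ × ℕ, (p.1 + 1).choose (j + 1) * (p.2 + 1 + (s + 1)).choose (s + 1) =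
          (p.1 + 1).choose (j + 1) * (p.2 + 1 + s).choose s +
            (p.1 + 1).choose (j + 1) * (p.2 + (s + 1)).choose (s + 1) := by
        intro p
        rw [← mul_add, show p.2 + 1 + (s + 1) = (p.2 + 1 + s) + 1 by ring, Nat.choose_succ_succ (_ + _ + _),
          show p.2 + 1 + s = p.2 + (s + 1) by ring]
      simp only [h2, Finset.sum_add_distrib, ihn]
      have h3 := Nat.choose_succ_succ (n + 1 + s + 2) (j + s + 2)
      rw [← h1] at h3
      rw [show n + 1 + (s + 1) + 2 = (n + 1 + s + 2) + 1 by ring,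
        show j + (s + 1) + 2 = (j + s + 2) + 1 by ring,
        show n + (s + 1) + 2 = n + 1 + s + 2 by ring, h3]
      simp
      ring

/-- Up to sign the sum is the n-th finite difference of P at 0, which vanishes in degree below n. -/
theorem sum_neg_one_pow_mul_choose_mul_eval_eq_zero {P : ℝ[X]} {n : ℕ} (hP : P.natDegree < n) :
    ∑ j ∈ Finset.range (n + 1), (-1 : ℝ) ^ j * n.choose j * P.eval (j : ℝ) = 0 := by
  have h := congrFun (Polynomial.fwdDiff_iter_eq_zero_of_degree_lt hP) 0
  rw [fwdDiff_iter_eq_sum_shift] at h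
  have h2 : ∀ j ∈ Finset.range (n + 1), (-1 : ℝ) ^ j * n.choose j * P.eval (j : ℝ) =
      (-1) ^ n * (((-1 : ℤ) ^ (n - j) * (n.choose j : ℤ)) • P.eval ((0 : ℝ) + j • (1 : ℝ))) := by
    intro j hj
    have hj' : j ≤ n := by simpa [Nat.lt_succ_iff] using hj
    have e : (-1 : ℝ) ^ j = (-1) ^ n * (-1) ^ (n - j) := by
      rw [← pow_add]
      obtain ⟨d, rfl⟩ := Nat.exists_eq_add_of_le hj'
      rw [Nat.add_sub_cancel_left, add_assoc, pow_add, ← two_mul, pow_mul]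
      simp
    rw [e]
    simp
    ring
  rw [Finset.sum_congr rfl h2, ← Finset.mul_sum, h]
  simp

/-- A linear functional that kills one polynomial of each degree below `L` kills all polynomials of
degree less than `L`. -/
theorem linearMap_eq_zero_of_natDegree_lt (F : ℝ[X] →ₗ[ℝ] ℝ) (e : ℕ → ℝ[X]) {L : ℕ}
    (hdeg : ∀ s < L, (e s).natDegree = s) (hne : ∀ s < L, e s ≠ 0) (h0 : ∀ s < L, F (e s) = 0) :
    ∀ p : ℝ[X], p.natDegree < L → F p = 0 := by
  intro p
  induction hn : p.natDegree using Nat.strong_induction_on generalizing p with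
  | _ n ih =>
    intro hp
    have hlead : (e n).leadingCoeff ≠ 0 := by simpa using hne n hp
    set c := p.leadingCoeff / (e n).leadingCoeff with hc
    have hF : F p = F (p - c • e n) := by simp [h0 n hp]
    rw [hF]
    by_cases hz : p - c • e n = 0
    · simp [hz]
    by_cases hp0 : p = 0
    · simp [hp0, h0 n hp]
    rcases Nat.eq_zero_or_pos n with rfl | hn0
    · exfalso
      apply hz
      rw [Polynomial.eq_C_of_natDegree_eq_zero hn, Polynomial.eq_C_of_natDegree_eq_zero
        (hdeg 0 hp), hc]
      have h1 : p.leadingCoeff = p.coeff 0 := by simp [leadingCoeff, hn]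
      have h2 : (e 0).leadingCoeff = (e 0).coeff 0 := by simp [leadingCoeff, hdeg 0 hp]
      rw [h1, h2]
      rw [h2] at hlead
      rw [smul_C, smul_eq_mul, div_mul_cancel₀ _ hlead, sub_self]
    have hlt : (p - c • e n).natDegree < n := by
      have hle : (p - c • e n).natDegree ≤ n := by
        refine (natDegree_sub_le _ _).trans (max_le hn.le ?_)
        exact (natDegree_smul_le _ _).trans (hdeg n hp).le
      refine lt_of_le_of_ne hle fun heq => hz ?_
      rw [← leadingCoeff_eq_zero, leadingCoeff, heq, coeff_sub, coeff_smul]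
      have h1 : p.coeff n = p.leadingCoeff := by rw [leadingCoeff, hn]
      have h2 : (e n).coeff n = (e n).leadingCoeff := by rw [leadingCoeff, hdeg n hp]
      rw [h1, h2, hc, smul_eq_mul, div_mul_cancel₀ _ hlead, sub_self]
    exact ih _ hlt _ rfl (hlt.trans hp)

/-! ### The Hahn polynomial that solves the discrete approximation problem -/

/-- Absolute values of the coefficients of the kernel in the Newton basis C(y, j), where the grid
point is x = y + 1. -/
def hahnCoeff (M L j : ℕ) : ℝ :=
  (L + 1).choose (j + 1) * (L + 1 + j).choose (j + 1) / M.choose (j + 1)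

/-- For L < M this is the reproducing kernel at 0 on the unscaled grid {1, ..., M}: its sum is 1 and
it is orthogonal to x g(x) for deg g < L, so pairing with any g of degree at most L returns g(0). -/
def hahnPoly (M L : ℕ) : ℝ[X] :=
  ∑ j ∈ Finset.range (L + 1),
    C ((-1) ^ j * hahnCoeff M L j / j !) * (descPochhammer ℝ j).comp (X - 1)

/-- For L < M, one more than the value of the kernel at 0. -/
def hahnRatio (M L : ℕ) : ℝ :=
  (M + L + 1).choose (L + 1) / M.choose (L + 1)

theorem natDegree_hahnPoly_le (M L : ℕ) : (hahnPoly M L).natDegree ≤ L := by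
  refine natDegree_sum_le_of_forall_le _ _ fun j hj => ?_
  refine (natDegree_C_mul_le _ _).trans (natDegree_comp_le.trans ?_)
  rw [descPochhammer_natDegree, show (X - 1 : ℝ[X]) = X - C 1 by simp, natDegree_X_sub_C]
  have := Finset.mem_range.1 hj
  omega

theorem eval_hahnPoly_succ (M L y : ℕ) :
    (hahnPoly M L).eval ((y : ℝ) + 1) =
      ∑ j ∈ Finset.range (L + 1), (-1) ^ j * hahnCoeff M L j * y.choose j := by
  rw [hahnPoly, eval_finsetSum]
  refine Finset.sum_congr rfl fun j _ => ?_
  have : (j ! : ℝ) ≠ 0 := by positivity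
  simp only [eval_mul, eval_C, eval_comp, eval_sub, eval_X, eval_one, add_sub_cancel_right,
    descPochhammer_eval_eq_descFactorial, Nat.descFactorial_eq_factorial_mul_choose]
  push_cast
  field_simp

theorem eval_hahnPoly_zero_eq_sum (M L : ℕ) :
    (hahnPoly M L).eval 0 = ∑ j ∈ Finset.range (L + 1), hahnCoeff M L j := by
  rw [hahnPoly, eval_finsetSum]
  refine Finset.sum_congr rfl fun j _ => ?_
  have : (j ! : ℝ) ≠ 0 := by positivity
  simp only [eval_mul, eval_C, eval_comp, eval_sub, eval_X, eval_one, zero_sub]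
  -- Since C(-1, j) = (-1)^j, the alternating signs cancel and the value at 0 is a sum of
  -- nonnegative terms.
  have h2 : (descPochhammer ℝ j).eval (-1) = (-1) ^ j * j ! := by
    rw [descPochhammer_eval_eq_prod_range, ← Finset.prod_range_add_one_eq_factorial]
    push_cast
    have h1 : (-1 : ℝ) ^ j = ∏ _i ∈ Finset.range j, (-1 : ℝ) := by simp
    rw [h1, ← Finset.prod_mul_distrib]
    exact Finset.prod_congr rfl fun i _ => by ring
  rw [h2]
  have h3 : ((-1 : ℝ) ^ j) * (-1) ^ j = 1 := by rw [← mul_pow]; simp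
  field_simp
  linear_combination (hahnCoeff M L j) * h3

/-- With t = j + 1 and an extra term 1 at t = 0, trinomial revision C(M,L+1) C(L+1,t) = C(M,t)
C(M-t,L+1-t) brings everything over the denominator C(M,L+1); the numerators form a convolution. -/
theorem sum_hahnCoeff {M L : ℕ} (h : L < M) :
    ∑ j ∈ Finset.range (L + 1), hahnCoeff M L j = hahnRatio M L - 1 := by
  have hM : (M.choose (L + 1) : ℝ) ≠ 0 := by exact_mod_cast (Nat.choose_pos h).ne'
  have hterm : ∀ t ∈ Finset.range (L + 2),
      ((L + 1).choose t * (L + t).choose t / M.choose t : ℝ) =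
        ((t + L).choose L * (L + 1 - t + (M - L - 1)).choose (M - L - 1) : ℕ) /
          M.choose (L + 1) := by
    intro t ht
    have ht' : t ≤ L + 1 := by have := Finset.mem_range.1 ht; omega
    have h1 := Nat.choose_mul (n := M) ht'
    have h2 : (M - t).choose (L + 1 - t) = (L + 1 - t + (M - L - 1)).choose (M - L - 1) := by
      rw [show M - t = L + 1 - t + (M - L - 1) by omega]
      exact Nat.choose_symm_add
    have h3 : (L + t).choose t = (t + L).choose L := by
      rw [add_comm L t]; exact Nat.choose_symm_add
    have hMt : (M.choose t : ℝ) ≠ 0 := by exact_mod_cast (Nat.choose_pos (by omega)).ne'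
    have h1' : (M.choose (L + 1) : ℝ) * (L + 1).choose t =
        M.choose t * (L + 1 - t + (M - L - 1)).choose (M - L - 1) := by
      rw [← h2]; exact_mod_cast h1
    rw [h3]
    push_cast
    field_simp
    linear_combination ((t + L).choose L : ℝ) * h1'
  have hsum := Finset.sum_congr rfl hterm
  rw [← Finset.sum_div, ← Nat.cast_sum] at hsum
  have hconv := sum_antidiagonal_add_choose_mul_add_choose (L + 1) L (M - L - 1)
  rw [Finset.Nat.sum_antidiagonal_eq_sum_range_succ_mk] at hconv
  simp only at hconv
  rw [hconv, Finset.sum_range_succ'] at hsum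
  have e : (L + 1 + L + (M - L - 1) + 1).choose (L + (M - L - 1) + 1) =
      (M + L + 1).choose (L + 1) := by
    rw [show L + 1 + L + (M - L - 1) + 1 = (L + 1) + M by omega,
      show L + (M - L - 1) + 1 = M by omega, show M + L + 1 = L + 1 + M by ring]
    exact Nat.choose_symm_add.symm
  rw [e] at hsum
  rw [hahnRatio, ← hsum]
  simp [hahnCoeff, add_comm, add_left_comm]

theorem eval_hahnPoly_zero {M L : ℕ} (h : L < M) :
    (hahnPoly M L).eval 0 = hahnRatio M L - 1 := by
  rw [eval_hahnPoly_zero_eq_sum, sum_hahnCoeff h]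

theorem eval_hahnPoly_one (M L : ℕ) :
    (hahnPoly M L).eval 1 = ((L : ℝ) + 1) ^ 2 / M := by
  have := eval_hahnPoly_succ M L 0
  rw [Finset.sum_range_succ'] at this
  simp [hahnCoeff] at this
  rw [this]
  ring

/-- Summing C(y, j) over the grid gives C(M, j+1), which cancels the denominator of `hahnCoeff`.
What remains is an (L+1)-th difference of (x+1)⋯(x+L), which is zero, without its t = 0 term. -/
theorem sum_eval_hahnPoly {M L : ℕ} (h : L < M) :
    ∑ y ∈ Finset.range M, (hahnPoly M L).eval ((y : ℝ) + 1) = 1 := by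
  simp_rw [eval_hahnPoly_succ]
  rw [Finset.sum_comm]
  have h1 : ∀ j ∈ Finset.range (L + 1),
      ∑ y ∈ Finset.range M, (-1 : ℝ) ^ j * hahnCoeff M L j * y.choose j =
        (-1) ^ j * (L + 1).choose (j + 1) * (L + 1 + j).choose (j + 1) := by
    intro j hj
    have hj' : j + 1 ≤ M := by have := Finset.mem_range.1 hj; omega
    have hM : (M.choose (j + 1) : ℝ) ≠ 0 := by exact_mod_cast (Nat.choose_pos hj').ne'
    rw [← Finset.mul_sum, ← Nat.cast_sum, sum_range_choose_right, hahnCoeff]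
    field_simp
  rw [Finset.sum_congr rfl h1]
  have h2 := sum_neg_one_pow_mul_choose_mul_eval_eq_zero (n := L + 1)
    (P := (ascPochhammer ℝ L).comp (X + 1)) (by
      rw [natDegree_comp, ascPochhammer_natDegree, show (X + 1 : ℝ[X]) = X + C 1 by simp,
        natDegree_X_add_C]
      omega)
  have h3 : ∀ j : ℕ, ((ascPochhammer ℝ L).comp (X + 1)).eval (j : ℝ) =
      L ! * (L + j).choose j := by
    intro j
    have : ((ascPochhammer ℝ L).comp (X + 1)).eval (j : ℝ) =
        (ascPochhammer ℝ L).eval ((j + 1 : ℕ) : ℝ) := by simp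
    rw [this, ascPochhammer_nat_eq_natCast_ascFactorial, Nat.ascFactorial_eq_factorial_mul_choose,
      add_comm j L, Nat.choose_symm_add]
    push_cast
    ring
  simp_rw [h3] at h2
  rw [Finset.sum_range_succ'] at h2
  have hL : (L ! : ℝ) ≠ 0 := by positivity
  have h4 : ∑ j ∈ Finset.range (L + 1), (-1 : ℝ) ^ (j + 1) * (L + 1).choose (j + 1) *
      (L ! * (L + (j + 1)).choose (j + 1)) =
      - (L ! * ∑ j ∈ Finset.range (L + 1), (-1 : ℝ) ^ j * (L + 1).choose (j + 1) *
        (L + 1 + j).choose (j + 1)) := by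
    rw [Finset.mul_sum, ← Finset.sum_neg_distrib]
    refine Finset.sum_congr rfl fun j _ => ?_
    rw [show L + (j + 1) = L + 1 + j by ring]
    ring
  rw [h4] at h2
  simp at h2
  have h5 : (L ! : ℝ) * (∑ j ∈ Finset.range (L + 1), (-1 : ℝ) ^ j * (L + 1).choose (j + 1) *
        (L + 1 + j).choose (j + 1)) = L ! * 1 := by linarith
  exact mul_left_cancel₀ hL h5

/-- The point is the dependence on j: after summation over the grid it is C(L, j) times a polynomial
in j of degree L-1-s < L, so the alternating sum over j vanishes. -/
theorem hahnCoeff_mul_choose {M L s j : ℕ} (h : L < M) (hs : s < L) (hj : j ≤ L) :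
    hahnCoeff M L j * ((j + 1) * (M - 1 + s + 2).choose (j + s + 2)) =
      ((L + 1) * (M + s + 1)! / (M ! * L !)) * (L.choose j *
        ((ascPochhammer ℝ (L - 1 - s)).comp (X + C (s + 3 : ℝ))).eval (j : ℝ)) := by
  obtain ⟨r, hr⟩ : ∃ r, L = s + 1 + r := ⟨L - s - 1, by omega⟩
  obtain ⟨d, hd⟩ : ∃ d, L = j + d := ⟨L - j, by omega⟩
  obtain ⟨e, rfl⟩ : ∃ e, M = L + 1 + e := ⟨M - L - 1, by omega⟩
  have h1 : ((ascPochhammer ℝ (L - 1 - s)).comp (X + C (s + 3 : ℝ))).eval (j : ℝ) =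
      (L + 1 + j)! / (j + s + 2)! := by
    have : ((ascPochhammer ℝ (L - 1 - s)).comp (X + C (s + 3 : ℝ))).eval (j : ℝ) =
        (ascPochhammer ℝ r).eval ((j + s + 2 + 1 : ℕ) : ℝ) := by
      rw [show L - 1 - s = r by omega]
      simp
      congr 1
      ring
    rw [this, ascPochhammer_nat_eq_natCast_ascFactorial, eq_div_iff (by positivity)]
    rw [mul_comm]
    have := Nat.factorial_mul_ascFactorial (j + s + 2) r
    rw [show j + s + 2 + r = L + 1 + j by omega] at this
    exact_mod_cast this
  rw [h1, hahnCoeff, Nat.cast_choose ℝ (show j + 1 ≤ L + 1 by omega),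
    Nat.cast_choose ℝ (show j + 1 ≤ L + 1 + j by omega),
    Nat.cast_choose ℝ (show j + 1 ≤ L + 1 + e by omega),
    Nat.cast_choose ℝ (show j + s + 2 ≤ L + 1 + e - 1 + s + 2 by omega),
    Nat.cast_choose ℝ hj,
    show L + 1 + e - 1 + s + 2 = L + 1 + e + s + 1 by omega,
    show L + 1 + e + s + 1 - (j + s + 2) = L + e - j by omega,
    show L + 1 + e - (j + 1) = L + e - j by omega,
    show L + 1 - (j + 1) = L - j by omega, show L + 1 + j - (j + 1) = L by omega,
    Nat.factorial_succ L, Nat.factorial_succ j]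
  push_cast
  field_simp

/-- It suffices to test rising factorials of M + 1 - x, which at x = y + 1 equal s! C(M-1-y+s, s).
The extra factor x turns C(y, j) into (j+1) C(y+1, j+1), and the convolution identity applies. -/
theorem sum_eval_hahnPoly_mul_eq_zero {M L : ℕ} (h : L < M) {g : ℝ[X]} (hg : g.natDegree < L) :
    ∑ y ∈ Finset.range M, (hahnPoly M L).eval ((y : ℝ) + 1) * (((y : ℝ) + 1) *
      g.eval ((y : ℝ) + 1)) = 0 := by
  let F : ℝ[X] →ₗ[ℝ] ℝ := ∑ y ∈ Finset.range M,
    ((hahnPoly M L).eval ((y : ℝ) + 1) * ((y : ℝ) + 1)) • Polynomial.leval ((y : ℝ) + 1)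
  have hF : ∀ p, F p = ∑ y ∈ Finset.range M, (hahnPoly M L).eval ((y : ℝ) + 1) * (((y : ℝ) + 1) *
      p.eval ((y : ℝ) + 1)) := by
    intro p
    simp [F, mul_assoc, LinearMap.sum_apply]
  rw [← hF]
  have hdeg1 : (C ((M : ℝ) + 1) - X : ℝ[X]).natDegree = 1 := by
    rw [← neg_sub, natDegree_neg, natDegree_X_sub_C]
  have hdeg : ∀ s, ((ascPochhammer ℝ s).comp (C ((M : ℝ) + 1) - X)).natDegree = s := by
    intro s
    rw [natDegree_comp, ascPochhammer_natDegree, hdeg1, mul_one]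
  refine linearMap_eq_zero_of_natDegree_lt F
    (fun s => (ascPochhammer ℝ s).comp (C ((M : ℝ) + 1) - X)) (fun s _ => hdeg s) ?_ ?_ g hg
  · intro s _ h0
    rcases Nat.eq_zero_or_pos s with rfl | hs
    · simp at h0
    · have := hdeg s
      simp only [h0, natDegree_zero] at this
      omega
  · intro s hs
    rw [hF]
    have h1 : ∀ y ∈ Finset.range M, (hahnPoly M L).eval ((y : ℝ) + 1) * (((y : ℝ) + 1) *
        ((ascPochhammer ℝ s).comp (C ((M : ℝ) + 1) - X)).eval ((y : ℝ) + 1)) =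
        ∑ j ∈ Finset.range (L + 1), (-1) ^ j * hahnCoeff M L j * (s ! * ((j + 1) *
          ((y + 1).choose (j + 1) * (M - 1 - y + s).choose s : ℕ))) := by
      intro y hy
      have hy' : y + 1 ≤ M := Finset.mem_range.1 hy
      rw [eval_hahnPoly_succ, Finset.sum_mul]
      refine Finset.sum_congr rfl fun j _ => ?_
      have e1 : ((ascPochhammer ℝ s).comp (C ((M : ℝ) + 1) - X)).eval ((y : ℝ) + 1) =
          (ascPochhammer ℝ s).eval ((M - 1 - y + 1 : ℕ) : ℝ) := by
        rw [eval_comp]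
        congr 1
        simp only [eval_sub, eval_C, eval_X]
        rw [show M - 1 - y + 1 = M - y by omega, Nat.cast_sub (by omega)]
        ring
      have e2 : ((y : ℝ) + 1) * y.choose j = (y + 1).choose (j + 1) * (j + 1) := by
        exact_mod_cast Nat.add_one_mul_choose_eq y j
      rw [e1, ascPochhammer_nat_eq_natCast_ascFactorial, Nat.ascFactorial_eq_factorial_mul_choose]
      push_cast
      linear_combination ((-1) ^ j * hahnCoeff M L j * (s ! * (M - 1 - y + s).choose s)) * e2
    rw [Finset.sum_congr rfl h1, Finset.sum_comm]
    have hconv : ∀ j, ∑ y ∈ Finset.range M,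
        (y + 1).choose (j + 1) * (M - 1 - y + s).choose s = (M - 1 + s + 2).choose (j + s + 2) := by
      intro j
      have := sum_antidiagonal_succ_choose_mul_add_choose (M - 1) j s
      rw [Finset.Nat.sum_antidiagonal_eq_sum_range_succ_mk] at this
      rw [← this, show (M - 1).succ = M by omega]
    have h2 : ∀ j ∈ Finset.range (L + 1), ∑ y ∈ Finset.range M,
        (-1) ^ j * hahnCoeff M L j * (s ! * ((j + 1) *
          ((y + 1).choose (j + 1) * (M - 1 - y + s).choose s : ℕ))) =
        (s ! * ((L + 1) * (M + s + 1)! / (M ! * L !))) * ((-1) ^ j * L.choose j *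
          ((ascPochhammer ℝ (L - 1 - s)).comp (X + C (s + 3 : ℝ))).eval (j : ℝ)) := by
      intro j hj
      have hj' : j ≤ L := by have := Finset.mem_range.1 hj; omega
      rw [← Finset.mul_sum, ← Finset.mul_sum, ← Finset.mul_sum, ← Nat.cast_sum, hconv]
      linear_combination ((-1) ^ j * (s ! : ℝ)) * hahnCoeff_mul_choose h hs hj'
    rw [Finset.sum_congr rfl h2, ← Finset.mul_sum,
      sum_neg_one_pow_mul_choose_mul_eval_eq_zero, mul_zero]
    rw [natDegree_comp, ascPochhammer_natDegree, natDegree_X_add_C]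
    omega

/-! ### The optimal polynomial -/

/-- The polynomial `1 - w₁ x - ⋯ - w_L x ^ L`. -/
def fitPoly {L : ℕ} (w : Fin L → ℝ) : ℝ[X] :=
  1 - ∑ i : Fin L, C (w i) * X ^ ((i : ℕ) + 1)

theorem eval_fitPoly {L : ℕ} (w : Fin L → ℝ) (x : ℝ) :
    (fitPoly w).eval x = 1 - ∑ i : Fin L, w i * x ^ ((i : ℕ) + 1) := by
  simp [fitPoly, eval_finsetSum]

theorem eval_zero_fitPoly {L : ℕ} (w : Fin L → ℝ) : (fitPoly w).eval 0 = 1 := by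
  simp [eval_fitPoly]

theorem natDegree_fitPoly_le {L : ℕ} (w : Fin L → ℝ) : (fitPoly w).natDegree ≤ L := by
  refine (natDegree_sub_le _ _).trans (max_le (by simp) ?_)
  refine natDegree_sum_le_of_forall_le _ _ fun i _ => ?_
  exact (natDegree_C_mul_X_pow_le _ _).trans i.2

theorem coeff_fitPoly {L : ℕ} (w : Fin L → ℝ) (i : Fin L) :
    (fitPoly w).coeff ((i : ℕ) + 1) = -w i := by
  simp only [fitPoly, coeff_sub, coeff_one, finsetSum_coeff, coeff_C_mul, coeff_X_pow]
  simp [Fin.val_inj]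

theorem exists_fitPoly_eq {L : ℕ} {p : ℝ[X]} (hp : p.natDegree ≤ L) (h0 : p.eval 0 = 1) :
    ∃ v : Fin L → ℝ, fitPoly v = p := by
  refine ⟨fun i => -p.coeff ((i : ℕ) + 1), ?_⟩
  ext j
  rcases j with _ | j
  · rw [coeff_zero_eq_eval_zero, coeff_zero_eq_eval_zero, eval_zero_fitPoly, h0]
  · by_cases hj : j < L
    · have := coeff_fitPoly (fun i : Fin L => -p.coeff ((i : ℕ) + 1)) ⟨j, hj⟩
      simpa using this
    · rw [coeff_eq_zero_of_natDegree_lt, coeff_eq_zero_of_natDegree_lt]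
      · omega
      · have := natDegree_fitPoly_le (fun i : Fin L => -p.coeff ((i : ℕ) + 1))
        omega

theorem residual_sq (M L : ℕ) (w : Fin L → ℝ) :
    residual M L w ^ 2 = ∑ y ∈ Finset.range M, (fitPoly w).eval (((y : ℝ) + 1) / M) ^ 2 := by
  rw [residual, EuclideanSpace.norm_sq_eq, Finset.sum_range]
  refine Finset.sum_congr rfl fun i _ => ?_
  rw [Real.norm_eq_abs, sq_abs, eval_fitPoly]
  simp only [Pi.sub_apply, Pi.one_apply, Matrix.mulVec, dotProduct, vandermondeB, Matrix.of_apply]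
  rw [← neg_sq, neg_sub]
  simp only [mul_comm]

theorem IsMinimizer.sum_sq_le {M L : ℕ} {w : Fin L → ℝ} (hw : IsMinimizer M L w)
    (v : Fin L → ℝ) :
    ∑ y ∈ Finset.range M, (fitPoly w).eval (((y : ℝ) + 1) / M) ^ 2 ≤
      ∑ y ∈ Finset.range M, (fitPoly v).eval (((y : ℝ) + 1) / M) ^ 2 := by
  rw [← residual_sq, ← residual_sq]
  exact pow_le_pow_left₀ (norm_nonneg _) (hw v) 2

/-! ### Lower bounds for the kernel at 0 -/

theorem hahnRatio_ge {M L : ℕ} (h : L < M) :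
    (1 + ((L : ℝ) + 1) / M) ^ (L + 1) ≤ hahnRatio M L := by
  have hM : (0 : ℝ) < M := by exact_mod_cast (Nat.zero_lt_of_lt h)
  -- Both binomials are falling factorials over (L+1)!, and the quotient of the factors with index i
  -- is 1 + (L+1)/(M-i).
  have h1 : hahnRatio M L =
      ∏ i ∈ Finset.range (L + 1), (1 + ((L : ℝ) + 1) / ((M - i : ℕ) : ℝ)) := by
    have e1 : ((M + L + 1).choose (L + 1) : ℝ) * (L + 1)! =
        ∏ i ∈ Finset.range (L + 1), ((M + L + 1 - i : ℕ) : ℝ) := by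
      rw [← Nat.cast_prod, ← Nat.descFactorial_eq_prod_range,
        Nat.descFactorial_eq_factorial_mul_choose]
      push_cast
      ring
    have e2 : (M.choose (L + 1) : ℝ) * (L + 1)! =
        ∏ i ∈ Finset.range (L + 1), ((M - i : ℕ) : ℝ) := by
      rw [← Nat.cast_prod, ← Nat.descFactorial_eq_prod_range,
        Nat.descFactorial_eq_factorial_mul_choose]
      push_cast
      ring
    have hf : ((L + 1)! : ℝ) ≠ 0 := by positivity
    rw [hahnRatio, ← mul_div_mul_right _ _ hf, e1, e2, ← Finset.prod_div_distrib]
    refine Finset.prod_congr rfl fun i hi => ?_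
    have hi' : i < M := by have := Finset.mem_range.1 hi; omega
    have hpos : ((M - i : ℕ) : ℝ) ≠ 0 := by
      have : M - i ≠ 0 := by omega
      exact_mod_cast this
    rw [show M + L + 1 - i = (M - i) + (L + 1) by omega]
    push_cast
    field_simp
  rw [h1, ← Finset.card_range (L + 1), ← Finset.prod_const, Finset.card_range]
  refine Finset.prod_le_prod (fun i _ => by positivity) fun i hi => ?_
  have hi' : i < M := by have := Finset.mem_range.1 hi; omega
  have hpos : (0 : ℝ) < ((M - i : ℕ) : ℝ) := by
    have : 0 < M - i := by omega
    exact_mod_cast this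
  have hle : ((M - i : ℕ) : ℝ) ≤ M := by exact_mod_cast Nat.sub_le _ _
  gcongr

theorem one_lt_hahnRatio {M L : ℕ} (h : L < M) : 1 < hahnRatio M L := by
  refine lt_of_lt_of_le ?_ (hahnRatio_ge h)
  have hM : (0 : ℝ) < M := by exact_mod_cast (Nat.zero_lt_of_lt h)
  refine one_lt_pow₀ ?_ (by omega)
  have : 0 < ((L : ℝ) + 1) / M := by positivity
  linarith

theorem exp_half_le_one_add {x : ℝ} (h0 : 0 ≤ x) (h1 : x ≤ 1) : Real.exp (x / 2) ≤ 1 + x := by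
  have h2 : 1 - x / 2 ≤ Real.exp (-(x / 2)) := by
    have := Real.add_one_le_exp (-(x / 2)); linarith
  have h3 : 0 < 1 - x / 2 := by linarith
  have h4 : Real.exp (x / 2) * Real.exp (-(x / 2)) = 1 := by rw [← Real.exp_add]; simp
  have h5 := Real.exp_pos (x / 2)
  have h6 : Real.exp (x / 2) * (1 - x / 2) ≤ 1 := by
    exact (mul_le_mul_of_nonneg_left h2 h5.le).trans h4.le
  nlinarith

theorem exp_le_hahnRatio {M L : ℕ} (h : L < M) :
    Real.exp (((L : ℝ) + 1) ^ 2 / (2 * M)) ≤ hahnRatio M L := by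
  have hM : (0 : ℝ) < M := by exact_mod_cast (Nat.zero_lt_of_lt h)
  have hLM : (L : ℝ) + 1 ≤ M := by exact_mod_cast h
  refine le_trans ?_ (hahnRatio_ge h)
  have h1 := exp_half_le_one_add (x := ((L : ℝ) + 1) / M) (by positivity)
    ((div_le_one hM).2 hLM)
  refine le_trans (le_of_eq ?_) (pow_le_pow_left₀ (Real.exp_pos _).le h1 (L + 1))
  rw [← Real.exp_nat_mul]
  congr 1
  push_cast
  field_simp

/-- Keep only the terms j = 0, 1 of the nonnegative sum for the value at 0. The first is s =
(L+1)²/M, which is also the value of the kernel at 1; the second provides the strict gap between the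
two values. -/
theorem hahnRatio_sub_one_ge {M L : ℕ} (hL : 1 ≤ L) (h : L < M) :
    ((L : ℝ) + 1) ^ 2 / M * (1 + 3 / 8 * (((L : ℝ) + 1) ^ 2 / M)) ≤ hahnRatio M L - 1 := by
  have hM : (1 : ℝ) < M := by exact_mod_cast (lt_of_le_of_lt hL h)
  have hL1 : (1 : ℝ) ≤ L := by exact_mod_cast hL
  have hn : ∀ j, 0 ≤ hahnCoeff M L j := fun j => by unfold hahnCoeff; positivity
  have h1 : ∑ j ∈ Finset.range 2, hahnCoeff M L j ≤ hahnRatio M L - 1 := by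
    rw [← sum_hahnCoeff h]
    exact Finset.sum_le_sum_of_subset_of_nonneg (Finset.range_subset_range.2 (by omega))
      fun j _ _ => hn j
  refine le_trans ?_ h1
  have e0 : hahnCoeff M L 0 = ((L : ℝ) + 1) ^ 2 / M := by
    simp [hahnCoeff]
    ring
  have e1 : hahnCoeff M L 1 = ((L : ℝ) + 1) ^ 2 / M * (L * (L + 2) / (2 * (M - 1))) := by
    have hM1 : (M : ℝ) - 1 ≠ 0 := by linarith
    simp only [hahnCoeff, Nat.reduceAdd, Nat.cast_choose_two]
    push_cast
    field_simp
    ring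
  rw [Finset.sum_range_succ, Finset.sum_range_one, e0, e1, mul_add, mul_one]
  refine add_le_add le_rfl (mul_le_mul_of_nonneg_left ?_ (by positivity))
  rw [← mul_div_assoc, div_le_div_iff₀ (by linarith) (by linarith)]
  have h3 : 3 / 4 * ((L : ℝ) + 1) ^ 2 ≤ L * (L + 2) := by nlinarith
  nlinarith [mul_le_mul_of_nonneg_right h3 (by linarith : (0 : ℝ) ≤ M), sq_nonneg ((L : ℝ) + 1)]

/-! ### Exact solution of the least-squares problem -/

/-- Pythagoras: the normalized kernel is admissible, and any other admissible polynomial differs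
from it by some x g(x) with deg g < L, which is orthogonal to it on the grid. Minimality forces x
g(x) to vanish there. -/
theorem IsMinimizer.eval_eq {M L : ℕ} (h : L < M) {w : Fin L → ℝ} (hw : IsMinimizer M L w)
    {y : ℕ} (hy : y < M) :
    (fitPoly w).eval (((y : ℝ) + 1) / M) =
      (hahnPoly M L).eval ((y : ℝ) + 1) / (hahnRatio M L - 1) := by
  have hM : (M : ℝ) ≠ 0 := by exact_mod_cast (Nat.zero_lt_of_lt h).ne'
  have hR : hahnRatio M L - 1 ≠ 0 := (sub_pos.2 (one_lt_hahnRatio h)).ne'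
  obtain ⟨v, hv⟩ := exists_fitPoly_eq (L := L)
    (p := C (1 / (hahnRatio M L - 1)) * (hahnPoly M L).comp (C (M : ℝ) * X)) (by
      refine (natDegree_C_mul_le _ _).trans (natDegree_comp_le.trans ?_)
      rw [natDegree_C_mul_X _ hM, mul_one]
      exact natDegree_hahnPoly_le M L) (by
      simp [eval_comp, eval_hahnPoly_zero h, hR])
  have hve : ∀ z : ℕ, (fitPoly v).eval (((z : ℝ) + 1) / M) =
      (hahnPoly M L).eval ((z : ℝ) + 1) / (hahnRatio M L - 1) := by
    intro z
    rw [hv]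
    simp only [eval_mul, eval_C, eval_comp, eval_X, mul_div_cancel₀ _ hM]
    ring
  rcases Nat.eq_zero_or_pos L with rfl | hL
  · rw [← hve, Subsingleton.elim w v]
  obtain ⟨g, hg⟩ : X ∣ fitPoly w - fitPoly v := by
    rw [X_dvd_iff, coeff_sub, coeff_zero_eq_eval_zero, coeff_zero_eq_eval_zero,
      eval_zero_fitPoly, eval_zero_fitPoly, sub_self]
  have hgdeg : g.natDegree < L := by
    have h1 : (fitPoly w - fitPoly v).natDegree ≤ L :=
      (natDegree_sub_le _ _).trans (max_le (natDegree_fitPoly_le w) (natDegree_fitPoly_le v))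
    by_cases hg0 : g = 0
    · simpa [hg0] using hL
    rw [hg, natDegree_X_mul hg0] at h1
    omega
  have hd : ∀ z : ℝ, (fitPoly w).eval z = (fitPoly v).eval z + z * g.eval z := by
    intro z
    have := congrArg (eval z) hg
    simp only [eval_sub, eval_mul, eval_X] at this
    linarith
  have hcross : ∑ z ∈ Finset.range M, (fitPoly v).eval (((z : ℝ) + 1) / M) *
      (((z : ℝ) + 1) / M * g.eval (((z : ℝ) + 1) / M)) = 0 := by
    have h1 := sum_eval_hahnPoly_mul_eq_zero h (g := g.comp (C (1 / (M : ℝ)) * X)) (by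
      refine lt_of_le_of_lt natDegree_comp_le ?_
      rw [natDegree_C_mul_X _ (one_div_ne_zero hM), mul_one]
      exact hgdeg)
    have h2 : ∀ z ∈ Finset.range M, (fitPoly v).eval (((z : ℝ) + 1) / M) *
      (((z : ℝ) + 1) / M * g.eval (((z : ℝ) + 1) / M)) = (1 / (hahnRatio M L - 1) / M) *
        ((hahnPoly M L).eval ((z : ℝ) + 1) * (((z : ℝ) + 1) *
          (g.comp (C (1 / (M : ℝ)) * X)).eval ((z : ℝ) + 1))) := by
      intro z _
      rw [hve, eval_comp]
      simp only [eval_mul, eval_C, eval_X]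
      rw [show 1 / (M : ℝ) * ((z : ℝ) + 1) = ((z : ℝ) + 1) / M by ring]
      ring
    rw [Finset.sum_congr rfl h2, ← Finset.mul_sum, h1, mul_zero]
  have hmin := hw.sum_sq_le v
  have hexp : ∀ z ∈ Finset.range M, (fitPoly w).eval (((z : ℝ) + 1) / M) ^ 2 =
      (fitPoly v).eval (((z : ℝ) + 1) / M) ^ 2 + 2 * ((fitPoly v).eval (((z : ℝ) + 1) / M) *
      (((z : ℝ) + 1) / M * g.eval (((z : ℝ) + 1) / M))) +
        (((z : ℝ) + 1) / M * g.eval (((z : ℝ) + 1) / M)) ^ 2 := by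
    intro z _
    rw [hd]
    ring
  rw [Finset.sum_congr rfl hexp, Finset.sum_add_distrib, Finset.sum_add_distrib,
    ← Finset.mul_sum, hcross] at hmin
  have hz : ∑ z ∈ Finset.range M, (((z : ℝ) + 1) / M * g.eval (((z : ℝ) + 1) / M)) ^ 2 = 0 :=
    le_antisymm (by linarith) (Finset.sum_nonneg fun _ _ => sq_nonneg _)
  have := (Finset.sum_eq_zero_iff_of_nonneg fun _ _ => sq_nonneg _).1 hz y (Finset.mem_range.2 hy)
  rw [hd, pow_eq_zero_iff two_ne_zero |>.1 this, add_zero, hve]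

/-- The reproducing property applied to the kernel itself gives ∑ Q² = Q(0), so the squared norm of
Q/Q(0) is 1/Q(0). -/
theorem IsMinimizer.sum_sq_eq {M L : ℕ} (h : L < M) {w : Fin L → ℝ} (hw : IsMinimizer M L w) :
    ∑ y ∈ Finset.range M, (fitPoly w).eval (((y : ℝ) + 1) / M) ^ 2 =
      1 / (hahnRatio M L - 1) := by
  have hR : hahnRatio M L - 1 ≠ 0 := (sub_pos.2 (one_lt_hahnRatio h)).ne'
  have h1 : ∀ y ∈ Finset.range M, (fitPoly w).eval (((y : ℝ) + 1) / M) ^ 2 =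
      (1 / (hahnRatio M L - 1)) ^ 2 * (hahnPoly M L).eval ((y : ℝ) + 1) ^ 2 := by
    intro y hy
    rw [hw.eval_eq h (Finset.mem_range.1 hy)]
    ring
  rw [Finset.sum_congr rfl h1, ← Finset.mul_sum]
  have h2 : ∑ y ∈ Finset.range M, (hahnPoly M L).eval ((y : ℝ) + 1) ^ 2 =
      hahnRatio M L - 1 := by
    obtain ⟨g, hg⟩ : X ∣ hahnPoly M L - C (hahnRatio M L - 1) := by
      rw [X_dvd_iff, coeff_sub, coeff_zero_eq_eval_zero, coeff_C_zero, eval_hahnPoly_zero h,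
        sub_self]
    have h3 : ∑ y ∈ Finset.range M, (hahnPoly M L).eval ((y : ℝ) + 1) * (((y : ℝ) + 1) *
      g.eval ((y : ℝ) + 1)) = 0 := by
      by_cases hg0 : g = 0
      · simp [hg0]
      refine sum_eval_hahnPoly_mul_eq_zero h ?_
      have h1 : (hahnPoly M L - C (hahnRatio M L - 1)).natDegree ≤ L := by
        rw [natDegree_sub_C]
        exact natDegree_hahnPoly_le M L
      rw [hg, natDegree_X_mul hg0] at h1
      omega
    have h4 : ∀ y ∈ Finset.range M, (hahnPoly M L).eval ((y : ℝ) + 1) ^ 2 =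
        (hahnPoly M L).eval ((y : ℝ) + 1) * (((y : ℝ) + 1) * g.eval ((y : ℝ) + 1)) +
          (hahnRatio M L - 1) * (hahnPoly M L).eval ((y : ℝ) + 1) := by
      intro y _
      have := congrArg (eval ((y : ℝ) + 1)) hg
      simp only [eval_sub, eval_mul, eval_X, eval_C] at this
      linear_combination ((hahnPoly M L).eval ((y : ℝ) + 1)) * this
    rw [Finset.sum_congr rfl h4, Finset.sum_add_distrib, h3, ← Finset.mul_sum,
      sum_eval_hahnPoly h]
    ring
  rw [h2]
  field_simp

theorem IsMinimizer.sq_eval_le {M L : ℕ} (h : L < M) {w : Fin L → ℝ} (hw : IsMinimizer M L w)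
    {y : ℕ} (hy : y < M) :
    (fitPoly w).eval (((y : ℝ) + 1) / M) ^ 2 ≤ 1 / (hahnRatio M L - 1) := by
  rw [← hw.sum_sq_eq h]
  exact Finset.single_le_sum (f := fun y : ℕ => (fitPoly w).eval (((y : ℝ) + 1) / M) ^ 2)
    (fun _ _ => sq_nonneg _) (Finset.mem_range.2 hy)

theorem IsMinimizer.eval_first_le {M L : ℕ} (hL : 1 ≤ L) (h : L < M) {w : Fin L → ℝ}
    (hw : IsMinimizer M L w) :
    (fitPoly w).eval (1 / (M : ℝ)) ≤ 1 / (1 + 3 / 8 * (((L : ℝ) + 1) ^ 2 / M)) := by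
  have hM : (0 : ℝ) < M := by exact_mod_cast (Nat.zero_lt_of_lt h)
  have h1 := hw.eval_eq h (y := 0) (by omega)
  have h2 := hahnRatio_sub_one_ge hL h
  simp only [Nat.cast_zero, zero_add, eval_hahnPoly_one] at h1
  rw [h1, div_le_div_iff₀ (sub_pos.2 (one_lt_hahnRatio h)) (by positivity)]
  linarith

/-! ### Bounds for the coefficients -/

/-- The ℓ₁ norm of the coefficients is submultiplicative. -/
theorem sum_abs_coeff_prod_le {ι : Type*} (s : Finset ι) (a b : ι → ℝ) (n : ℕ) :
    ∑ j ∈ Finset.range n, |(∏ i ∈ s, (C (a i) + C (b i) * X)).coeff j| ≤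
      ∏ i ∈ s, (|a i| + |b i|) := by
  classical
  induction s using Finset.induction_on generalizing n with
  | empty =>
    simp only [Finset.prod_empty, coeff_one]
    rcases n with _ | n
    · simp
    · rw [Finset.sum_range_succ']
      simp
  | insert i s hi ih =>
    rw [Finset.prod_insert hi, Finset.prod_insert hi]
    set p := ∏ i ∈ s, (C (a i) + C (b i) * X) with hp
    have h1 : ∀ j, |((C (a i) + C (b i) * X) * p).coeff j| ≤
        |a i| * |p.coeff j| + |b i| * |(X * p).coeff j| := by
      intro j
      rw [add_mul, mul_assoc, coeff_add, coeff_C_mul, coeff_C_mul, ← abs_mul, ← abs_mul]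
      exact abs_add_le _ _
    have h2 : ∑ j ∈ Finset.range n, |(X * p).coeff j| ≤ ∏ i ∈ s, (|a i| + |b i|) := by
      rcases n with _ | n
      · simpa using Finset.prod_nonneg fun i _ => by positivity
      · rw [Finset.sum_range_succ']
        simpa using ih n
    refine (Finset.sum_le_sum fun j _ => h1 j).trans ?_
    rw [Finset.sum_add_distrib, ← Finset.mul_sum, ← Finset.mul_sum, add_mul]
    exact add_le_add (mul_le_mul_of_nonneg_left (ih n) (abs_nonneg _))
      (mul_le_mul_of_nonneg_left h2 (abs_nonneg _))

theorem sum_abs_le_sum_abs_coeff {L : ℕ} (w : Fin L → ℝ) :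
    ∑ i, |w i| ≤ ∑ j ∈ Finset.range (L + 1), |(fitPoly w).coeff j| := by
  rw [Finset.sum_range_succ', Finset.sum_range]
  simp only [coeff_fitPoly, abs_neg]
  linarith [abs_nonneg ((fitPoly w).coeff 0)]

/-- The product of 1 - M x / i over 1 ≤ i ≤ M works; its coefficient norm is at most ∏ (1 + M/i) =
C(2M, M). -/
theorem exists_interpolating {M L : ℕ} (h : M ≤ L) :
    ∃ v : Fin L → ℝ, (∀ y < M, (fitPoly v).eval (((y : ℝ) + 1) / M) = 0) ∧
      ∑ i, |v i| ≤ 4 ^ M := by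
  obtain ⟨v, hv⟩ := exists_fitPoly_eq (L := L)
    (p := ∏ i ∈ Finset.range M, (C (1 : ℝ) + C (-((M : ℝ) / (i + 1))) * X)) (by
      refine (natDegree_prod_le _ _).trans ?_
      refine (Finset.sum_le_card_nsmul _ _ 1 fun i _ => ?_).trans (by simpa using h)
      refine (natDegree_add_le _ _).trans (max_le (by simp) (by simpa using natDegree_C_mul_X_pow_le (-((M : ℝ) / (i + 1))) 1))) (by
      simp [eval_prod])
  refine ⟨v, fun y hy => ?_, ?_⟩
  · rw [hv, eval_prod]
    refine Finset.prod_eq_zero (Finset.mem_range.2 hy) ?_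
    have hM : (M : ℝ) ≠ 0 := by exact_mod_cast (Nat.zero_lt_of_lt hy).ne'
    have hy1 : (y : ℝ) + 1 ≠ 0 := by positivity
    simp only [eval_add, eval_mul, eval_C, eval_X]
    field_simp
    ring
  · refine (sum_abs_le_sum_abs_coeff v).trans ?_
    rw [hv]
    refine (sum_abs_coeff_prod_le _ _ _ _).trans ?_
    have h1 : ∏ i ∈ Finset.range M, (|(1 : ℝ)| + |-((M : ℝ) / (i + 1))|) =
        (M.centralBinom : ℝ) := by
      have hf : (M ! : ℝ) ≠ 0 := by positivity
      have e : (M.centralBinom : ℝ) * M ! = ∏ i ∈ Finset.range M, ((M : ℝ) + (i + 1)) := by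
        rw [Nat.centralBinom_eq_two_mul_choose]
        have h2 := Nat.ascFactorial_eq_factorial_mul_choose M M
        rw [Nat.ascFactorial_eq_prod_range, ← two_mul] at h2
        have h3 := congrArg (Nat.cast (R := ℝ)) h2
        push_cast at h3
        rw [mul_comm, ← h3]
        exact Finset.prod_congr rfl fun i _ => by ring
      rw [← mul_right_cancel_iff_of_pos (show (0 : ℝ) < (M ! : ℝ) by positivity), e,
        ← Finset.prod_range_add_one_eq_factorial]
      push_cast
      rw [← Finset.prod_mul_distrib]
      refine Finset.prod_congr rfl fun i _ => ?_
      have hi : (i : ℝ) + 1 ≠ 0 := by positivity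
      rw [abs_neg, abs_one, abs_of_nonneg (by positivity)]
      field_simp
      ring
    rw [h1]
    have : M.centralBinom ≤ 4 ^ M := by
      rw [Nat.centralBinom_eq_two_mul_choose]
      calc (2 * M).choose M ≤ 2 ^ (2 * M) := Nat.choose_le_two_pow _ _
        _ = 4 ^ M := by rw [pow_mul]; norm_num
    exact_mod_cast this

theorem prod_erase_abs_sub {L s : ℕ} (hs : s ≤ L) :
    ∏ t ∈ (Finset.range (L + 1)).erase s, |(s : ℝ) - t| = s ! * (L - s)! := by
  obtain ⟨d, rfl⟩ := Nat.exists_eq_add_of_le hs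
  have h1 : (Finset.range (s + d + 1)).erase s =
      Finset.range s ∪ (Finset.range d).map (addLeftEmbedding (s + 1)) := by
    ext t
    simp only [Finset.mem_erase, Finset.mem_range, Finset.mem_union, Finset.mem_map,
      addLeftEmbedding_apply]
    constructor
    · rintro ⟨h1, h2⟩
      rcases lt_or_gt_of_ne h1 with h | h
      · exact Or.inl h
      · exact Or.inr ⟨t - (s + 1), by omega, by omega⟩
    · rintro (h | ⟨a, h, rfl⟩) <;> omega
  rw [h1, Finset.prod_union, Finset.prod_map, ← Finset.prod_range_reflect,
    Nat.add_sub_cancel_left, ← Finset.prod_range_add_one_eq_factorial,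
    ← Finset.prod_range_add_one_eq_factorial]
  · push_cast
    congr 1
    · refine Finset.prod_congr rfl fun t ht => ?_
      have ht' := Finset.mem_range.1 ht
      rw [show s - 1 - t = s - (t + 1) by omega, Nat.cast_sub (by omega)]
      push_cast
      rw [sub_sub_cancel, abs_of_nonneg (by positivity)]
    · refine Finset.prod_congr rfl fun t _ => ?_
      simp only [addLeftEmbedding_apply]
      push_cast
      rw [show (s : ℝ) - (s + 1 + t) = -(t + 1) by ring, abs_neg, abs_of_nonneg (by positivity)]
  · rw [Finset.disjoint_left]
    intro t ht ht'
    simp only [Finset.mem_map, Finset.mem_range, addLeftEmbedding_apply] at ht ht'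
    omega

/-- A polynomial of degree `L` that is bounded by `D` on the grid `{0, 1/M, …, 1}`, `M ≥ L`, has
coefficients bounded by `D exp (4 L)`. -/
theorem sum_abs_coeff_le_of_grid {M L : ℕ} (hL : 1 ≤ L) (h : L ≤ M) {p : ℝ[X]}
    (hp : p.natDegree ≤ L) {D : ℝ} (hD : 0 ≤ D) (hb : ∀ z ≤ M, |p.eval ((z : ℝ) / M)| ≤ D) :
    ∑ j ∈ Finset.range (L + 1), |p.coeff j| ≤ D * Real.exp (4 * L) := by
  have hMpos : (0 : ℝ) < M := by exact_mod_cast (by omega : 0 < M)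
  have hLpos : (0 : ℝ) < L := by exact_mod_cast (by omega : 0 < L)
  -- Every H-th grid point, starting from 0, gives L + 1 equally spaced interpolation nodes in [0,
  -- 1]; rounding down costs at most a factor 2, M ≤ 2 L H.
  set H := M / L with hH
  have hHpos : 0 < H := Nat.div_pos h (by omega)
  have hHpos' : (0 : ℝ) < H := by exact_mod_cast hHpos
  have hHL : H * L ≤ M := Nat.div_mul_le_self M L
  have hHge : (M : ℝ) ≤ 2 * L * H := by
    have h1 : M < L * (H + 1) := by
      have := Nat.lt_mul_div_succ M (show 0 < L by omega)
      simpa [hH] using this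
    have h2 : M ≤ 2 * L * H := by nlinarith
    exact_mod_cast h2
  set x : ℕ → ℝ := fun s => ((s * H : ℕ) : ℝ) / M with hx
  have hxdiff : ∀ s t, x s - x t = ((s : ℝ) - t) * (H / M) := by
    intro s t
    simp only [hx]
    push_cast
    ring
  have hle : ∀ s ∈ Finset.range (L + 1), s * H ≤ M := by
    intro s hs
    have hs' : s ≤ L := by have := Finset.mem_range.1 hs; omega
    nlinarith
  have hinj : Set.InjOn x (Finset.range (L + 1)) := by
    intro s _ t _ hst
    have := hxdiff s t
    rw [hst, sub_self, eq_comm, mul_eq_zero] at this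
    rcases this with h | h
    · exact_mod_cast sub_eq_zero.1 h
    · exact absurd h (by positivity)
  have hinterp : p = Lagrange.interpolate (Finset.range (L + 1)) x fun s => p.eval (x s) := by
    refine Lagrange.eq_interpolate hinj ?_
    rw [Finset.card_range]
    exact lt_of_le_of_lt degree_le_natDegree (by exact_mod_cast Nat.lt_succ_of_le hp)
  rw [Lagrange.interpolate_apply] at hinterp
  have hbasis : ∀ s ∈ Finset.range (L + 1),
      ∑ j ∈ Finset.range (L + 1), |(Lagrange.basis (Finset.range (L + 1)) x s).coeff j| ≤
        (4 * L) ^ L / (s ! * (L - s)!) := by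
    intro s hs
    have hs' : s ≤ L := by have := Finset.mem_range.1 hs; omega
    have h1 : Lagrange.basis (Finset.range (L + 1)) x s =
        ∏ t ∈ (Finset.range (L + 1)).erase s,
          (C (-((x s - x t)⁻¹ * x t)) + C ((x s - x t)⁻¹) * X) := by
      rw [Lagrange.basis]
      refine Finset.prod_congr rfl fun t _ => ?_
      rw [Lagrange.basisDivisor]
      simp only [C_neg, C_mul]
      ring
    rw [h1]
    refine (sum_abs_coeff_prod_le _ _ _ _).trans ?_
    have h2 : ∀ t ∈ (Finset.range (L + 1)).erase s,
        |-((x s - x t)⁻¹ * x t)| + |(x s - x t)⁻¹| ≤ 4 * L * |(s : ℝ) - t|⁻¹ := by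
      intro t ht
      have hxt : |x t| ≤ 1 := by
        rw [abs_of_nonneg (by positivity)]
        refine (div_le_one hMpos).2 ?_
        exact_mod_cast hle t (Finset.mem_of_mem_erase ht)
      rw [abs_neg, abs_mul, hxdiff, abs_inv, abs_mul, abs_of_pos (show (0 : ℝ) < H / M by positivity),
        mul_inv, inv_div]
      have h3 : (M : ℝ) / H ≤ 2 * L := by rwa [div_le_iff₀ hHpos']
      have h4 : 0 ≤ |(s : ℝ) - t|⁻¹ := by positivity
      calc |(s : ℝ) - t|⁻¹ * (M / H) * |x t| + |(s : ℝ) - t|⁻¹ * (M / H)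
          ≤ |(s : ℝ) - t|⁻¹ * (M / H) * 1 + |(s : ℝ) - t|⁻¹ * (M / H) := by gcongr
        _ = |(s : ℝ) - t|⁻¹ * 2 * (M / H) := by ring
        _ ≤ |(s : ℝ) - t|⁻¹ * 2 * (2 * L) := by gcongr
        _ = _ := by ring
    refine (Finset.prod_le_prod (fun _ _ => by positivity) h2).trans (le_of_eq ?_)
    rw [Finset.prod_mul_distrib, Finset.prod_const, Finset.card_erase_of_mem hs, Finset.card_range,
      Finset.prod_inv_distrib, prod_erase_abs_sub hs', Nat.add_sub_cancel, div_eq_mul_inv]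
  have hcoeff : ∀ j, |p.coeff j| ≤ ∑ s ∈ Finset.range (L + 1),
      D * |(Lagrange.basis (Finset.range (L + 1)) x s).coeff j| := by
    intro j
    conv_lhs => rw [hinterp, finsetSum_coeff]
    refine (Finset.abs_sum_le_sum_abs _ _).trans (Finset.sum_le_sum fun s hs => ?_)
    rw [coeff_C_mul, abs_mul]
    exact mul_le_mul_of_nonneg_right (hb _ (hle s hs)) (abs_nonneg _)
  refine (Finset.sum_le_sum fun j _ => hcoeff j).trans ?_
  rw [Finset.sum_comm]
  simp_rw [← Finset.mul_sum]
  refine mul_le_mul_of_nonneg_left ?_ hD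
  refine (Finset.sum_le_sum hbasis).trans ?_
  -- Summed over s this is (8L)^L / L!, at most (8e)^L ≤ exp(4L).
  have h5 : ∀ s ∈ Finset.range (L + 1), (4 * L : ℝ) ^ L / (s ! * (L - s)!) =
      (4 * L : ℝ) ^ L / L ! * L.choose s := by
    intro s hs
    have hs' : s ≤ L := by have := Finset.mem_range.1 hs; omega
    rw [Nat.cast_choose ℝ hs']
    field_simp
  rw [Finset.sum_congr rfl h5, ← Finset.mul_sum, ← Nat.cast_sum, Nat.sum_range_choose]
  have h6 := Real.pow_div_factorial_le_exp (L : ℝ) hLpos.le L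
  have h7 : (8 : ℝ) ≤ Real.exp 3 := by
    have h8 : (2 : ℝ) ≤ Real.exp 1 := by linarith [Real.add_one_le_exp (1 : ℝ)]
    calc (8 : ℝ) = 2 ^ 3 := by norm_num
      _ ≤ Real.exp 1 ^ 3 := by gcongr
      _ = Real.exp 3 := by rw [← Real.exp_nat_mul]; norm_num
  calc (4 * L : ℝ) ^ L / L ! * ((2 ^ L : ℕ) : ℝ) = 8 ^ L * ((L : ℝ) ^ L / L !) := by
        rw [show (8 : ℝ) = 4 * 2 by norm_num, mul_pow, mul_pow]
        push_cast
        ring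
    _ ≤ Real.exp 3 ^ L * Real.exp L := by gcongr
    _ = Real.exp (4 * L) := by
        rw [← Real.exp_nat_mul, ← Real.exp_add]
        congr 1
        ring

/-! ### Properties of the optimal coefficients -/

theorem isOptimal_optimalW (M L : ℕ) : IsOptimal M L (optimalW M L) :=
  Classical.choose_spec (exists_isOptimal M L)

theorem eval_fitPoly_optimalW_eq_zero {M L : ℕ} (h : M ≤ L) {y : ℕ} (hy : y < M) :
    (fitPoly (optimalW M L)).eval (((y : ℝ) + 1) / M) = 0 := by
  obtain ⟨v, hv, -⟩ := exists_interpolating h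
  have h1 := (isOptimal_optimalW M L).1.sum_sq_le v
  have h2 : ∑ y ∈ Finset.range M, (fitPoly v).eval (((y : ℝ) + 1) / M) ^ 2 = 0 :=
    Finset.sum_eq_zero fun z hz => by rw [hv z (Finset.mem_range.1 hz)]; norm_num
  rw [h2] at h1
  have h3 := le_antisymm h1 (Finset.sum_nonneg fun _ _ => sq_nonneg _)
  have := (Finset.sum_eq_zero_iff_of_nonneg fun _ _ => sq_nonneg _).1 h3 y (Finset.mem_range.2 hy)
  exact pow_eq_zero_iff two_ne_zero |>.1 this

/-- Here minimality of the Euclidean norm among all minimizers matters: it bounds every entry by the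
norm of the explicit interpolating solution, at most 4^M. -/
theorem sum_abs_optimalW_le_of_le {M L : ℕ} (h : M ≤ L) :
    ∑ i, |optimalW M L i| ≤ Real.exp (4 * L) := by
  obtain ⟨v, hv, hv4⟩ := exists_interpolating h
  have hvmin : IsMinimizer M L v := by
    intro z
    have h1 : residual M L v ^ 2 = 0 := by
      rw [residual_sq]
      exact Finset.sum_eq_zero fun z hz => by rw [hv z (Finset.mem_range.1 hz)]; norm_num
    rw [pow_eq_zero_iff two_ne_zero |>.1 h1]
    exact norm_nonneg _
  have h2 := (isOptimal_optimalW M L).2 v hvmin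
  have h3 : ‖(WithLp.toLp 2 v : EuclideanSpace ℝ (Fin L))‖ ≤ ∑ i, |v i| := by
    rw [EuclideanSpace.norm_eq]
    refine Real.sqrt_le_iff.2 ⟨Finset.sum_nonneg fun _ _ => abs_nonneg _, ?_⟩
    exact Finset.sum_sq_le_sq_sum_of_nonneg fun _ _ => abs_nonneg _
  have h4 : ∀ i, |optimalW M L i| ≤ 4 ^ L := by
    intro i
    have h5 := PiLp.norm_apply_le (WithLp.toLp 2 (optimalW M L) : EuclideanSpace ℝ (Fin L)) i
    calc |optimalW M L i| ≤ 4 ^ M := (h5.trans h2).trans (h3.trans hv4)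
      _ ≤ 4 ^ L := pow_le_pow_right₀ (by norm_num) h
  have h8 : (2 : ℝ) ≤ Real.exp 1 := by linarith [Real.add_one_le_exp (1 : ℝ)]
  have h9 : (L : ℝ) ≤ Real.exp L := by linarith [Real.add_one_le_exp (L : ℝ)]
  calc ∑ i, |optimalW M L i| ≤ ∑ i : Fin L, (4 : ℝ) ^ L := Finset.sum_le_sum fun i _ => h4 i
    _ = L * (2 ^ 2) ^ L := by simp; norm_num
    _ ≤ Real.exp L * (Real.exp 1 ^ 2) ^ L := by gcongr
    _ = Real.exp (3 * L) := by
        rw [← pow_mul, ← Real.exp_nat_mul, ← Real.exp_add]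
        congr 1
        push_cast
        ring
    _ ≤ Real.exp (4 * L) := by gcongr; norm_num

theorem sum_abs_optimalW_le {M L : ℕ} {D : ℝ} (hD : 1 ≤ D)
    (hb : ∀ y < M, |(fitPoly (optimalW M L)).eval (((y : ℝ) + 1) / M)| ≤ D) :
    ∑ i, |optimalW M L i| ≤ D * Real.exp (4 * L) := by
  rcases le_total M L with h | h
  · exact (sum_abs_optimalW_le_of_le h).trans (le_mul_of_one_le_left (Real.exp_pos _).le hD)
  rcases Nat.eq_zero_or_pos L with rfl | hL
  · simp
    linarith
  refine (sum_abs_le_sum_abs_coeff _).trans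
    (sum_abs_coeff_le_of_grid hL h (natDegree_fitPoly_le _) (by linarith) ?_)
  -- The grid now includes 0, where the polynomial equals 1; hence the requirement 1 ≤ D.
  intro z hz
  rcases z with _ | z
  · simpa [eval_zero_fitPoly] using hD
  · simpa using hb z hz

end Approximation

/-! ### Poissonization -/

/-- The colours that occur in the urn. -/
abbrev Palette {k : ℕ} (color : Fin k → ℕ) : Type :=
  {a // a ∈ Finset.univ.image color}

def toPalette {k : ℕ} (color : Fin k → ℕ) (b : Fin k) : Palette color :=
  ⟨color b, Finset.mem_image_of_mem _ (Finset.mem_univ b)⟩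

/-- The number of balls of a given colour. -/
def multiplicity {k : ℕ} (color : Fin k → ℕ) (a : Palette color) : ℕ :=
  (Finset.univ.filter fun b => toPalette color b = a).card

/-- The number of occurrences of each colour of the urn in a sample. -/
def tally {k : ℕ} (color : Fin k → ℕ) {m : ℕ} (x : Fin m → ℕ) : Palette color → ℕ :=
  fun a => histogram x a

theorem card_palette {k : ℕ} (color : Fin k → ℕ) :
    Fintype.card (Palette color) = numColors color := by
  rw [Fintype.card_coe, numColors]

theorem sum_multiplicity {k : ℕ} (color : Fin k → ℕ) : ∑ a, multiplicity color a = k := by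
  simp only [multiplicity]
  rw [← Finset.card_eq_sum_card_fiberwise (s := Finset.univ) (t := Finset.univ)
    fun _ _ => Finset.mem_coe.2 (Finset.mem_univ _)]
  simp

theorem multiplicity_pos {k : ℕ} (color : Fin k → ℕ) (a : Palette color) :
    0 < multiplicity color a := by
  obtain ⟨b, -, hb⟩ := Finset.mem_image.1 a.2
  exact Finset.card_pos.2 ⟨b, Finset.mem_filter.2 ⟨Finset.mem_univ b, Subtype.ext hb⟩⟩

theorem tally_apply {k : ℕ} (color : Fin k → ℕ) {m : ℕ} (y : Fin m → Fin k) (a : Palette color) :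
    tally color (fun t => color (y t)) a =
      (Finset.univ.filter fun t => toPalette color (y t) = a).card := by
  simp only [tally, histogram, toPalette, Subtype.ext_iff]

theorem sum_tally {k : ℕ} (color : Fin k → ℕ) {m : ℕ} (y : Fin m → Fin k) :
    ∑ a, tally color (fun t => color (y t)) a = m := by
  simp only [tally_apply]
  rw [← Finset.card_eq_sum_card_fiberwise (s := Finset.univ) (t := Finset.univ)
    fun _ _ => Finset.mem_coe.2 (Finset.mem_univ _)]
  simp

/-- Expand (∑_b X_{colour of b})^m in two ways, over sequences of draws and by the multinomial
theorem, and compare coefficients. -/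
theorem card_tally_eq {k : ℕ} (color : Fin k → ℕ) (x : Palette color → ℕ) {m : ℕ}
    (hm : ∑ a, x a = m) :
    (Finset.univ.filter fun y : Fin m → Fin k => tally color (fun t => color (y t)) = x).card =
      Nat.multinomial Finset.univ x * ∏ a, multiplicity color a ^ x a := by
  classical
  let P : MvPolynomial (Palette color) ℕ := ∑ b, MvPolynomial.X (toPalette color b)
  let e : (Palette color → ℕ) → (Palette color →₀ ℕ) := Finsupp.equivFunOnFinite.symm
  have he : Function.Injective e := Finsupp.equivFunOnFinite.symm.injective
  have hprod : ∀ z : Palette color → ℕ, ∏ a, (MvPolynomial.X a : MvPolynomial (Palette color) ℕ) ^ z a =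
      MvPolynomial.monomial (e z) 1 := by
    intro z
    rw [MvPolynomial.monomial_eq, MvPolynomial.C_1, one_mul, Finsupp.prod_fintype _ _ (by simp)]
    rfl
  have h1 : P ^ m = ∑ y : Fin m → Fin k,
      MvPolynomial.monomial (e (tally color fun t => color (y t))) 1 := by
    rw [Fintype.sum_pow]
    refine Finset.sum_congr rfl fun y _ => ?_
    rw [← hprod, ← Finset.prod_fiberwise' (s := Finset.univ) (g := fun t => toPalette color (y t))
      (f := fun a => (MvPolynomial.X a : MvPolynomial (Palette color) ℕ))]
    refine Finset.prod_congr rfl fun a _ => ?_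
    rw [Finset.prod_const, tally_apply]
  have h2 : P = ∑ a, MvPolynomial.C (multiplicity color a) * MvPolynomial.X a := by
    change ∑ b, MvPolynomial.X (toPalette color b) = _
    rw [← Finset.sum_fiberwise' (s := Finset.univ) (g := toPalette color)
      (f := fun a => (MvPolynomial.X a : MvPolynomial (Palette color) ℕ))]
    refine Finset.sum_congr rfl fun a _ => ?_
    rw [Finset.sum_const, multiplicity, nsmul_eq_mul]
    simp
  have h3 : P ^ m = ∑ z ∈ Finset.piAntidiag Finset.univ m,
      MvPolynomial.monomial (e z)
        (Nat.multinomial Finset.univ z * ∏ a, multiplicity color a ^ z a) := by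
    rw [h2, Finset.sum_pow_eq_sum_piAntidiag]
    refine Finset.sum_congr rfl fun z _ => ?_
    simp_rw [mul_pow]
    rw [Finset.prod_mul_distrib, hprod]
    simp_rw [← map_pow]
    rw [← map_prod, MvPolynomial.C_mul_monomial, mul_one, ← map_natCast (MvPolynomial.C),
      MvPolynomial.C_mul_monomial]
    simp
  have h4 := congrArg (MvPolynomial.coeff (e x)) (h1.symm.trans h3)
  simp only [MvPolynomial.coeff_sum, MvPolynomial.coeff_monomial, he.eq_iff] at h4
  rw [Finset.sum_ite_eq' (Finset.piAntidiag Finset.univ m) x, if_pos (Finset.mem_piAntidiag.2 ⟨hm, fun _ _ => Finset.mem_univ _⟩)] at h4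
  rw [← h4, Finset.card_filter]

theorem pi_uniformOn_apply {k m : ℕ} (s : Finset (Fin m → Fin k)) :
    (Measure.pi fun _ : Fin m => uniformOn (Set.univ : Set (Fin k))) s =
      s.card / (k : ENNReal) ^ m := by
  rw [← uniformOn_pi, Set.pi_univ, uniformOn_univ, Measure.count_apply_finset]
  simp

theorem map_tally_singleton {k : ℕ} (color : Fin k → ℕ) (x : Palette color → ℕ) (m : ℕ) :
    ((Measure.pi fun _ : Fin m => uniformOn (Set.univ : Set (Fin k))).map
      fun y => tally color fun t => color (y t)) {x} =
      if ∑ a, x a = m then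
        ((Nat.multinomial Finset.univ x * ∏ a, multiplicity color a ^ x a : ℕ) : ENNReal) /
          (k : ENNReal) ^ m else 0 := by
  rw [Measure.map_apply .of_discrete (measurableSet_singleton _)]
  have h1 : (fun y : Fin m → Fin k => tally color fun t => color (y t)) ⁻¹' {x} =
      (Finset.univ.filter fun y : Fin m → Fin k => tally color (fun t => color (y t)) = x :
        Finset (Fin m → Fin k)) := by
    ext y
    simp
  rw [h1, pi_uniformOn_apply]
  split_ifs with hm
  · rw [card_tally_eq color x hm]
  · rw [Finset.filter_eq_empty_iff.2, Finset.card_empty]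
    · simp
    · rintro y - rfl
      exact hm (sum_tally color y)

/-- The mean number of occurrences of a colour. -/
def colorRate {k : ℕ} (n : ℝ≥0) (color : Fin k → ℕ) (a : Palette color) : ℝ≥0 :=
  n * multiplicity color a / k

/-- If the sample size is Poisson, then the numbers of occurrences of the colours are independent
Poisson variables. -/
theorem sum_poisson_smul_map_tally {k : ℕ} (hk : 1 ≤ k) (n : ℝ≥0) (color : Fin k → ℕ) :
    Measure.sum (fun m : ℕ => poissonMeasure n {m} •
      (Measure.pi fun _ : Fin m => uniformOn (Set.univ : Set (Fin k))).map
        fun y => tally color fun t => color (y t)) =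
      Measure.pi fun a => poissonMeasure (colorRate n color a) := by
  have hk0 : (k : ℝ) ≠ 0 := by exact_mod_cast (by omega : k ≠ 0)
  refine Measure.ext_of_singleton fun x => ?_
  rw [Measure.sum_apply _ (measurableSet_singleton _), Measure.pi_singleton]
  simp only [Measure.smul_apply, smul_eq_mul, map_tally_singleton]
  rw [tsum_eq_single (∑ a, x a) fun m hm => by rw [if_neg hm.symm, mul_zero], if_pos rfl]
  simp only [poissonMeasure_singleton]
  rw [← ENNReal.ofReal_prod_of_nonneg fun _ _ => by positivity]
  have h1 : ((Nat.multinomial Finset.univ x * ∏ a, multiplicity color a ^ x a : ℕ) : ENNReal) /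
      (k : ENNReal) ^ (∑ a, x a) = ENNReal.ofReal
      ((Nat.multinomial Finset.univ x * ∏ a, (multiplicity color a : ℝ) ^ x a) /
        (k : ℝ) ^ (∑ a, x a)) := by
    rw [ENNReal.ofReal_div_of_pos (by positivity), ENNReal.ofReal_pow (by positivity),
      ENNReal.ofReal_natCast]
    congr 1
    rw [← ENNReal.ofReal_natCast]
    push_cast
    rfl
  rw [h1, ← ENNReal.ofReal_mul (by positivity)]
  congr 1
  have h2 : ∑ a, (colorRate n color a : ℝ) = n := by
    simp only [colorRate]
    push_cast
    rw [← Finset.sum_div, ← Finset.mul_sum, ← Nat.cast_sum, sum_multiplicity]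
    field_simp
  have h3 : (Nat.multinomial Finset.univ x : ℝ) = (∑ a, x a)! / ∏ a, ((x a)! : ℝ) := by
    rw [eq_div_iff (Finset.prod_ne_zero_iff.2 fun a _ => by positivity), mul_comm]
    exact_mod_cast Nat.multinomial_spec Finset.univ x
  rw [Finset.prod_div_distrib, Finset.prod_mul_distrib, ← Real.exp_sum, Finset.sum_neg_distrib,
    h2, h3]
  have h4 : ∏ a, (colorRate n color a : ℝ) ^ x a =
      (n : ℝ) ^ (∑ a, x a) * (∏ a, (multiplicity color a : ℝ) ^ x a) / (k : ℝ) ^ (∑ a, x a) := by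
    simp only [colorRate]
    push_cast
    simp_rw [div_pow, mul_pow]
    rw [Finset.prod_div_distrib, Finset.prod_mul_distrib, Finset.prod_pow_eq_pow_sum,
      Finset.prod_pow_eq_pow_sum]
  rw [h4]
  have h5 : ((∑ a, x a)! : ℝ) ≠ 0 := by positivity
  field_simp

/-- The law of the observed tally in the Poisson sampling model. -/
theorem IsPoissonSample.map_tally {Ω : Type*} [MeasurableSpace Ω] {μ : Measure Ω}
    [IsProbabilityMeasure μ] {k : ℕ} (hk : 1 ≤ k) {n : ℝ≥0} {N : Ω → ℕ} {Y : ℕ → Ω → Fin k}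
    (h : IsPoissonSample μ k n N Y) (color : Fin k → ℕ) :
    Measurable (fun ω => tally color (observed color N Y ω)) ∧
    μ.map (fun ω => tally color (observed color N Y ω)) =
      Measure.pi fun a => poissonMeasure (colorRate n color a) := by
  have hY : ∀ m, Measurable fun ω => (fun (t : Fin m) => Y t ω) := fun m =>
    measurable_pi_lambda _ fun t => h.measurable_draw t
  -- The type of the observed sample depends on ω, so events are split along N = m, where the sample
  -- is the first m draws.
  have hpre : ∀ s : Set (Palette color → ℕ),
      (fun ω => tally color (observed color N Y ω)) ⁻¹' s = ⋃ m : ℕ, (N ⁻¹' {m} ∩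
        (fun ω => (fun (t : Fin m) => Y t ω)) ⁻¹'
          ((fun y : Fin m → Fin k => tally color fun t => color (y t)) ⁻¹' s)) := by
    intro s
    ext ω
    simp only [Set.mem_preimage, Set.mem_iUnion, Set.mem_inter_iff, Set.mem_singleton_iff]
    constructor
    · intro hs
      exact ⟨N ω, rfl, hs⟩
    · rintro ⟨m, rfl, hs⟩
      exact hs
  have hmeas : Measurable (fun ω => tally color (observed color N Y ω)) := by
    intro s _
    rw [hpre]
    exact MeasurableSet.iUnion fun m => (h.measurable_size (measurableSet_singleton m)).inter
      (hY m .of_discrete)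
  refine ⟨hmeas, ?_⟩
  rw [← sum_poisson_smul_map_tally hk n color]
  ext s hs
  rw [Measure.map_apply hmeas hs, hpre, measure_iUnion, Measure.sum_apply _ hs]
  · refine tsum_congr fun m => ?_
    have hind : IndepFun N (fun ω => (fun (t : Fin m) => Y t ω)) μ :=
      h.indep_size.comp measurable_id
        (show Measurable fun (z : ℕ → Fin k) (t : Fin m) => z t from
          measurable_pi_lambda _ fun t => measurable_pi_apply _)
    rw [hind.measure_inter_preimage_eq_mul _ _ (measurableSet_singleton m) .of_discrete,
      Measure.smul_apply, smul_eq_mul, ← h.size_law,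
      Measure.map_apply h.measurable_size (measurableSet_singleton m)]
    congr 1
    have hlaw : μ.map (fun ω => (fun (t : Fin m) => Y t ω)) =
        Measure.pi fun _ : Fin m => uniformOn (Set.univ : Set (Fin k)) := by
      have h1 : iIndepFun (fun (t : Fin m) => Y t) μ :=
        h.indep_draws.precomp (g := fun t : Fin m => (t : ℕ)) Fin.val_injective
      rw [(iIndepFun_iff_map_fun_eq_pi_map fun t : Fin m =>
        (h.measurable_draw t).aemeasurable).1 h1]
      congr 1
      funext t
      exact h.draw_law t
    rw [← Measure.map_apply (hY m) .of_discrete, hlaw, Measure.map_apply .of_discrete hs]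
  · intro i j hij
    refine Set.disjoint_left.2 fun ω h1 h2 => hij ?_
    exact h1.1.symm.trans h2.1
  · intro m
    exact (h.measurable_size (measurableSet_singleton m)).inter (hY m .of_discrete)

/-! ### The estimator as a function of the tally -/

theorem numColors_le {k : ℕ} (color : Fin k → ℕ) : numColors color ≤ k := by
  simpa [numColors] using Finset.card_image_le (s := Finset.univ) (f := color)

/-- At j = 0 the two sides would differ: the palette also contains the unseen colours. -/
theorem fingerprint_eq {k : ℕ} (color : Fin k → ℕ) {m : ℕ} (y : Fin m → Fin k) {j : ℕ}
    (hj : 1 ≤ j) :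
    fingerprint (fun t => color (y t)) j =
      (Finset.univ.filter fun a => tally color (fun t => color (y t)) a = j).card := by
  rw [fingerprint, ← Finset.card_map (Function.Embedding.subtype _)]
  congr 1
  ext a
  simp only [Finset.mem_filter, Finset.mem_image, Finset.mem_univ, true_and, Finset.mem_map,
    Function.Embedding.subtype_apply, tally]
  constructor
  · rintro ⟨⟨t, rfl⟩, h⟩
    exact ⟨toPalette color (y t), Finset.mem_filter.2 ⟨Finset.mem_univ _, h⟩, rfl⟩
  · rintro ⟨b, hb, rfl⟩
    have h := (Finset.mem_filter.1 hb).2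
    refine ⟨?_, h⟩
    have : 0 < histogram (fun t => color (y t)) b := by omega
    obtain ⟨t, ht⟩ := Finset.card_pos.1 this
    exact ⟨t, (Finset.mem_filter.1 ht).2⟩

/-- The number of colours that are seen. -/
def tallySeen {k : ℕ} (color : Fin k → ℕ) (x : Palette color → ℕ) : ℕ :=
  (Finset.univ.filter fun a => 1 ≤ x a).card

theorem seen_eq {k : ℕ} (color : Fin k → ℕ) {m : ℕ} (y : Fin m → Fin k) :
    seen (fun t => color (y t)) = tallySeen color (tally color fun t => color (y t)) := by
  rw [seen, tallySeen, Finset.card_eq_sum_card_fiberwise (t := Finset.Icc 1 m)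
    (f := tally color fun t => color (y t))]
  · refine Finset.sum_congr rfl fun j hj => ?_
    rw [fingerprint_eq color y (Finset.mem_Icc.1 hj).1, Finset.filter_filter]
    congr 1
    ext a
    have := (Finset.mem_Icc.1 hj).1
    simp only [Finset.mem_filter, Finset.mem_univ, true_and]
    omega
  · intro a ha
    have h1 : 1 ≤ tally color (fun t => color (y t)) a := (Finset.mem_filter.1 ha).2
    refine Finset.mem_coe.2 (Finset.mem_Icc.2 ⟨h1, ?_⟩)
    simpa [tally, histogram] using
      Finset.card_filter_le (Finset.univ : Finset (Fin m)) fun t => color (y t) = a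

theorem tallySeen_le {k : ℕ} (color : Fin k → ℕ) (x : Palette color → ℕ) :
    tallySeen color x ≤ numColors color := by
  rw [← card_palette]
  exact Finset.card_filter_le _ _

/-- The contribution of a colour that is seen `r` times to the error of the linear estimator. -/
def score {L : ℕ} (w : Fin L → ℝ) (ρ : ℝ) (r : ℕ) : ℝ :=
  (if r = 0 then -1 else 0) +
    ∑ i : Fin L, if r = (i : ℕ) + 1 then w i * ((i : ℕ) + 1)! * ρ ^ ((i : ℕ) + 1) else 0

/-- The error of the linear estimator. -/
def excess {k L : ℕ} (w : Fin L → ℝ) (ρ : ℝ) (color : Fin k → ℕ) (x : Palette color → ℕ) : ℝ :=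
  ∑ a, score w ρ (x a)

def tallyError {k L : ℕ} (w : Fin L → ℝ) (ρ : ℝ) (color : Fin k → ℕ) (x : Palette color → ℕ) :
    ℝ :=
  min (max (numColors color + excess w ρ color x) (tallySeen color x)) k - numColors color

theorem estimator_sub_eq (α β : ℝ) {k : ℕ} (n : ℝ≥0) (color : Fin k → ℕ) {m : ℕ}
    (y : Fin m → Fin k) :
    estimator α β k n (fun t => color (y t)) - numColors color =
      tallyError (optimalW (nodesM β k n) (degreeL α k)) ((k : ℝ) / (n * nodesM β k n)) color
        (tally color fun t => color (y t)) := by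
  have h1 : (seen (fun t => color (y t)) : ℝ) + unseenEstimate k n (nodesM β k n) (degreeL α k)
      (fun t => color (y t)) = numColors color +
      excess (optimalW (nodesM β k n) (degreeL α k)) ((k : ℝ) / (n * nodesM β k n)) color
        (tally color fun t => color (y t)) := by
    simp only [excess, score]
    rw [Finset.sum_add_distrib, Finset.sum_comm, ← add_assoc]
    congr 1
    · rw [seen_eq, tallySeen, ← card_palette, Finset.card_filter]
      push_cast
      rw [← Finset.card_univ, Finset.cast_card, ← Finset.sum_add_distrib]
      refine Finset.sum_congr rfl fun a _ => ?_
      by_cases h : tally color (fun t => color (y t)) a = 0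
      · simp [h]
      · simp [h, Nat.one_le_iff_ne_zero]
    · rw [unseenEstimate]
      refine Finset.sum_congr rfl fun i _ => ?_
      rw [fingerprint_eq color y (by omega), ← Finset.sum_filter, Finset.sum_const, nsmul_eq_mul]
      ring
  rw [estimator, tallyError, h1, seen_eq]

/-! ### Deterministic bounds on the clamped error -/

section Clamp

variable {k L : ℕ} (w : Fin L → ℝ) (ρ : ℝ) (color : Fin k → ℕ) (x : Palette color → ℕ)

theorem tallyError_le : tallyError w ρ color x ≤ k - numColors color :=
  sub_le_sub_right (min_le_right _ _) _

theorem neg_tallyError_le_sub : -tallyError w ρ color x ≤ numColors color - tallySeen color x := by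
  have h1 : (tallySeen color x : ℝ) ≤ numColors color := by exact_mod_cast tallySeen_le color x
  have h2 : (numColors color : ℝ) ≤ k := by exact_mod_cast numColors_le color
  have h3 := le_min (le_max_right (numColors color + excess w ρ color x) (tallySeen color x : ℝ))
    (h1.trans h2)
  rw [tallyError]
  linarith

theorem neg_tallyError_le_max : -tallyError w ρ color x ≤ max 0 (-excess w ρ color x) := by
  have h2 : (numColors color : ℝ) ≤ k := by exact_mod_cast numColors_le color
  have h3 : numColors color + min 0 (excess w ρ color x) ≤
      min (max (numColors color + excess w ρ color x) (tallySeen color x : ℝ)) k :=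
    le_min (le_max_of_le_left (by linarith [min_le_right 0 (excess w ρ color x)]))
      (by linarith [min_le_left 0 (excess w ρ color x)])
  have h4 : max 0 (-excess w ρ color x) = -min 0 (excess w ρ color x) := by
    rw [← max_neg_neg, neg_zero]
  rw [h4, tallyError]
  linarith

/-- The true value lies between the number of seen colours and k, so clamping to that interval never
increases the error. -/
theorem abs_tallyError_le_abs_excess : |tallyError w ρ color x| ≤ |excess w ρ color x| := by
  refine abs_le'.2 ⟨?_, (neg_tallyError_le_max w ρ color x).trans
    (max_le (abs_nonneg _) (neg_le_abs _))⟩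
  have h1 : (tallySeen color x : ℝ) ≤ numColors color := by exact_mod_cast tallySeen_le color x
  have h2 : max (numColors color + excess w ρ color x) (tallySeen color x : ℝ) ≤
      numColors color + |excess w ρ color x| :=
    max_le (by linarith [le_abs_self (excess w ρ color x)])
      (by linarith [abs_nonneg (excess w ρ color x)])
  rw [tallyError]
  linarith [min_le_left (max (numColors color + excess w ρ color x) (tallySeen color x : ℝ)) k]

theorem abs_tallyError_le_max :
    |tallyError w ρ color x| ≤ max (k - numColors color : ℝ) (numColors color) := by
  refine abs_le'.2 ⟨(tallyError_le w ρ color x).trans (le_max_left _ _),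
    (neg_tallyError_le_sub w ρ color x).trans ((sub_le_self _ ?_).trans (le_max_right _ _))⟩
  positivity

theorem abs_tallyError_le : |tallyError w ρ color x| ≤ k := by
  refine (abs_tallyError_le_max w ρ color x).trans (max_le ?_ ?_)
  · linarith [(Nat.cast_nonneg (numColors color) : (0 : ℝ) ≤ _)]
  · exact_mod_cast numColors_le color

theorem abs_tallyError_le_pred (hx : x ≠ 0) : |tallyError w ρ color x| ≤ k - 1 := by
  have h2 : (numColors color : ℝ) ≤ k := by exact_mod_cast numColors_le color
  obtain ⟨a, ha⟩ := Function.ne_iff.1 hx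
  have h1 : (1 : ℝ) ≤ tallySeen color x := by
    have : 0 < tallySeen color x := Finset.card_pos.2
      ⟨a, by simpa [Nat.one_le_iff_ne_zero] using ha⟩
    exact_mod_cast this
  have h3 : (tallySeen color x : ℝ) ≤ numColors color := by exact_mod_cast tallySeen_le color x
  exact abs_le'.2 ⟨by linarith [tallyError_le w ρ color x],
    by linarith [neg_tallyError_le_sub w ρ color x]⟩

end Clamp

/-! ### Moments of the linear estimator -/

theorem integrable_of_abs_le {Ω : Type*} [MeasurableSpace Ω] {μ : Measure Ω} [IsFiniteMeasure μ]
    {f : Ω → ℝ} (hf : Measurable f) {U : ℝ} (h : ∀ x, |f x| ≤ U) : Integrable f μ :=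
  Integrable.of_bound hf.aestronglyMeasurable U (Filter.Eventually.of_forall h)

theorem abs_score_le {L : ℕ} {w : Fin L → ℝ} {ρ U : ℝ} (hU : 1 ≤ U)
    (h : ∀ i : Fin L, |w i * ((i : ℕ) + 1)! * ρ ^ ((i : ℕ) + 1)| ≤ U) (r : ℕ) :
    |score w ρ r| ≤ U := by
  rw [score]
  rcases r with _ | r
  · simpa using hU
  · by_cases hr : r < L
    · rw [Finset.sum_eq_single ⟨r, hr⟩]
      · simpa using h ⟨r, hr⟩
      · intro i _ hi
        rw [if_neg]
        rintro he
        apply hi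
        ext
        simp at he ⊢
        exact he.symm
      · simp
    · rw [Finset.sum_eq_zero]
      · simp
        linarith
      · intro i _
        rw [if_neg]
        have := i.2
        omega

theorem integral_ite_poissonMeasure (l : ℝ≥0) (j : ℕ) (c : ℝ) :
    ∫ r, (if r = j then c else 0) ∂(poissonMeasure l) = Real.exp (-l) * l ^ j / j ! * c := by
  have : (fun r => if r = j then c else 0) = Set.indicator {j} fun _ => c := by
    ext r
    simp [Set.indicator_apply]
  rw [this, integral_indicator_const _ (measurableSet_singleton _), poissonMeasure_real_singleton,
    smul_eq_mul]

/-- The factorial in u_j cancels that of the Poisson weight, leaving exp(-l) w_j (ρ l)^j; the unseen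
case contributes the constant term of the polynomial. -/
theorem integral_score {L : ℕ} (w : Fin L → ℝ) (ρ : ℝ) (l : ℝ≥0) :
    ∫ r, score w ρ r ∂(poissonMeasure l) = -(Real.exp (-l) * (fitPoly w).eval (ρ * l)) := by
  have hint : ∀ (j : ℕ) (c : ℝ), Integrable (fun r => if r = j then c else 0) (poissonMeasure l) :=
    fun j c => integrable_of_abs_le .of_discrete (U := |c|) fun r => by split_ifs <;> simp
  simp only [score]
  rw [integral_add (hint 0 (-1)) (integrable_finsetSum _ fun i _ => hint _ _),
    integral_finsetSum _ fun i _ => hint _ _, integral_ite_poissonMeasure]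
  simp only [integral_ite_poissonMeasure]
  rw [eval_fitPoly, mul_sub, Finset.mul_sum]
  have : ∀ i : Fin L, Real.exp (-l) * l ^ ((i : ℕ) + 1) / ((i : ℕ) + 1)! *
      (w i * ((i : ℕ) + 1)! * ρ ^ ((i : ℕ) + 1)) =
      Real.exp (-l) * (w i * (ρ * l) ^ ((i : ℕ) + 1)) := by
    intro i
    have : (((i : ℕ) + 1)! : ℝ) ≠ 0 := by positivity
    rw [mul_pow]
    field_simp
  simp only [this]
  simp
  ring

/-- The law of the tally under Poisson sampling. -/
def tallyLaw {k : ℕ} (n : ℝ≥0) (color : Fin k → ℕ) : Measure (Palette color → ℕ) :=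
  Measure.pi fun a => poissonMeasure (colorRate n color a)

instance {k : ℕ} (n : ℝ≥0) (color : Fin k → ℕ) : IsProbabilityMeasure (tallyLaw n color) := by
  unfold tallyLaw
  infer_instance

/-- Minus the mean of the error of the linear estimator. -/
def bias {k L : ℕ} (w : Fin L → ℝ) (ρ : ℝ) (n : ℝ≥0) (color : Fin k → ℕ) : ℝ :=
  ∑ a, Real.exp (-colorRate n color a) * (fitPoly w).eval (ρ * colorRate n color a)

section Moments

variable {k L : ℕ} {w : Fin L → ℝ} {ρ U : ℝ} (n : ℝ≥0) (color : Fin k → ℕ)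

theorem memLp_excess (hb : ∀ r, |score w ρ r| ≤ U) :
    MemLp (excess w ρ color) 2 (tallyLaw n color) := by
  refine MemLp.of_bound Measurable.of_discrete.aestronglyMeasurable
    (∑ _a : Palette color, U) (Filter.Eventually.of_forall fun x => ?_)
  exact (Finset.abs_sum_le_sum_abs _ _).trans (Finset.sum_le_sum fun a _ => hb _)

theorem integral_excess (hb : ∀ r, |score w ρ r| ≤ U) :
    ∫ x, excess w ρ color x ∂(tallyLaw n color) = -bias w ρ n color := by
  simp only [excess, tallyLaw]
  rw [integral_finsetSum _ fun a _ => integrable_of_abs_le .of_discrete fun x => hb (x a), bias,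
    ← Finset.sum_neg_distrib]
  refine Finset.sum_congr rfl fun a _ => ?_
  rw [← integral_score]
  exact integral_comp_eval (μ := fun a => poissonMeasure (colorRate n color a)) (f := score w ρ)
    Measurable.of_discrete.aestronglyMeasurable

theorem variance_excess_le (hb : ∀ r, |score w ρ r| ≤ U) :
    Var[excess w ρ color; tallyLaw n color] ≤ k * U ^ 2 := by
  have hU : 0 ≤ U := (abs_nonneg _).trans (hb 0)
  have h1 : excess w ρ color = ∑ a, fun x : Palette color → ℕ => score w ρ (x a) := by
    ext x
    simp [excess]
  rw [h1, tallyLaw, variance_sum_pi (X := fun _ => score w ρ) fun a =>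
    MemLp.of_bound Measurable.of_discrete.aestronglyMeasurable U
      (Filter.Eventually.of_forall hb)]
  have h2 : ∀ a : Palette color, Var[score w ρ; poissonMeasure (colorRate n color a)] ≤ U ^ 2 := by
    intro a
    refine (variance_le_expectation_sq Measurable.of_discrete.aestronglyMeasurable).trans ?_
    have h3 : ∀ r, (score w ρ ^ 2) r ≤ U ^ 2 := fun r => by
      simpa using sq_le_sq' (abs_le.1 (hb r)).1 (abs_le.1 (hb r)).2
    calc ∫ r, (score w ρ ^ 2) r ∂(poissonMeasure (colorRate n color a))
        ≤ ∫ _r, U ^ 2 ∂(poissonMeasure (colorRate n color a)) := by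
          refine integral_mono (integrable_of_abs_le .of_discrete (U := U ^ 2) fun r => ?_)
            (integrable_const _) h3
          rw [abs_of_nonneg (by simpa using sq_nonneg _)]
          exact h3 r
      _ = U ^ 2 := by simp
  calc ∑ a, Var[score w ρ; poissonMeasure (colorRate n color a)]
      ≤ ∑ _a : Palette color, U ^ 2 := Finset.sum_le_sum fun a _ => h2 a
    _ = numColors color * U ^ 2 := by simp [numColors]
    _ ≤ k * U ^ 2 := by
        have : (numColors color : ℝ) ≤ k := by exact_mod_cast numColors_le color
        gcongr

theorem integrable_tallyError_sq :
    Integrable (fun x => tallyError w ρ color x ^ 2) (tallyLaw n color) := by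
  refine integrable_of_abs_le .of_discrete (U := (k : ℝ) ^ 2) fun x => ?_
  rw [abs_pow]
  exact pow_le_pow_left₀ (abs_nonneg _) (abs_tallyError_le w ρ color x) 2

theorem integral_tallyError_sq_le_of_bound {B : ℝ} (hB : ∀ x, |tallyError w ρ color x| ≤ B) :
    ∫ x, tallyError w ρ color x ^ 2 ∂(tallyLaw n color) ≤ B ^ 2 := by
  calc ∫ x, tallyError w ρ color x ^ 2 ∂(tallyLaw n color)
      ≤ ∫ _x, B ^ 2 ∂(tallyLaw n color) := by
        refine integral_mono (integrable_tallyError_sq n color) (integrable_const _) fun x => ?_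
        exact sq_le_sq' (abs_le.1 (hB x)).1 (abs_le.1 (hB x)).2
    _ = B ^ 2 := by simp

theorem integral_tallyError_sq_le (hb : ∀ r, |score w ρ r| ≤ U) :
    ∫ x, tallyError w ρ color x ^ 2 ∂(tallyLaw n color) ≤ bias w ρ n color ^ 2 + k * U ^ 2 := by
  have hm := memLp_excess n color hb
  have h1 := variance_eq_sub hm
  have h2 := variance_excess_le n color hb
  rw [integral_excess n color hb] at h1
  have h3 : ∫ x, tallyError w ρ color x ^ 2 ∂(tallyLaw n color) ≤
      ∫ x, (excess w ρ color ^ 2) x ∂(tallyLaw n color) := by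
    refine integral_mono (integrable_tallyError_sq n color) hm.integrable_sq fun x => ?_
    exact sq_le_sq.2 (abs_tallyError_le_abs_excess w ρ color x)
  linarith [neg_sq (bias w ρ n color)]

/-- A one-sided bias bound suffices: overestimates are capped by k - C, and an underestimate is at
most B plus the fluctuation v, with (B + |v|)² ≤ (1+τ) B² + (1+1/τ) v². -/
theorem integral_tallyError_sq_le_add (hb : ∀ r, |score w ρ r| ≤ U) {B τ : ℝ} (hB0 : 0 ≤ B)
    (hB : bias w ρ n color ≤ B) (hτ : 0 < τ) :
    ∫ x, tallyError w ρ color x ^ 2 ∂(tallyLaw n color) ≤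
      (k - numColors color) ^ 2 + (1 + τ) * B ^ 2 + (1 + 1 / τ) * (k * U ^ 2) := by
  have hm := memLp_excess n color hb
  have h2 := variance_excess_le n color hb
  rw [variance_eq_integral hm.aestronglyMeasurable.aemeasurable, integral_excess n color hb] at h2
  have hCk : (numColors color : ℝ) ≤ k := by exact_mod_cast numColors_le color
  have hint : Integrable (fun x => (excess w ρ color x - -bias w ρ n color) ^ 2)
      (tallyLaw n color) := (hm.sub (memLp_const _)).integrable_sq
  have hpt : ∀ x, tallyError w ρ color x ^ 2 ≤ ((k - numColors color) ^ 2 + (1 + τ) * B ^ 2) +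
      (1 + 1 / τ) * (excess w ρ color x - -bias w ρ n color) ^ 2 := by
    intro x
    set v := excess w ρ color x - -bias w ρ n color with hv
    have hn : 0 ≤ (1 + τ) * B ^ 2 := by positivity
    have hn2 : 0 ≤ (1 + 1 / τ) * v ^ 2 := by positivity
    rcases le_total 0 (tallyError w ρ color x) with h | h
    · have := pow_le_pow_left₀ h (tallyError_le w ρ color x) 2
      linarith
    · have h4 : -tallyError w ρ color x ≤ B + |v| := by
        refine (neg_tallyError_le_max w ρ color x).trans (max_le (by positivity) ?_)
        have := neg_le_abs v
        linarith
      have h5 := pow_le_pow_left₀ (neg_nonneg.2 h) h4 2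
      rw [neg_sq] at h5
      have h6 : (B + |v|) ^ 2 ≤ (1 + τ) * B ^ 2 + (1 + 1 / τ) * v ^ 2 := by
        have h7 : 0 ≤ (τ * B - |v|) ^ 2 / τ := by positivity
        have h8 : (τ * B - |v|) ^ 2 / τ = τ * B ^ 2 - 2 * B * |v| + 1 / τ * v ^ 2 := by
          rw [← sq_abs v]
          field_simp
          ring
        nlinarith [sq_abs v]
      have h9 : 0 ≤ ((k : ℝ) - numColors color) ^ 2 := sq_nonneg _
      linarith
  calc ∫ x, tallyError w ρ color x ^ 2 ∂(tallyLaw n color)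
      ≤ ∫ x, (((k - numColors color) ^ 2 + (1 + τ) * B ^ 2) +
        (1 + 1 / τ) * (excess w ρ color x - -bias w ρ n color) ^ 2) ∂(tallyLaw n color) :=
        integral_mono (integrable_tallyError_sq n color)
          ((integrable_const _).add (hint.const_mul _)) hpt
    _ = ((k - numColors color) ^ 2 + (1 + τ) * B ^ 2) + (1 + 1 / τ) *
        ∫ x, (excess w ρ color x - -bias w ρ n color) ^ 2 ∂(tallyLaw n color) := by
        rw [integral_add (integrable_const _) (hint.const_mul _), integral_const_mul]
        simp
    _ ≤ _ := by gcongr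

end Moments

/-! ### Bias and variance for the optimal coefficients -/

section Bounds

variable {α β : ℝ} {k : ℕ} {n : ℝ≥0}

theorem degreeL_le (hα : 0 < α) (k : ℕ) : (degreeL α k : ℝ) ≤ α * Real.log k :=
  Nat.floor_le (mul_nonneg hα.le (Real.log_natCast_nonneg k))

theorem lt_degreeL_add_one (α : ℝ) (k : ℕ) : α * Real.log k < degreeL α k + 1 :=
  Nat.lt_floor_add_one _

theorem le_mul_nodesM (hn : 0 < n) : β * k * Real.log k ≤ n * nodesM β k n := by
  have hn' : (0 : ℝ) < n := hn
  have := Nat.le_ceil (β * k * Real.log k / n)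
  rw [div_le_iff₀ hn'] at this
  rw [mul_comm (n : ℝ)]
  exact this

theorem log_natCast_pos (hk : 2 ≤ k) : 0 < Real.log k :=
  Real.log_pos (by exact_mod_cast (by omega : 1 < k))

theorem nodesM_pos (hβ : 4 ≤ β) (hk : 2 ≤ k) (hn : 0 < n) : 0 < nodesM β k n := by
  have hn' : (0 : ℝ) < n := hn
  have := log_natCast_pos hk
  have hk' : (0 : ℝ) < k := by exact_mod_cast (by omega : 0 < k)
  exact Nat.ceil_pos.2 (by positivity)

/-- The scaling of u_j is chosen for this: multiplicities 1, ..., M land exactly on the grid. -/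
theorem mul_colorRate (hβ : 4 ≤ β) (hk : 2 ≤ k) (hn : 0 < n) (color : Fin k → ℕ)
    (a : Palette color) :
    (k : ℝ) / (n * nodesM β k n) * colorRate n color a = multiplicity color a / nodesM β k n := by
  have hn' : (n : ℝ) ≠ 0 := by exact_mod_cast hn.ne'
  have hM : (nodesM β k n : ℝ) ≠ 0 := by exact_mod_cast (nodesM_pos hβ hk hn).ne'
  have hk' : (k : ℝ) ≠ 0 := by exact_mod_cast (by omega : k ≠ 0)
  simp only [colorRate]
  push_cast
  field_simp

theorem exp_four_mul_degreeL_le (hα : 0 < α) (k : ℕ) :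
    Real.exp (4 * degreeL α k) ≤ Real.exp (4 * α * Real.log k) := by
  rw [mul_assoc]
  exact Real.exp_le_exp.2 (mul_le_mul_of_nonneg_left (degreeL_le hα k) (by norm_num))

/-- For j ≤ L, j! ρ^j ≤ (L ρ)^j ≤ 1 because L k ≤ β k log k ≤ n M; so only the size of w* matters.
-/
theorem abs_coeff_le (hα : 0 < α) (hα' : α ≤ 1 / 32) (hβ : 4 ≤ β) (hk : 2 ≤ k) (hn : 0 < n) {D : ℝ}
    (hD : 1 ≤ D) (hb : ∀ y < nodesM β k n, |(fitPoly (optimalW (nodesM β k n) (degreeL α k))).eval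
      (((y : ℝ) + 1) / nodesM β k n)| ≤ D) (i : Fin (degreeL α k)) :
    |optimalW (nodesM β k n) (degreeL α k) i * ((i : ℕ) + 1)! *
      ((k : ℝ) / (n * nodesM β k n)) ^ ((i : ℕ) + 1)| ≤
        D * Real.exp (4 * α * Real.log k) := by
  have hn' : (0 : ℝ) < n := hn
  have hM : (0 : ℝ) < nodesM β k n := by exact_mod_cast nodesM_pos hβ hk hn
  have hk' : (0 : ℝ) < k := by exact_mod_cast (by omega : 0 < k)
  have hl := log_natCast_pos hk
  have h1 : (degreeL α k : ℝ) * (k / (n * nodesM β k n)) ≤ 1 := by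
    rw [← mul_div_assoc, div_le_one (by positivity)]
    refine le_trans ?_ (le_mul_nodesM hn)
    calc (degreeL α k : ℝ) * k ≤ α * Real.log k * k := by gcongr; exact degreeL_le hα k
      _ ≤ β * Real.log k * k := by gcongr; linarith
      _ = _ := by ring
  have h2 : (((i : ℕ) + 1)! : ℝ) * ((k : ℝ) / (n * nodesM β k n)) ^ ((i : ℕ) + 1) ≤ 1 := by
    have h3 : (((i : ℕ) + 1)! : ℝ) ≤ (degreeL α k : ℝ) ^ ((i : ℕ) + 1) := by
      have h4 := Nat.factorial_le_pow ((i : ℕ) + 1)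
      have h5 : ((i : ℕ) + 1) ^ ((i : ℕ) + 1) ≤ degreeL α k ^ ((i : ℕ) + 1) :=
        Nat.pow_le_pow_left i.2 _
      exact_mod_cast h4.trans h5
    calc _ ≤ (degreeL α k : ℝ) ^ ((i : ℕ) + 1) * ((k : ℝ) / (n * nodesM β k n)) ^ ((i : ℕ) + 1) := by
          gcongr
      _ = ((degreeL α k : ℝ) * (k / (n * nodesM β k n))) ^ ((i : ℕ) + 1) := by rw [mul_pow]
      _ ≤ 1 := pow_le_one₀ (by positivity) h1
  rw [mul_assoc, abs_mul, abs_of_nonneg (a := (((i : ℕ) + 1)! : ℝ) * _) (by positivity)]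
  have h6 : |optimalW (nodesM β k n) (degreeL α k) i| ≤ D * Real.exp (4 * α * Real.log k) := by
    refine le_trans ?_ (mul_le_mul_of_nonneg_left (exp_four_mul_degreeL_le hα k) (by linarith))
    refine le_trans ?_ (sum_abs_optimalW_le hD hb)
    exact Finset.single_le_sum (f := fun i => |optimalW (nodesM β k n) (degreeL α k) i|)
      (fun _ _ => abs_nonneg _) (Finset.mem_univ i)
  calc _ ≤ D * Real.exp (4 * α * Real.log k) * 1 := by gcongr
    _ = _ := mul_one _

theorem abs_eval_fitPoly_le {L : ℕ} (w : Fin L → ℝ) {x W : ℝ} (hx : 1 ≤ x) (hW : 1 ≤ W)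
    (h : ∑ i, |w i| ≤ W) : |(fitPoly w).eval x| ≤ 2 * W * x ^ L := by
  have h1 : 1 ≤ x ^ L := one_le_pow₀ hx
  rw [eval_fitPoly]
  have h2 : |∑ i : Fin L, w i * x ^ ((i : ℕ) + 1)| ≤ W * x ^ L := by
    refine (Finset.abs_sum_le_sum_abs _ _).trans ?_
    refine le_trans ?_ (mul_le_mul_of_nonneg_right h (by positivity))
    rw [Finset.sum_mul]
    refine Finset.sum_le_sum fun i _ => ?_
    rw [abs_mul, abs_of_nonneg (a := x ^ _) (by positivity)]
    exact mul_le_mul_of_nonneg_left (pow_le_pow_right₀ hx i.2) (abs_nonneg _)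
  calc _ ≤ |(1 : ℝ)| + |∑ i : Fin L, w i * x ^ ((i : ℕ) + 1)| := abs_sub _ _
    _ ≤ 1 + W * x ^ L := by rw [abs_one]; gcongr
    _ ≤ W * x ^ L + W * x ^ L := by
        have : 1 ≤ W * x ^ L := one_le_mul_of_one_le_of_one_le hW h1
        linarith
    _ = _ := by ring

/-- Colours with more than `M` balls contribute little to the bias. -/
theorem exp_neg_mul_abs_eval_le (hα : 0 < α) (hα' : α ≤ 1 / 32) (hβ : 4 ≤ β) (hk : 2 ≤ k) {D : ℝ}
    (hD : 1 ≤ D) {w : Fin (degreeL α k) → ℝ} (hw : ∑ i, |w i| ≤ D * Real.exp (4 * degreeL α k))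
    {x l : ℝ} (hx : 1 ≤ x) (hl : x * (β * Real.log k) ≤ l) :
    Real.exp (-l) * |(fitPoly w).eval x| ≤ 2 * D / k := by
  have hlog := log_natCast_pos hk
  have hk' : (0 : ℝ) < k := by exact_mod_cast (by omega : 0 < k)
  have hW : 1 ≤ D * Real.exp (4 * α * Real.log k) :=
    one_le_mul_of_one_le_of_one_le hD (Real.one_le_exp (by positivity))
  have h1 := abs_eval_fitPoly_le w hx hW (hw.trans
    (mul_le_mul_of_nonneg_left (exp_four_mul_degreeL_le hα k) (by linarith)))
  have h2 : x ^ degreeL α k ≤ Real.exp (α * Real.log k * x) := by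
    have h3 : x ≤ Real.exp x := by linarith [Real.add_one_le_exp x]
    calc x ^ degreeL α k ≤ Real.exp x ^ degreeL α k := by gcongr
      _ = Real.exp (degreeL α k * x) := by rw [← Real.exp_nat_mul]
      _ ≤ _ := by gcongr; exact degreeL_le hα k
  calc Real.exp (-l) * |(fitPoly w).eval x|
      ≤ Real.exp (-(x * (β * Real.log k))) * (2 * (D * Real.exp (4 * α * Real.log k)) *
        Real.exp (α * Real.log k * x)) := by
        refine mul_le_mul (Real.exp_le_exp.2 (neg_le_neg hl)) (h1.trans ?_) (abs_nonneg _)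
          (Real.exp_pos _).le
        gcongr
    _ = 2 * D * Real.exp (-(x * (β * Real.log k)) + 4 * α * Real.log k + α * Real.log k * x) := by
        rw [Real.exp_add, Real.exp_add]
        ring
    _ ≤ 2 * D * Real.exp (-Real.log k) := by
        gcongr
        -- The exponent per unit of log k; x ≥ 1, α ≤ 1/32 and β ≥ 4 leave ample room.
        have h4 : -(x * β) + 4 * α + α * x ≤ -1 := by nlinarith
        nlinarith
    _ = 2 * D / k := by
        rw [Real.exp_neg, Real.exp_log hk']
        rfl

variable (hα : 0 < α) (hα' : α ≤ 1 / 32) (hβ : 4 ≤ β) (hk : 2 ≤ k) (hn : 0 < n) {D δ : ℝ}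
  (hD : 1 ≤ D) (hδ : 0 ≤ δ) (hδD : δ ≤ D)
  (hb : ∀ y < nodesM β k n, |(fitPoly (optimalW (nodesM β k n) (degreeL α k))).eval
      (((y : ℝ) + 1) / nodesM β k n)| ≤ δ) (color : Fin k → ℕ)

include hα hα' hβ hk hn hD hδ hδD hb

/-- Colours with at most M balls sit on the grid and cost δ; the others cost 2D/k each, hence 2D in
total. D ≥ max(1, δ) is kept apart from δ because the coefficient bound needs D ≥ 1 even when δ is
tiny. -/
theorem abs_bias_term_le (a : Palette color) :
    |Real.exp (-colorRate n color a) * (fitPoly (optimalW (nodesM β k n) (degreeL α k))).eval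
      ((k : ℝ) / (n * nodesM β k n) * colorRate n color a)| ≤ δ + 2 * D / k := by
  have hM : (0 : ℝ) < nodesM β k n := by exact_mod_cast nodesM_pos hβ hk hn
  have hk' : (0 : ℝ) < k := by exact_mod_cast (by omega : 0 < k)
  rw [mul_colorRate hβ hk hn, abs_mul, abs_of_pos (Real.exp_pos _)]
  rcases le_or_gt (multiplicity color a) (nodesM β k n) with h | h
  · obtain ⟨y, hy⟩ : ∃ y, multiplicity color a = y + 1 :=
      ⟨multiplicity color a - 1, by have := multiplicity_pos color a; omega⟩
    have h1 := hb y (by omega)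
    rw [hy]
    push_cast
    have h2 : Real.exp (-colorRate n color a) ≤ 1 := Real.exp_le_one_iff.2 (by simp)
    have h3 : 0 ≤ 2 * D / k := by positivity
    calc _ ≤ 1 * δ := by gcongr
      _ ≤ _ := by linarith
  · have h1 : (1 : ℝ) ≤ multiplicity color a / nodesM β k n := by
      rw [one_le_div hM]
      exact_mod_cast h.le
    have h2 : (multiplicity color a / nodesM β k n : ℝ) * (β * Real.log k) ≤
        colorRate n color a := by
      have h3 := le_mul_nodesM (β := β) (k := k) hn
      simp only [colorRate]
      push_cast
      rw [div_mul_eq_mul_div, div_le_div_iff₀ hM hk']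
      have h4 : (0 : ℝ) ≤ multiplicity color a := by positivity
      nlinarith [mul_le_mul_of_nonneg_left h3 h4]
    have h3 := exp_neg_mul_abs_eval_le hα hα' hβ hk hD
      (sum_abs_optimalW_le hD fun y hy => (hb y hy).trans hδD) h1 h2
    linarith

theorem abs_bias_le :
    |bias (optimalW (nodesM β k n) (degreeL α k)) ((k : ℝ) / (n * nodesM β k n)) n color| ≤
      numColors color * δ + 2 * D := by
  have hk' : (0 : ℝ) < k := by exact_mod_cast (by omega : 0 < k)
  have hC : (numColors color : ℝ) ≤ k := by exact_mod_cast numColors_le color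
  refine (Finset.abs_sum_le_sum_abs _ _).trans ((Finset.sum_le_sum fun a _ =>
    abs_bias_term_le hα hα' hβ hk hn hD hδ hδD hb color a).trans ?_)
  rw [Finset.sum_const, Finset.card_univ, card_palette, nsmul_eq_mul, mul_add]
  have : (numColors color : ℝ) * (2 * D / k) ≤ k * (2 * D / k) := by gcongr
  rw [mul_div_cancel₀ _ hk'.ne'] at this
  linarith

/-- Singletons are charged r. Any other colour is charged (k_a - 1) δ ≥ δ, and the sum of k_a - 1
over all colours is k - C, small when almost all balls have distinct colours. -/
theorem bias_le {r : ℝ} (hr : 0 ≤ r)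
    (h0 : (fitPoly (optimalW (nodesM β k n) (degreeL α k))).eval (1 / (nodesM β k n : ℝ)) ≤ r) :
    bias (optimalW (nodesM β k n) (degreeL α k)) ((k : ℝ) / (n * nodesM β k n)) n color ≤
      k * r + (k - numColors color) * δ + 2 * D := by
  have hk' : (0 : ℝ) < k := by exact_mod_cast (by omega : 0 < k)
  have hC : (numColors color : ℝ) ≤ k := by exact_mod_cast numColors_le color
  have hterm : ∀ a : Palette color, Real.exp (-colorRate n color a) *
      (fitPoly (optimalW (nodesM β k n) (degreeL α k))).eval
        ((k : ℝ) / (n * nodesM β k n) * colorRate n color a) ≤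
      r + 2 * D / k + (multiplicity color a - 1) * δ := by
    intro a
    have hp : 0 ≤ 2 * D / k := by positivity
    have hpos := multiplicity_pos color a
    by_cases h1 : multiplicity color a = 1
    · rw [mul_colorRate hβ hk hn, h1]
      have h2 : Real.exp (-colorRate n color a) ≤ 1 := Real.exp_le_one_iff.2 (by simp)
      have h3 := Real.exp_pos (-colorRate n color a)
      have h4 : Real.exp (-colorRate n color a) *
        (fitPoly (optimalW (nodesM β k n) (degreeL α k))).eval (1 / (nodesM β k n : ℝ)) ≤ r := by
        nlinarith
      push_cast
      linarith
    · have h2 := (le_abs_self _).trans (abs_bias_term_le hα hα' hβ hk hn hD hδ hδD hb color a)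
      have h3 : (2 : ℝ) ≤ multiplicity color a := by
        exact_mod_cast (by omega : 2 ≤ multiplicity color a)
      nlinarith
  refine (Finset.sum_le_sum fun a _ => hterm a).trans ?_
  rw [Finset.sum_add_distrib, Finset.sum_const, Finset.card_univ, card_palette, nsmul_eq_mul,
    ← Finset.sum_mul, Finset.sum_sub_distrib, ← Nat.cast_sum, sum_multiplicity, Finset.sum_const,
    Finset.card_univ, card_palette]
  have h5 : (numColors color : ℝ) * (2 * D / k) ≤ k * (2 * D / k) := by gcongr
  rw [mul_div_cancel₀ _ hk'.ne'] at h5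
  have h6 : (numColors color : ℝ) * r ≤ k * r := by gcongr
  simp only [nsmul_eq_mul, mul_one]
  linarith

omit hδ in
theorem abs_score_optimalW_le (r : ℕ) :
    |score (optimalW (nodesM β k n) (degreeL α k)) ((k : ℝ) / (n * nodesM β k n)) r| ≤
      D * Real.exp (4 * α * Real.log k) := by
  have hlog := log_natCast_pos hk
  exact abs_score_le (one_le_mul_of_one_le_of_one_le hD (Real.one_le_exp (by positivity)))
    (abs_coeff_le hα hα' hβ hk hn hD fun y hy => (hb y hy).trans hδD) r

theorem mse_le :
    ∫ x, tallyError (optimalW (nodesM β k n) (degreeL α k)) ((k : ℝ) / (n * nodesM β k n)) color x ^ 2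
      ∂(tallyLaw n color) ≤
      (numColors color * δ + 2 * D) ^ 2 + D ^ 2 * Real.exp ((1 + 8 * α) * Real.log k) := by
  have hk' : (0 : ℝ) < k := by exact_mod_cast (by omega : 0 < k)
  have h1 := integral_tallyError_sq_le n color
    (abs_score_optimalW_le hα hα' hβ hk hn hD hδD hb)
  have h2 := abs_bias_le hα hα' hβ hk hn hD hδ hδD hb color
  have h3 := pow_le_pow_left₀ (abs_nonneg _) h2 2
  rw [sq_abs] at h3
  have h4 : (k : ℝ) * (D * Real.exp (4 * α * Real.log k)) ^ 2 =
      D ^ 2 * Real.exp ((1 + 8 * α) * Real.log k) := by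
    rw [mul_pow, ← Real.exp_nat_mul, add_mul, one_mul, Real.exp_add, Real.exp_log hk']
    rw [show ((2 : ℕ) : ℝ) * (4 * α * Real.log k) = 8 * α * Real.log k by push_cast; ring]
    ring
  rw [h4] at h1
  linarith

theorem mse_le_add {r τ : ℝ} (hr : 0 ≤ r) (hτ : 0 < τ)
    (h0 : (fitPoly (optimalW (nodesM β k n) (degreeL α k))).eval (1 / (nodesM β k n : ℝ)) ≤ r) :
    ∫ x, tallyError (optimalW (nodesM β k n) (degreeL α k)) ((k : ℝ) / (n * nodesM β k n)) color x ^ 2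
      ∂(tallyLaw n color) ≤
      (k - numColors color) ^ 2 + (1 + τ) * (k * r + (k - numColors color) * δ + 2 * D) ^ 2 +
        (1 + 1 / τ) * (D ^ 2 * Real.exp ((1 + 8 * α) * Real.log k)) := by
  have hk' : (0 : ℝ) < k := by exact_mod_cast (by omega : 0 < k)
  have hC : (numColors color : ℝ) ≤ k := by exact_mod_cast numColors_le color
  have hB0 : 0 ≤ k * r + (k - numColors color) * δ + 2 * D := by
    have := mul_nonneg (sub_nonneg.2 hC) hδ
    positivity
  have h1 := integral_tallyError_sq_le_add n color
    (abs_score_optimalW_le hα hα' hβ hk hn hD hδD hb) hB0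
    (bias_le hα hα' hβ hk hn hD hδ hδD hb color hr h0) hτ
  have h4 : (k : ℝ) * (D * Real.exp (4 * α * Real.log k)) ^ 2 =
      D ^ 2 * Real.exp ((1 + 8 * α) * Real.log k) := by
    rw [mul_pow, ← Real.exp_nat_mul, add_mul, one_mul, Real.exp_add, Real.exp_log hk']
    rw [show ((2 : ℕ) : ℝ) * (4 * α * Real.log k) = 8 * α * Real.log k by push_cast; ring]
    ring
  rwa [h4] at h1

end Bounds

/-! ### The mean squared error under Poisson sampling -/

/-- The mean squared error of the estimator under Poisson sampling. -/
def poissonMSE (α β : ℝ) {k : ℕ} (n : ℝ≥0) (color : Fin k → ℕ) : ℝ :=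
  ∫ x, tallyError (optimalW (nodesM β k n) (degreeL α k)) ((k : ℝ) / (n * nodesM β k n)) color x ^ 2
    ∂(tallyLaw n color)

/-- Both bounds follow from (L+1)²/M ≥ 2κY with κ = α²/(4β) and Y = n log k / k ≥ 1; for M ≤ L the
values are zero. -/
theorem eval_optimalW_bounds {α β : ℝ} (hα : 0 < α) (hβ : 4 ≤ β) {k : ℕ} (hk : 2 ≤ k) {n : ℝ≥0}
    (hn : 0 < n) (hL : 1 ≤ degreeL α k) (hkn : (k : ℝ) ≤ n * Real.log k) :
    (∀ y < nodesM β k n, (fitPoly (optimalW (nodesM β k n) (degreeL α k))).eval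
      (((y : ℝ) + 1) / nodesM β k n) ^ 2 ≤ 1 / (1 - Real.exp (-(α ^ 2 / (4 * β)))) *
        Real.exp (-(α ^ 2 / (4 * β) * (n * Real.log k / k)))) ∧
    (fitPoly (optimalW (nodesM β k n) (degreeL α k))).eval (1 / (nodesM β k n : ℝ)) ≤
      1 / (1 + 3 / 4 * (α ^ 2 / (4 * β))) := by
  have hn' : (0 : ℝ) < n := hn
  have hk' : (0 : ℝ) < k := by exact_mod_cast (by omega : 0 < k)
  have hlog := log_natCast_pos hk
  set κ := α ^ 2 / (4 * β) with hκ
  have hκ0 : 0 < κ := by positivity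
  set Y := n * Real.log k / k with hY
  have hY1 : 1 ≤ Y := (one_le_div hk').2 hkn
  have hexp : Real.exp (-κ) < 1 := Real.exp_lt_one_iff.2 (by linarith)
  have hMpos := nodesM_pos hβ hk hn
  rcases le_or_gt (nodesM β k n) (degreeL α k) with h | h
  · constructor
    · intro y hy
      rw [eval_fitPoly_optimalW_eq_zero h hy]
      have : 0 < 1 - Real.exp (-κ) := by linarith
      rw [zero_pow two_ne_zero]
      positivity
    · have := eval_fitPoly_optimalW_eq_zero h hMpos
      simp only [Nat.cast_zero, zero_add] at this
      rw [this]
      positivity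
  have hmin := (isOptimal_optimalW (nodesM β k n) (degreeL α k)).1
  have hM : (0 : ℝ) < nodesM β k n := by exact_mod_cast hMpos
  have hs : 2 * κ * Y ≤ ((degreeL α k : ℝ) + 1) ^ 2 / nodesM β k n := by
    -- M > L ≥ 1 gives M ≥ 2, so rounding up at most doubles; this is where the 4 in κ comes from.
    have h1 : 1 < β * k * Real.log k / n := by
      by_contra! hcon
      have : nodesM β k n ≤ 1 := Nat.ceil_le.2 (by exact_mod_cast hcon)
      omega
    have h2 : (nodesM β k n : ℝ) ≤ 2 * (β * k * Real.log k / n) := by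
      have := Nat.ceil_lt_add_one (a := β * k * Real.log k / n) (by positivity)
      have h3 : (nodesM β k n : ℝ) < β * k * Real.log k / n + 1 := this
      linarith
    rw [le_div_iff₀ hM]
    calc 2 * κ * Y * nodesM β k n ≤ 2 * κ * Y * (2 * (β * k * Real.log k / n)) := by gcongr
      _ = (α * Real.log k) ^ 2 := by
          rw [hκ, hY]
          field_simp
          ring
      _ ≤ _ := by
          have := (lt_degreeL_add_one α k).le
          gcongr
  have hs2 : 2 * κ ≤ ((degreeL α k : ℝ) + 1) ^ 2 / nodesM β k n := by nlinarith
  constructor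
  · intro y hy
    refine (hmin.sq_eval_le h hy).trans ?_
    have hR := exp_le_hahnRatio h
    have hR2 : Real.exp (κ * Y) ≤ hahnRatio (nodesM β k n) (degreeL α k) := by
      refine le_trans (Real.exp_le_exp.2 ?_) hR
      rw [mul_comm (2 : ℝ), ← div_div]
      linarith
    have h3 : (1 - Real.exp (-κ)) * Real.exp (κ * Y) ≤ Real.exp (κ * Y) - 1 := by
      have h4 : 1 ≤ Real.exp (-κ) * Real.exp (κ * Y) := by
        rw [← Real.exp_add]
        exact Real.one_le_exp (by nlinarith)
      linarith
    have h5 : 0 < (1 - Real.exp (-κ)) * Real.exp (κ * Y) :=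
      mul_pos (by linarith) (Real.exp_pos _)
    calc 1 / (hahnRatio (nodesM β k n) (degreeL α k) - 1)
        ≤ 1 / ((1 - Real.exp (-κ)) * Real.exp (κ * Y)) :=
          one_div_le_one_div_of_le h5 (by linarith)
      _ = _ := by
          rw [Real.exp_neg (κ * Y), one_div, mul_inv, one_div]
  · refine (hmin.eval_first_le hL h).trans ?_
    exact one_div_le_one_div_of_le (by positivity) (by linarith)

theorem poissonMSE_le_sq (α β : ℝ) {k : ℕ} (n : ℝ≥0) (color : Fin k → ℕ) :
    poissonMSE α β n color ≤ (k : ℝ) ^ 2 :=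
  integral_tallyError_sq_le_of_bound n color (abs_tallyError_le _ _ color)

theorem tallyLaw_zero {k : ℕ} (hk : 1 ≤ k) (n : ℝ≥0) (color : Fin k → ℕ) :
    (tallyLaw n color).real {0} = Real.exp (-n) := by
  have hk' : (k : ℝ) ≠ 0 := by exact_mod_cast (by omega : k ≠ 0)
  rw [measureReal_def, tallyLaw, Measure.pi_singleton, ENNReal.toReal_prod]
  simp only [← measureReal_def, poissonMeasure_real_singleton, Pi.zero_apply, pow_zero, mul_one,
    Nat.factorial_zero, Nat.cast_one, div_one]
  rw [← Real.exp_sum, Finset.sum_neg_distrib]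
  simp only [colorRate]
  push_cast
  rw [← Finset.sum_div, ← Finset.mul_sum, ← Nat.cast_sum, sum_multiplicity,
    mul_div_cancel_right₀ _ hk']

/-- A bound for small urns: the estimator errs by `k` only if nothing is drawn. -/
theorem poissonMSE_le_of_one_le (α β : ℝ) {k : ℕ} (hk : 1 ≤ k) {n : ℝ≥0} (hn : 1 ≤ n)
    (color : Fin k → ℕ) : poissonMSE α β n color ≤ (k : ℝ) ^ 2 - k / 2 := by
  have hk' : (1 : ℝ) ≤ k := by exact_mod_cast hk
  have hn' : (1 : ℝ) ≤ n := hn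
  set w := optimalW (nodesM β k n) (degreeL α k)
  set ρ := (k : ℝ) / (n * nodesM β k n)
  have hpt : ∀ x, tallyError w ρ color x ^ 2 ≤ ((k : ℝ) - 1) ^ 2 +
      Set.indicator {0} (fun _ => (k : ℝ) ^ 2 - (k - 1) ^ 2) x := by
    intro x
    by_cases hx : x = 0
    · simp only [hx, Set.mem_singleton_iff, Set.indicator_of_mem, add_sub_cancel]
      exact sq_le_sq' (abs_le.1 (abs_tallyError_le w ρ color 0)).1
        (abs_le.1 (abs_tallyError_le w ρ color 0)).2
    · have h1 := abs_tallyError_le_pred w ρ color x hx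
      simp only [Set.mem_singleton_iff, hx, not_false_eq_true, Set.indicator_of_notMem, add_zero]
      exact sq_le_sq' (abs_le.1 h1).1 (abs_le.1 h1).2
  have hint : Integrable (Set.indicator {0} fun _ : Palette color → ℕ =>
      (k : ℝ) ^ 2 - (k - 1) ^ 2) (tallyLaw n color) :=
    (integrable_const _).indicator (measurableSet_singleton _)
  have h1 : poissonMSE α β n color ≤ ∫ x, (((k : ℝ) - 1) ^ 2 +
      Set.indicator {0} (fun _ => (k : ℝ) ^ 2 - (k - 1) ^ 2) x) ∂(tallyLaw n color) :=
    integral_mono (integrable_tallyError_sq n color) ((integrable_const _).add hint) hpt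
  rw [integral_add (integrable_const _) hint,
    integral_indicator_const _ (measurableSet_singleton _), tallyLaw_zero hk] at h1
  simp only [integral_const, probReal_univ, smul_eq_mul, one_mul] at h1
  have h2 : Real.exp (-(n : ℝ)) ≤ 1 / 2 := by
    calc Real.exp (-(n : ℝ)) ≤ Real.exp (-1) := Real.exp_le_exp.2 (by linarith)
      _ = (Real.exp 1)⁻¹ := Real.exp_neg 1
      _ ≤ 2⁻¹ := by gcongr; linarith [Real.add_one_le_exp (1 : ℝ)]
      _ = 1 / 2 := by norm_num
  have h3 : 0 ≤ (k : ℝ) ^ 2 - (k - 1) ^ 2 := by nlinarith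
  nlinarith

theorem exp_mul_log_le {α : ℝ} (hα' : α ≤ 1 / 32) (k : ℕ) :
    Real.exp ((1 + 8 * α) * Real.log k) ≤ Real.exp (5 / 4 * Real.log k) :=
  Real.exp_le_exp.2 (mul_le_mul_of_nonneg_right (by linarith) (Real.log_natCast_nonneg k))

theorem exp_five_fourths_mul_log {k : ℕ} (hk : 1 ≤ k) :
    Real.exp (5 / 4 * Real.log k) = (k : ℝ) ^ 2 * Real.exp (-(3 / 4 * Real.log k)) := by
  have hk' : (0 : ℝ) < k := by exact_mod_cast hk
  conv_rhs => rw [← Real.exp_log hk', ← Real.exp_nat_mul, ← Real.exp_add, Real.exp_log hk']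
  congr 1
  push_cast
  ring

theorem eventually_exp_log_le {ε : ℝ} (hε : 0 < ε) :
    ∀ᶠ k : ℕ in Filter.atTop, Real.exp (-(3 / 4 * Real.log k)) ≤ ε := by
  have h1 : Filter.Tendsto (fun k : ℕ => Real.exp (-(3 / 4 * Real.log k))) Filter.atTop (nhds 0) :=
    Real.tendsto_exp_neg_atTop_nhds_zero.comp
      ((Real.tendsto_log_atTop.comp tendsto_natCast_atTop_atTop).const_mul_atTop (by norm_num))
  exact (h1.eventually_lt_const hε).mono fun _ h => h.le

theorem eventually_one_le_degreeL {α : ℝ} (hα : 0 < α) :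
    ∀ᶠ k : ℕ in Filter.atTop, 1 ≤ degreeL α k := by
  have h1 : Filter.Tendsto (fun k : ℕ => α * Real.log k) Filter.atTop Filter.atTop :=
    (Real.tendsto_log_atTop.comp tendsto_natCast_atTop_atTop).const_mul_atTop hα
  exact (h1.eventually_ge_atTop 1).mono fun _ h => Nat.le_floor (by exact_mod_cast h)

/-- The exponential bound, up to a constant factor. -/
theorem exists_poissonMSE_le_const_mul {α β : ℝ} (hα : 0 < α) (hα' : α ≤ 1 / 32) (hβ : 4 ≤ β) :
    ∃ A : ℝ, 1 ≤ A ∧ ∀ᶠ k : ℕ in Filter.atTop, ∀ n : ℝ≥0, 0 < n → (k : ℝ) ≤ n * Real.log k →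
      ∀ color : Fin k → ℕ, poissonMSE α β n color ≤ A * ((k : ℝ) ^ 2 *
        Real.exp (-(α ^ 2 / (4 * β) * min (n * Real.log k / k) (Real.log k)))) := by
  set κ := α ^ 2 / (4 * β) with hκ
  have hκ0 : 0 < κ := by positivity
  -- So that the variance, of order k^(5/4) = k² exp(-(3/4) log k), also fits under the target.
  have hκ1 : κ ≤ 3 / 4 := by
    rw [hκ, div_le_iff₀ (by linarith)]
    nlinarith
  have hexp : Real.exp (-κ) < 1 := Real.exp_lt_one_iff.2 (by linarith)
  set G := 1 / (1 - Real.exp (-κ)) with hG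
  have hG1 : 1 ≤ G := (one_le_div (by linarith)).2 (by linarith [Real.exp_pos (-κ)])
  -- 11 = 2 + 8 + 1: squared bias on the grid, colours with more than M balls, variance.
  refine ⟨11 * G, by linarith, ?_⟩
  filter_upwards [eventually_one_le_degreeL hα, Filter.eventually_ge_atTop 2] with k hL hk n hn hkn
    color
  have hk' : (1 : ℝ) ≤ k := by exact_mod_cast (by omega : 1 ≤ k)
  set Y := n * Real.log k / k with hY
  set X := min Y (Real.log k) with hX
  have hXY : X ≤ Y := min_le_left _ _
  have hXl : X ≤ Real.log k := min_le_right _ _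
  have hlog := log_natCast_pos hk
  have hY1 : 1 ≤ Y := (one_le_div (by linarith)).2 hkn
  have hX0 : 0 ≤ X := le_min (by linarith) hlog.le
  have hb := (eval_optimalW_bounds hα hβ hk hn hL hkn).1
  have hD : 1 ≤ Real.sqrt G := Real.one_le_sqrt.2 hG1
  have hE1 : Real.exp (-(κ * Y)) ≤ 1 := Real.exp_le_one_iff.2 (by nlinarith)
  have h1 := mse_le hα hα' hβ hk hn (D := Real.sqrt G)
    (δ := Real.sqrt (G * Real.exp (-(κ * Y)))) hD (Real.sqrt_nonneg _)
    (Real.sqrt_le_sqrt (by nlinarith)) (fun y hy => Real.abs_le_sqrt (hb y hy)) color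
  have hC : (numColors color : ℝ) ≤ k := by exact_mod_cast numColors_le color
  have h2 : (numColors color * Real.sqrt (G * Real.exp (-(κ * Y))) + 2 * Real.sqrt G) ^ 2 ≤
      2 * (k ^ 2 * (G * Real.exp (-(κ * Y)))) + 8 * G := by
    have e1 := Real.sq_sqrt (show 0 ≤ G * Real.exp (-(κ * Y)) by positivity)
    have e2 := Real.sq_sqrt (show 0 ≤ G by linarith)
    have h3 : numColors color * Real.sqrt (G * Real.exp (-(κ * Y))) ≤
        k * Real.sqrt (G * Real.exp (-(κ * Y))) := by gcongr
    calc _ ≤ (k * Real.sqrt (G * Real.exp (-(κ * Y))) + 2 * Real.sqrt G) ^ 2 := by gcongr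
      _ ≤ 2 * (k * Real.sqrt (G * Real.exp (-(κ * Y)))) ^ 2 + 2 * (2 * Real.sqrt G) ^ 2 := by
          nlinarith [sq_nonneg (k * Real.sqrt (G * Real.exp (-(κ * Y))) - 2 * Real.sqrt G)]
      _ = _ := by rw [mul_pow, mul_pow, e1, e2]; ring
  rw [Real.sq_sqrt (by linarith)] at h1
  have h4 := exp_mul_log_le hα' k
  rw [exp_five_fourths_mul_log (by omega)] at h4
  have h5 : Real.exp (-(κ * Y)) ≤ Real.exp (-(κ * X)) := Real.exp_le_exp.2 (by nlinarith)
  have h6 : Real.exp (-(3 / 4 * Real.log k)) ≤ Real.exp (-(κ * X)) :=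
    Real.exp_le_exp.2 (by nlinarith)
  have h7 : 1 ≤ (k : ℝ) ^ 2 * Real.exp (-(κ * X)) := by
    have : (k : ℝ) ^ 2 = Real.exp (2 * Real.log k) := by
      rw [two_mul, Real.exp_add, Real.exp_log (by linarith), sq]
    rw [this, ← Real.exp_add]
    exact Real.one_le_exp (by nlinarith)
  have h8 : (k : ℝ) ^ 2 * Real.exp (-(κ * Y)) ≤ k ^ 2 * Real.exp (-(κ * X)) := by gcongr
  have h9 : (k : ℝ) ^ 2 * Real.exp (-(3 / 4 * Real.log k)) ≤ k ^ 2 * Real.exp (-(κ * X)) := by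
    gcongr
  set Q := (k : ℝ) ^ 2 * Real.exp (-(κ * X)) with hQ
  calc poissonMSE α β n color ≤ (2 * (k ^ 2 * (G * Real.exp (-(κ * Y)))) + 8 * G) +
        G * Real.exp ((1 + 8 * α) * Real.log k) := h1.trans (by gcongr)
    _ = G * (2 * (k ^ 2 * Real.exp (-(κ * Y))) + 8 + Real.exp ((1 + 8 * α) * Real.log k)) := by ring
    _ ≤ G * (2 * Q + 8 * Q + Q) := by
        gcongr
        · linarith
        · exact h4.trans h9
    _ = 11 * G * Q := by ring

/-! ### Errors bounded away from k² -/

theorem le_one_sub_mul_of_few_colors {η θ D k C V E : ℝ} (hη0 : 0 < η) (hη1 : η < 1)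
    (hθη : θ ≤ η / 8) (hθD : θ * D = η / 8) (hC0 : 0 ≤ C) (hD : 1 ≤ D)
    (hC : C ≤ θ * k) (hkD : 2 * D ≤ η / 8 * k) (hV : V ≤ η / 64 * k ^ 2)
    (hE : E ≤ (C * D + 2 * D) ^ 2 + V) : E ≤ (1 - θ) * k ^ 2 := by
  have h2 : C * D + 2 * D ≤ η / 4 * k := by
    have : C * D ≤ θ * k * D := by gcongr
    have e : θ * k * D = η / 8 * k := by rw [← hθD]; ring
    linarith
  have h3 : (C * D + 2 * D) ^ 2 ≤ (η / 4 * k) ^ 2 := by gcongr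
  have h6 : (η / 4) ^ 2 + η / 64 ≤ 1 - θ := by
    have : η ^ 2 ≤ η := by nlinarith
    rw [div_pow]
    linarith
  calc E ≤ ((η / 4) ^ 2 + η / 64) * k ^ 2 := by
        rw [mul_pow] at h3
        linarith
    _ ≤ _ := mul_le_mul_of_nonneg_right h6 (sq_nonneg _)

/-- The singleton gap η = 1 - r leaves a bias of at most (1 - 3η/4) k, and τ = η/2 is small enough
that (1+τ)(1 - 3η/4)² ≤ 1 - η/4; the other terms fit in the remaining slack. -/
theorem le_one_sub_mul_of_many_colors {η θ D k C V E r : ℝ} (hη0 : 0 < η) (hη1 : η < 1)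
    (hθ0 : 0 < θ) (hθη : θ ≤ η / 8) (hθD : θ * D = η / 8) (hk : 0 ≤ k) (hD : 1 ≤ D)
    (hr : r = 1 - η) (hC : C ≤ k) (hC' : (1 - θ) * k ≤ C) (hkD : 2 * D ≤ η / 8 * k)
    (hV : V ≤ η / 64 * k ^ 2)
    (hE : E ≤ (k - C) ^ 2 + (1 + η / 2) * (k * r + (k - C) * D + 2 * D) ^ 2 + V) :
    E ≤ (1 - θ) * k ^ 2 := by
  have hkC := sub_nonneg.2 hC
  have h2 : k * r + (k - C) * D + 2 * D ≤ (1 - 3 * η / 4) * k := by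
    have : (k - C) * D ≤ θ * k * D := by
      refine mul_le_mul_of_nonneg_right ?_ (by linarith)
      linarith
    have e : k * r = k - η * k := by rw [hr]; ring
    have e' : θ * k * D = η / 8 * k := by rw [← hθD]; ring
    have : 0 ≤ η * k := by positivity
    linarith
  have h20 : 0 ≤ k * r + (k - C) * D + 2 * D := by
    have h21 : 0 ≤ (k - C) * D := mul_nonneg hkC (by linarith)
    have h22 : 0 ≤ k * r := mul_nonneg hk (by linarith)
    linarith
  have h3 := pow_le_pow_left₀ h20 h2 2
  have h4 : (k - C) ^ 2 ≤ (θ * k) ^ 2 := pow_le_pow_left₀ hkC (by linarith) 2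
  have h30 : (1 + η / 2) * (k * r + (k - C) * D + 2 * D) ^ 2 ≤
      (1 + η / 2) * ((1 - 3 * η / 4) * k) ^ 2 := mul_le_mul_of_nonneg_left h3 (by linarith)
  have hηη : η ^ 2 ≤ η := by nlinarith
  have h7 : θ ^ 2 ≤ η / 64 := by
    have h70 : θ ^ 2 ≤ (η / 8) ^ 2 := by gcongr
    rw [div_pow] at h70
    linarith
  have h8 : (1 + η / 2) * (1 - 3 * η / 4) ^ 2 ≤ 1 - η / 4 := by
    have h9 : (1 + η / 2) * (1 - 3 * η / 4) ≤ 1 - η / 4 := by nlinarith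
    have h10 : 0 ≤ (1 + η / 2) * (1 - 3 * η / 4) := by
      apply mul_nonneg <;> linarith
    calc (1 + η / 2) * (1 - 3 * η / 4) ^ 2 =
          ((1 + η / 2) * (1 - 3 * η / 4)) * (1 - 3 * η / 4) := by ring
      _ ≤ ((1 + η / 2) * (1 - 3 * η / 4)) * 1 := mul_le_mul_of_nonneg_left (by linarith) h10
      _ ≤ _ := by linarith
  have h6 : θ ^ 2 + (1 + η / 2) * (1 - 3 * η / 4) ^ 2 + η / 64 ≤ 1 - θ := by linarith
  calc E ≤ (θ ^ 2 + (1 + η / 2) * (1 - 3 * η / 4) ^ 2 + η / 64) * k ^ 2 := by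
        rw [mul_pow] at h4 h30
        linarith
    _ ≤ _ := mul_le_mul_of_nonneg_right h6 (sq_nonneg _)

/-- A bound by a constant factor less than one. -/
theorem exists_poissonMSE_le_one_sub_mul {α β : ℝ} (hα : 0 < α) (hα' : α ≤ 1 / 32) (hβ : 4 ≤ β) :
    ∃ ε : ℝ, 0 < ε ∧ ∀ᶠ k : ℕ in Filter.atTop, ∀ n : ℝ≥0, 0 < n → (k : ℝ) ≤ n * Real.log k →
      ∀ color : Fin k → ℕ, poissonMSE α β n color ≤ (1 - ε) * (k : ℝ) ^ 2 := by
  set κ := α ^ 2 / (4 * β) with hκ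
  have hκ0 : 0 < κ := by positivity
  have hexp : Real.exp (-κ) < 1 := Real.exp_lt_one_iff.2 (by linarith)
  set G := 1 / (1 - Real.exp (-κ)) with hG
  have hG1 : 1 ≤ G := (one_le_div (by linarith)).2 (by linarith [Real.exp_pos (-κ)])
  set D := Real.sqrt G with hDdef
  have hD : 1 ≤ D := Real.one_le_sqrt.2 hG1
  have hDG : D ^ 2 = G := Real.sq_sqrt (by linarith)
  set r := 1 / (1 + 3 / 4 * κ) with hr
  have hr0 : 0 < r := by positivity
  have hr1 : r < 1 := (div_lt_one (by positivity)).2 (by linarith)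
  obtain ⟨η, hη⟩ : ∃ η, η = 1 - r := ⟨_, rfl⟩
  have hη0 : 0 < η := by linarith
  have hη1 : η < 1 := by linarith
  -- Makes θ k colours with bias D each cost only η k / 8.
  set θ := η / (8 * D) with hθ
  have hθ0 : 0 < θ := by positivity
  have hθD : θ * D = η / 8 := by rw [hθ]; field_simp
  have hθη : θ ≤ η / 8 := by nlinarith
  refine ⟨θ, hθ0, ?_⟩
  filter_upwards [eventually_one_le_degreeL hα, Filter.eventually_ge_atTop 2,
    tendsto_natCast_atTop_atTop.eventually_ge_atTop (16 * D / η),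
    eventually_exp_log_le (show 0 < η / 64 / ((1 + 2 / η) * G) by positivity)]
    with k hL hk hkD hkG n hn hkn color
  have hk' : (1 : ℝ) ≤ k := by exact_mod_cast (by omega : 1 ≤ k)
  have hlog := log_natCast_pos hk
  obtain ⟨hb, hfirst⟩ := eval_optimalW_bounds hα hβ hk hn hL hkn
  have hbD : ∀ y < nodesM β k n, |(fitPoly (optimalW (nodesM β k n) (degreeL α k))).eval
      (((y : ℝ) + 1) / nodesM β k n)| ≤ D := by
    intro y hy
    refine Real.abs_le_sqrt ((hb y hy).trans ?_)
    have hn' : (0 : ℝ) < n := hn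
    have : Real.exp (-(κ * (n * Real.log k / k))) ≤ 1 := by
      refine Real.exp_le_one_iff.2 ?_
      have : 0 ≤ κ * (n * Real.log k / k) := by positivity
      linarith
    nlinarith
  have hC : (numColors color : ℝ) ≤ k := by exact_mod_cast numColors_le color
  have hC0 : (0 : ℝ) ≤ numColors color := Nat.cast_nonneg _
  have hkD' : 2 * D ≤ η / 8 * k := by
    rw [div_le_iff₀ hη0] at hkD
    linarith
  have hvar : (1 + 2 / η) * (G * Real.exp ((1 + 8 * α) * Real.log k)) ≤ η / 64 * (k : ℝ) ^ 2 := by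
    have h4 := exp_mul_log_le hα' k
    rw [exp_five_fourths_mul_log (by omega)] at h4
    rw [le_div_iff₀ (by positivity)] at hkG
    calc (1 + 2 / η) * (G * Real.exp ((1 + 8 * α) * Real.log k))
        ≤ (1 + 2 / η) * (G * ((k : ℝ) ^ 2 * Real.exp (-(3 / 4 * Real.log k)))) := by gcongr
      _ = (Real.exp (-(3 / 4 * Real.log k)) * ((1 + 2 / η) * G)) * (k : ℝ) ^ 2 := by ring
      _ ≤ _ := by gcongr
  rcases le_or_gt (numColors color : ℝ) (θ * k) with h | h
  · have h1 := mse_le hα hα' hβ hk hn hD (by linarith) le_rfl hbD color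
    rw [hDG] at h1
    refine le_one_sub_mul_of_few_colors hη0 hη1 hθη hθD hC0 hD h hkD'
      (le_trans (le_mul_of_one_le_left (by positivity) ?_) hvar) h1
    exact le_add_of_nonneg_right (by positivity)
  -- In the middle range the clamped error never exceeds max(k - C, C) ≤ (1 - θ) k.
  rcases le_or_gt (numColors color : ℝ) ((1 - θ) * k) with h' | h'
  · have h1 : ∀ x, |tallyError (optimalW (nodesM β k n) (degreeL α k))
        ((k : ℝ) / (n * nodesM β k n)) color x| ≤ (1 - θ) * k := fun x =>
      (abs_tallyError_le_max _ _ color x).trans (max_le (by linarith) h')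
    have h2 : poissonMSE α β n color ≤ ((1 - θ) * k) ^ 2 :=
      integral_tallyError_sq_le_of_bound n color h1
    refine h2.trans ?_
    rw [mul_pow]
    exact mul_le_mul_of_nonneg_right
      (pow_le_of_le_one (by linarith) (by linarith) two_ne_zero) (sq_nonneg _)
  · have h1 := mse_le_add hα hα' hβ hk hn hD (by linarith) le_rfl hbD color hr0.le
      (show 0 < η / 2 by linarith) hfirst
    rw [hDG, show 1 / (η / 2) = 2 / η by rw [one_div_div]] at h1
    exact le_one_sub_mul_of_many_colors hη0 hη1 hθ0 hθη hθD (by linarith) hD (by linarith) hC h'.le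
      hkD' hvar h1

/-! ### The exponential bound without a prefactor -/

/-- For large k, a large exponent absorbs the constant A by halving its rate, and a bounded exponent
is covered by the factor 1 - ε. For small k the exponent is at most c k uniformly in n, so the bound
k² - k/2 suffices. -/
theorem exists_poissonMSE_le {α β : ℝ} (hα : 0 < α) (hα' : α ≤ 1 / 32) (hβ : 4 ≤ β) :
    ∃ c : ℝ, 0 < c ∧ ∀ (k : ℕ) (n : ℝ≥0), 1 ≤ k → 0 < n → (k : ℝ) ≤ n * Real.log k →
      ∀ color : Fin k → ℕ, poissonMSE α β n color ≤ (k : ℝ) ^ 2 *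
        Real.exp (-(c * max 1 (min (n * Real.log k / k) (Real.log k)))) := by
  obtain ⟨A, hA, hev1⟩ := exists_poissonMSE_le_const_mul hα hα' hβ
  obtain ⟨ε, hε, hev2⟩ := exists_poissonMSE_le_one_sub_mul hα hα' hβ
  obtain ⟨k₀, hk₀⟩ := Filter.eventually_atTop.1 (hev1.and hev2)
  set κ := α ^ 2 / (4 * β) with hκ
  have hκ0 : 0 < κ := by positivity
  set X₀ := max 1 (2 * Real.log A / κ) with hX₀
  have hX₀1 : 1 ≤ X₀ := le_max_left _ _
  refine ⟨min (κ / 2) (min (ε / X₀) (1 / (2 * ((k₀ : ℝ) + 1) ^ 2))), by positivity, ?_⟩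
  intro k n hk hn hkn color
  set c := min (κ / 2) (min (ε / X₀) (1 / (2 * ((k₀ : ℝ) + 1) ^ 2))) with hc
  have hc0 : 0 < c := by positivity
  have hk' : (1 : ℝ) ≤ k := by exact_mod_cast hk
  have hn' : (0 : ℝ) < n := hn
  have hlogk : Real.log k ≤ k := by linarith [Real.log_le_sub_one_of_pos (show (0 : ℝ) < k by linarith)]
  set X := max 1 (min (n * Real.log k / k) (Real.log k)) with hX
  have hXk : X ≤ k := max_le hk' ((min_le_right _ _).trans hlogk)
  rcases le_or_gt k₀ k with hkk | hkk
  · obtain ⟨h1, h2⟩ := hk₀ k hkk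
    specialize h1 n hn hkn color
    specialize h2 n hn hkn color
    rcases le_or_gt X X₀ with hXX | hXX
    · refine h2.trans ?_
      rw [mul_comm]
      refine mul_le_mul_of_nonneg_left ?_ (sq_nonneg _)
      have h3 : c * X ≤ ε := by
        calc c * X ≤ ε / X₀ * X₀ := by
              gcongr
              exact (min_le_right _ _).trans (min_le_left _ _)
          _ = ε := div_mul_cancel₀ _ (by positivity)
      have h4 := Real.add_one_le_exp (-(c * X))
      linarith
    · have hX1 : 1 < X := lt_of_le_of_lt hX₀1 hXX
      have hXe : X = min (n * Real.log k / k) (Real.log k) := by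
        rcases max_choice 1 (min (n * Real.log k / k) (Real.log k)) with h | h
        · rw [← hX] at h
          linarith
        · exact h
      rw [← hXe] at h1
      refine h1.trans ?_
      have h3 : A ≤ Real.exp (κ / 2 * X) := by
        have h4 : 2 * Real.log A / κ ≤ X := (le_max_right _ _).trans hXX.le
        rw [div_le_iff₀ hκ0] at h4
        rw [← Real.log_le_iff_le_exp (by linarith)]
        linarith
      calc A * ((k : ℝ) ^ 2 * Real.exp (-(κ * X)))
          ≤ Real.exp (κ / 2 * X) * ((k : ℝ) ^ 2 * Real.exp (-(κ * X))) := by gcongr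
        _ = (k : ℝ) ^ 2 * Real.exp (-(κ / 2 * X)) := by
            rw [mul_left_comm, ← Real.exp_add]
            congr 2
            ring
        _ ≤ (k : ℝ) ^ 2 * Real.exp (-(c * X)) := by
            gcongr
            exact min_le_left _ _
  -- From k ≤ n log k and log k ≤ k.
  · have hn1 : 1 ≤ n := by
      have h0 : 0 < Real.log k := by
        by_contra! hcon
        nlinarith
      have : (1 : ℝ) ≤ n := by
        by_contra! hcon
        nlinarith
      exact this
    refine (poissonMSE_le_of_one_le α β hk hn1 color).trans ?_
    have h1 : c * X ≤ 1 / (2 * k) := by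
      have hkk' : (k : ℝ) ≤ k₀ + 1 := by exact_mod_cast (by omega : k ≤ k₀ + 1)
      calc c * X ≤ 1 / (2 * ((k₀ : ℝ) + 1) ^ 2) * k := by
            gcongr
            exact (min_le_right _ _).trans (min_le_right _ _)
        _ ≤ 1 / (2 * (k : ℝ) ^ 2) * k := by gcongr
        _ = 1 / (2 * k) := by field_simp
    have h2 := Real.add_one_le_exp (-(c * X))
    have h3 : (k : ℝ) ^ 2 - k / 2 = k ^ 2 * (1 - 1 / (2 * k)) := by field_simp
    rw [h3]
    refine mul_le_mul_of_nonneg_left ?_ (sq_nonneg _)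
    linarith

/-- Transfer from the sampling model to the law of the tally. -/
theorem IsPoissonSample.mse_eq {Ω : Type*} [MeasurableSpace Ω] {μ : Measure Ω}
    [IsProbabilityMeasure μ] {k : ℕ} (hk : 1 ≤ k) {n : ℝ≥0} {N : Ω → ℕ} {Y : ℕ → Ω → Fin k}
    (h : IsPoissonSample μ k n N Y) (color : Fin k → ℕ) (α β : ℝ) :
    Integrable (fun ω => (estimator α β k n (observed color N Y ω) - numColors color) ^ 2) μ ∧
      ∫ ω, (estimator α β k n (observed color N Y ω) - numColors color) ^ 2 ∂μ =
        poissonMSE α β n color := by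
  obtain ⟨hmeas, hmap⟩ := h.map_tally hk color
  have h1 : ∀ ω, estimator α β k n (observed color N Y ω) - numColors color =
      tallyError (optimalW (nodesM β k n) (degreeL α k)) ((k : ℝ) / (n * nodesM β k n)) color
        (tally color (observed color N Y ω)) := fun ω =>
    estimator_sub_eq α β n color fun t : Fin (N ω) => Y t ω
  have hint := integrable_tallyError_sq (w := optimalW (nodesM β k n) (degreeL α k))
    (ρ := (k : ℝ) / (n * nodesM β k n)) n color
  simp only [h1, poissonMSE]
  rw [tallyLaw, ← hmap] at hint ⊢
  refine ⟨(integrable_map_measure hint.aestronglyMeasurable hmeas.aemeasurable).1 hint, ?_⟩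
  rw [integral_map hmeas.aemeasurable hint.aestronglyMeasurable]

/-! ### Sample complexity -/

/-- Chernoff: P(N > m) ≤ E exp(N - m) = exp(n(e-1) - m), and e < 3. -/
theorem one_sub_exp_le_sum_poisson (n : ℝ≥0) (m : ℕ) :
    1 - Real.exp (2 * n - m) ≤
      ∑ j ∈ Finset.range (m + 1), (poissonMeasure n).real {j} := by
  have h1 : HasSum (fun j => (poissonMeasure n).real {j}) 1 := by
    simpa only [poissonMeasure_real_singleton] using hasSum_one_poissonMeasure n
  have h2 : HasSum (fun j => (poissonMeasure n).real {j} * Real.exp ((j : ℝ) - m))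
      (Real.exp (-n - m) * Real.exp (n * Real.exp 1)) := by
    have h3 := NormedSpace.expSeries_div_hasSum_exp (n * Real.exp 1 : ℝ)
    rw [← Real.exp_eq_exp_ℝ] at h3
    have h4 := h3.mul_left (Real.exp (-n - m))
    convert! h4 using 2 with j
    rw [poissonMeasure_real_singleton, mul_pow, ← Real.exp_nat_mul, mul_one, Real.exp_sub,
      Real.exp_sub]
    ring
  have h4 : HasSum (fun j => if j ∈ Finset.range (m + 1) then (poissonMeasure n).real {j} else 0)
      (∑ j ∈ Finset.range (m + 1), (poissonMeasure n).real {j}) := by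
    rw [← Finset.sum_congr rfl fun j hj => if_pos hj]
    exact hasSum_sum_of_ne_finset_zero fun j hj => if_neg hj
  have h5 := hasSum_le (fun j => ?_) (h1.sub h2) h4
  · refine le_trans ?_ h5
    rw [← Real.exp_add]
    have h6 : -(n : ℝ) - m + n * Real.exp 1 ≤ 2 * n - m := by
      have h7 := Real.exp_one_lt_three
      have h8 : (0 : ℝ) ≤ n := n.2
      nlinarith
    linarith [Real.exp_le_exp.2 h6]
  · have h9 : 0 ≤ (poissonMeasure n).real {j} := measureReal_nonneg
    split_ifs with hj
    · have := mul_nonneg h9 (Real.exp_pos ((j : ℝ) - m)).le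
      linarith
    · have h10 : (m : ℝ) ≤ j := by
        rw [Finset.mem_range] at hj
        exact_mod_cast (by omega : m ≤ j)
      have := Real.one_le_exp (sub_nonneg.2 h10)
      nlinarith

theorem sq_sum_mul_add_mul_le {ι : Type*} (s : Finset ι) (p a : ι → ℝ) {q b : ℝ}
    (hp : ∀ i ∈ s, 0 ≤ p i) (hq : 0 ≤ q) (h1 : ∑ i ∈ s, p i + q = 1) :
    (∑ i ∈ s, p i * a i + q * b) ^ 2 ≤ ∑ i ∈ s, p i * a i ^ 2 + q * b ^ 2 := by
  set M := ∑ i ∈ s, p i * a i + q * b with hM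
  have h2 : 0 ≤ ∑ i ∈ s, p i * (a i - M) ^ 2 + q * (b - M) ^ 2 :=
    add_nonneg (Finset.sum_nonneg fun i hi => mul_nonneg (hp i hi) (sq_nonneg _)) (by positivity)
  have h3 : ∑ i ∈ s, p i * (a i - M) ^ 2 = ∑ i ∈ s, p i * a i ^ 2 - 2 * M * ∑ i ∈ s, p i * a i +
      M ^ 2 * ∑ i ∈ s, p i := by
    rw [Finset.mul_sum, Finset.mul_sum, ← Finset.sum_sub_distrib, ← Finset.sum_add_distrib]
    exact Finset.sum_congr rfl fun i _ => by ring
  have h4 : ∑ i ∈ s, p i * a i = M - q * b := by rw [hM]; ring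
  have h5 : ∑ i ∈ s, p i = 1 - q := by linarith
  rw [h3, h4, h5] at h2
  nlinarith

instance {k m : ℕ} [NeZero k] :
    IsProbabilityMeasure (Measure.pi fun _ : Fin m => uniformOn (Set.univ : Set (Fin k))) := by
  have : IsProbabilityMeasure (uniformOn (Set.univ : Set (Fin k))) :=
    isProbabilityMeasure_uniformOn Set.finite_univ Set.univ_nonempty
  infer_instance

theorem map_castLE_pi_uniformOn {k j m : ℕ} [NeZero k] (h : j ≤ m) :
    (Measure.pi fun _ : Fin m => uniformOn (Set.univ : Set (Fin k))).map
      (fun y (t : Fin j) => y (Fin.castLE h t)) =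
        Measure.pi fun _ : Fin j => uniformOn (Set.univ : Set (Fin k)) := by
  have : IsProbabilityMeasure (uniformOn (Set.univ : Set (Fin k))) :=
    isProbabilityMeasure_uniformOn Set.finite_univ Set.univ_nonempty
  have h1 : iIndepFun (fun (t : Fin m) (y : Fin m → Fin k) => y t)
      (Measure.pi fun _ : Fin m => uniformOn (Set.univ : Set (Fin k))) :=
    iIndepFun_pi (X := fun _ => id) fun _ => aemeasurable_id
  rw [(iIndepFun_iff_map_fun_eq_pi_map fun t : Fin j =>
    (measurable_pi_apply (Fin.castLE h t)).aemeasurable).1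
      (h1.precomp (Fin.castLE_injective h))]
  congr 1
  funext t
  exact (measurePreserving_eval (fun _ : Fin m => uniformOn (Set.univ : Set (Fin k)))
    (Fin.castLE h t)).map_eq

/-- The Poisson risk is the mixture of the fixed-size risks; dropping sizes only decreases it. -/
theorem sum_poisson_mul_integral_le {k : ℕ} [NeZero k] (α β : ℝ) (n : ℝ≥0) (color : Fin k → ℕ)
    (m : ℕ) :
    ∑ j ∈ Finset.range m, (poissonMeasure n).real {j} *
      ∫ y, (estimator α β k n (fun t => color (y t)) - numColors color) ^ 2
        ∂(Measure.pi fun _ : Fin j => uniformOn (Set.univ : Set (Fin k))) ≤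
      poissonMSE α β n color := by
  have hk : 1 ≤ k := Nat.one_le_iff_ne_zero.2 (NeZero.ne k)
  have hint := integrable_tallyError_sq (w := optimalW (nodesM β k n) (degreeL α k))
    (ρ := (k : ℝ) / (n * nodesM β k n)) n color
  rw [poissonMSE, tallyLaw, ← sum_poisson_smul_map_tally hk n color] at *
  have h1 := hasSum_integral_measure hint
  refine le_trans (le_of_eq ?_) (sum_le_hasSum (Finset.range m) (fun j _ =>
    integral_nonneg fun x => sq_nonneg _) h1)
  refine Finset.sum_congr rfl fun j _ => ?_
  rw [integral_smul_measure, integral_map Measurable.of_discrete.aemeasurable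
    Measurable.of_discrete.aestronglyMeasurable, smul_eq_mul]
  simp only [estimator_sub_eq]
  rfl

/-- The conditional mean of the Poissonized estimator, given a sample of fixed size. -/
def averagedEstimator (α β : ℝ) (k : ℕ) (n : ℝ≥0) {m : ℕ} (x : Fin m → ℕ) : ℝ :=
  ∑ j : Fin (m + 1), (poissonMeasure n).real {(j : ℕ)} *
    estimator α β k n fun t : Fin j => x (Fin.castLE (Nat.le_of_lt_succ j.2) t)

theorem integral_averagedEstimator_le {k : ℕ} [NeZero k] (α β : ℝ) (n : ℝ≥0) (color : Fin k → ℕ)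
    (m : ℕ) :
    ∫ y, (averagedEstimator α β k n (fun t => color (y t)) - numColors color) ^ 2
      ∂(Measure.pi fun _ : Fin m => uniformOn (Set.univ : Set (Fin k))) ≤
      poissonMSE α β n color + Real.exp (2 * n - m) * (k : ℝ) ^ 2 := by
  set P := Measure.pi fun _ : Fin m => uniformOn (Set.univ : Set (Fin k))
  have hint : ∀ f : (Fin m → Fin k) → ℝ, Integrable f P := fun f => Integrable.of_finite
  set p : Fin (m + 1) → ℝ := fun j => (poissonMeasure n).real {(j : ℕ)} with hp
  set q := 1 - ∑ j, p j with hq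
  have htail : q ≤ Real.exp (2 * n - m) := by
    have := one_sub_exp_le_sum_poisson n m
    rw [Finset.sum_range] at this
    linarith
  have hq0 : 0 ≤ q := by
    have h1 : HasSum (fun j => (poissonMeasure n).real {j}) 1 := by
      simpa only [poissonMeasure_real_singleton] using hasSum_one_poissonMeasure n
    have := sum_le_hasSum (Finset.range (m + 1)) (fun j _ => measureReal_nonneg) h1
    rw [Finset.sum_range] at this
    linarith
  have hC : (numColors color : ℝ) ≤ k := by exact_mod_cast numColors_le color
  let A : Fin (m + 1) → (Fin m → Fin k) → ℝ := fun j y =>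
    estimator α β k n (fun t : Fin j => color (y (Fin.castLE (Nat.le_of_lt_succ j.2) t))) -
      numColors color
  have hpt : ∀ y : Fin m → Fin k,
      (averagedEstimator α β k n (fun t => color (y t)) - numColors color) ^ 2 ≤
        ∑ j, p j * A j y ^ 2 + q * (k : ℝ) ^ 2 := by
    intro y
    -- Jensen's inequality. Sizes beyond m carry mass q and are treated as if the estimate were 0,
    -- with error -C.
    have h1 := sq_sum_mul_add_mul_le Finset.univ p (fun j => A j y) (q := q)
      (b := -(numColors color : ℝ)) (fun j _ => measureReal_nonneg) hq0 (by rw [hq]; ring)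
    have h2 : ∑ j, p j * A j y + q * -(numColors color : ℝ) =
        averagedEstimator α β k n (fun t => color (y t)) - numColors color := by
      simp only [A, averagedEstimator, mul_sub, Finset.sum_sub_distrib, ← Finset.sum_mul, hq, hp]
      ring
    rw [h2, neg_sq] at h1
    refine h1.trans ?_
    gcongr
  calc _ ≤ ∫ y, (∑ j, p j * A j y ^ 2 + q * (k : ℝ) ^ 2) ∂P :=
        integral_mono (hint _) (hint _) hpt
    _ = ∑ j, p j * ∫ y, A j y ^ 2 ∂P + q * (k : ℝ) ^ 2 := by
        rw [integral_add (hint _) (hint _), integral_finsetSum _ fun j _ => hint _]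
        simp only [integral_const_mul, integral_const, probReal_univ, smul_eq_mul, one_mul]
    _ ≤ _ := by
        gcongr
        refine le_trans (le_of_eq ?_) (sum_poisson_mul_integral_le α β n color (m + 1))
        rw [Finset.sum_range]
        refine Finset.sum_congr rfl fun j _ => ?_
        rw [← map_castLE_pi_uniformOn (Nat.le_of_lt_succ j.2),
          integral_map Measurable.of_discrete.aemeasurable
            Measurable.of_discrete.aestronglyMeasurable]

/-! ### From mean squared error to sample size -/

/-- Rounding costs 1/2 ≤ Δ/2, so Markov is applied at level (Δ/2)²; 4 (1/50 + 1/512) < 0.1. The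
summand log k + 9 in the size makes the Poisson tail, times k², at most k/512 ≤ Δ²/512. -/
theorem sampleSizeSuffices_of_poissonMSE_le {α β : ℝ} {k : ℕ} (hk : 1 ≤ k) {n : ℝ≥0} {Δ : ℝ}
    (hΔ0 : 0 < Δ) (hΔ : (k : ℝ) ≤ Δ ^ 2)
    (h : ∀ color : Fin k → ℕ, poissonMSE α β n color ≤ Δ ^ 2 / 50) :
    SampleSizeSuffices k Δ ⌈2 * n + Real.log k + 9⌉₊ := by
  have : NeZero k := ⟨by omega⟩
  have hk' : (1 : ℝ) ≤ k := by exact_mod_cast hk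
  have hΔ1 : 1 ≤ Δ := by nlinarith
  set m := ⌈2 * n + Real.log k + 9⌉₊ with hm
  refine ⟨fun x => round (averagedEstimator α β k n x), fun color => ?_⟩
  set P := Measure.pi fun _ : Fin m => uniformOn (Set.univ : Set (Fin k))
  have h1 := integral_averagedEstimator_le α β n color m
  have h2 : Real.exp (2 * n - m) * (k : ℝ) ^ 2 ≤ Δ ^ 2 / 512 := by
    have h3 : 2 * n + Real.log k + 9 ≤ m := Nat.le_ceil _
    have h4 : Real.exp (2 * n - m) ≤ Real.exp (-Real.log k + -9) := Real.exp_le_exp.2 (by linarith)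
    rw [Real.exp_add, Real.exp_neg, Real.exp_log (by linarith)] at h4
    have h5 : Real.exp (-9) ≤ 1 / 512 := by
      have h6 : (2 : ℝ) ≤ Real.exp 1 := by linarith [Real.add_one_le_exp (1 : ℝ)]
      rw [Real.exp_neg, ← one_div]
      refine one_div_le_one_div_of_le (by norm_num) ?_
      calc (512 : ℝ) = 2 ^ 9 := by norm_num
        _ ≤ Real.exp 1 ^ 9 := by gcongr
        _ = Real.exp 9 := by rw [← Real.exp_nat_mul]; norm_num
    calc Real.exp (2 * n - m) * (k : ℝ) ^ 2 ≤ ((k : ℝ)⁻¹ * (1 / 512)) * k ^ 2 := by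
          gcongr
          exact h4.trans (by gcongr)
      _ = (k : ℝ) / 512 := by field_simp
      _ ≤ Δ ^ 2 / 512 := by gcongr
  have hsub : {y : Fin m → Fin k | Δ ≤ |((round (averagedEstimator α β k n fun t => color (y t)) : ℤ) :
      ℝ) - numColors color|} ⊆
      {y | (Δ / 2) ^ 2 ≤ (averagedEstimator α β k n (fun t => color (y t)) - numColors color) ^ 2} := by
    intro y hy
    simp only [Set.mem_ofPred_eq] at hy ⊢
    rw [← sq_abs (_ - _)]
    refine pow_le_pow_left₀ (by linarith) ?_ 2
    have h3 := abs_sub_round (averagedEstimator α β k n fun t => color (y t))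
    have h4 := abs_sub_le ((round (averagedEstimator α β k n fun t => color (y t)) : ℤ) : ℝ)
      (averagedEstimator α β k n fun t => color (y t)) (numColors color)
    rw [abs_sub_comm] at h3
    linarith
  refine (measureReal_mono hsub (measure_ne_top _ _)).trans ?_
  have h6 := mul_meas_ge_le_integral_of_nonneg (μ := P)
    (f := fun y => (averagedEstimator α β k n (fun t => color (y t)) - numColors color) ^ 2)
    (Filter.Eventually.of_forall fun y => sq_nonneg _) Integrable.of_finite ((Δ / 2) ^ 2)
  have h7 := h color
  have h8 : 0 < Δ ^ 2 := by positivity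
  by_contra! hcon
  have h9 := mul_lt_mul_of_pos_left hcon (show 0 < (Δ / 2) ^ 2 by positivity)
  nlinarith

/-- Once every ball has been drawn the plug-in count is exact; by the union bound this fails with
probability at most k (1 - 1/k)^m. The size does not depend on Δ, as needed for the finitely many
small k. -/
theorem exists_sampleSizeSuffices {k : ℕ} (hk : 1 ≤ k) :
    ∃ m, ∀ Δ : ℝ, 0 < Δ → SampleSizeSuffices k Δ m := by
  have : NeZero k := ⟨by omega⟩
  have hk' : (0 : ℝ) < k := by exact_mod_cast hk
  have hr0 : (0 : ℝ) ≤ (k - 1 : ℕ) / k := by positivity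
  have hr1 : ((k - 1 : ℕ) / k : ℝ) < 1 := by
    rw [div_lt_one hk']
    exact_mod_cast (by omega : k - 1 < k)
  obtain ⟨m, hm⟩ := exists_pow_lt_of_lt_one (show 0 < 0.1 / (k : ℝ) by positivity) hr1
  refine ⟨m, fun Δ hΔ => ⟨fun x => (Finset.univ.image x).card, fun color => ?_⟩⟩
  set P := Measure.pi fun _ : Fin m => uniformOn (Set.univ : Set (Fin k))
  have hsub : {y : Fin m → Fin k | Δ ≤ |((((Finset.univ.image fun t => color (y t)).card : ℕ) : ℤ) : ℝ) -
      numColors color|} ⊆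
      ⋃ b ∈ (Finset.univ : Finset (Fin k)),
        ((Fintype.piFinset fun _ : Fin m => Finset.univ.erase b : Finset (Fin m → Fin k)) :
          Set (Fin m → Fin k)) := by
    intro y hy
    by_contra hcon
    simp only [Set.mem_iUnion, Finset.mem_coe, Fintype.mem_piFinset, Finset.mem_erase,
      Finset.mem_univ, and_true, exists_prop, true_and, not_exists, not_forall, not_not] at hcon
    have himg : Finset.univ.image (fun t => color (y t)) = Finset.univ.image color := by
      ext a
      simp only [Finset.mem_image, Finset.mem_univ, true_and]
      constructor
      · rintro ⟨t, rfl⟩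
        exact ⟨_, rfl⟩
      · rintro ⟨b, rfl⟩
        obtain ⟨t, ht⟩ := hcon b
        exact ⟨t, by rw [ht]⟩
    simp only [Set.mem_ofPred_eq, himg, numColors, Int.cast_natCast, sub_self, abs_zero] at hy
    linarith
  refine (measureReal_mono hsub (measure_ne_top _ _)).trans ((measureReal_biUnion_finset_le _ _).trans ?_)
  have h1 : ∀ b ∈ (Finset.univ : Finset (Fin k)), P.real
      ((Fintype.piFinset fun _ : Fin m => Finset.univ.erase b : Finset (Fin m → Fin k)) :
          Set (Fin m → Fin k)) ≤ 0.1 / k := by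
    intro b _
    rw [measureReal_def, pi_uniformOn_apply, Fintype.card_piFinset]
    simp only [Finset.card_erase_of_mem (Finset.mem_univ b), Finset.card_univ, Fintype.card_fin,
      Finset.prod_const]
    rw [ENNReal.toReal_div, ENNReal.toReal_pow]
    simp only [ENNReal.toReal_natCast]
    push_cast
    rw [← div_pow]
    exact hm.le
  refine (Finset.sum_le_sum h1).trans (le_of_eq ?_)
  simp
  field_simp

theorem log_sq_le_four_mul {k : ℕ} (hk : 1 ≤ k) : Real.log k ^ 2 ≤ 4 * k := by
  have hk' : (0 : ℝ) < k := by exact_mod_cast hk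
  have h1 : Real.log k ≤ 2 * Real.sqrt k := by
    have h2 := Real.log_le_sub_one_of_pos (Real.sqrt_pos.2 hk')
    rw [Real.log_sqrt hk'.le] at h2
    linarith
  calc Real.log k ^ 2 ≤ (2 * Real.sqrt k) ^ 2 :=
        pow_le_pow_left₀ (Real.log_natCast_nonneg k) h1 2
    _ = 4 * k := by rw [mul_pow, Real.sq_sqrt hk'.le]; norm_num

theorem half_le_div_log_mul {k : ℕ} (hk : 2 ≤ k) {l : ℝ} (hl : 1 / 2 ≤ l) :
    1 / 2 ≤ (k : ℝ) / Real.log k * l := by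
  have hlog := log_natCast_pos hk
  have hk' : (0 : ℝ) < k := by exact_mod_cast (by omega : 0 < k)
  have h1 : 1 ≤ (k : ℝ) / Real.log k := by
    rw [one_le_div hlog]
    linarith [Real.log_le_sub_one_of_pos hk']
  nlinarith

/-- With T = (k / log k) l ≥ 1/2 one has log k ≤ 8T and 9 + 1 ≤ 20T; hence 28. -/
theorem ceil_sampleSize_le {k : ℕ} (hk : 2 ≤ k) {n l : ℝ} (hn : 0 ≤ n) (hl : 1 / 2 ≤ l) :
    (⌈2 * n + Real.log k + 9⌉₊ : ℝ) ≤ 2 * n + 28 * (k / Real.log k * l) := by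
  have hlog := log_natCast_pos hk
  have h1 := half_le_div_log_mul hk hl
  have h2 : Real.log k ≤ 8 * (k / Real.log k * l) := by
    have h3 := log_sq_le_four_mul (show 1 ≤ k by omega)
    have h4 : Real.log k ≤ 4 * (k / Real.log k) := by
      rw [← mul_div_assoc, le_div_iff₀ hlog, ← sq]
      exact h3
    have h5 : (0 : ℝ) ≤ k / Real.log k := by positivity
    nlinarith
  have := (Nat.ceil_lt_add_one (a := 2 * n + Real.log k + 9) (by positivity)).le
  linarith

/-- With linearly many draws the polynomial interpolates and only the variance remains. -/
theorem eventually_poissonMSE_le_of_linear {δ : ℝ} (hδ : 0 < δ) {α : ℝ} (hα : 0 < α)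
    (hα' : α ≤ 1 / 32) (hαδ : α ≤ δ / 16) :
    ∀ᶠ k : ℕ in Filter.atTop, ∀ n : ℝ≥0, (n : ℝ) = 8 / α * k → ∀ color : Fin k → ℕ,
      poissonMSE α 4 n color ≤ ((k : ℝ) ^ (1 / 2 + δ)) ^ 2 / 50 := by
  have hl1 : Filter.Tendsto (fun k : ℕ => α * Real.log k) Filter.atTop Filter.atTop :=
    (Real.tendsto_log_atTop.comp tendsto_natCast_atTop_atTop).const_mul_atTop hα
  have hl2 : Filter.Tendsto (fun k : ℕ => Real.exp (3 / 2 * δ * Real.log k)) Filter.atTop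
      Filter.atTop :=
    Real.tendsto_exp_atTop.comp
      ((Real.tendsto_log_atTop.comp tendsto_natCast_atTop_atTop).const_mul_atTop (by positivity))
  filter_upwards [hl1.eventually_ge_atTop 2, hl2.eventually_ge_atTop 250,
    Filter.eventually_ge_atTop 2] with k h1 h2 hk n hn color
  have hlog := log_natCast_pos hk
  have hk' : (0 : ℝ) < k := by exact_mod_cast (by omega : 0 < k)
  have hnpos : 0 < n := by
    have : (0 : ℝ) < n := by rw [hn]; positivity
    exact this
  -- With n = 8k/α, M ≤ (α log k)/2 + 1 ≤ α log k, using α log k ≥ 2.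
  have hML : nodesM 4 k n ≤ degreeL α k := by
    refine Nat.le_floor ?_
    have h3 := (Nat.ceil_lt_add_one (a := 4 * k * Real.log k / n) (by positivity)).le
    have h4 : 4 * k * Real.log k / n = α * Real.log k / 2 := by
      rw [hn]
      field_simp
      ring
    have h5 : (nodesM 4 k n : ℝ) ≤ 4 * k * Real.log k / n + 1 := h3
    linarith
  have h3 := mse_le hα hα' le_rfl hk hnpos (D := 1) (δ := 0) le_rfl le_rfl zero_le_one
    (fun y hy => by rw [eval_fitPoly_optimalW_eq_zero hML hy, abs_zero]) color
  have h4 : ((k : ℝ) ^ (1 / 2 + δ)) ^ 2 = Real.exp ((1 + δ / 2) * Real.log k) *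
      Real.exp (3 / 2 * δ * Real.log k) := by
    rw [Real.rpow_def_of_pos hk', ← Real.exp_nat_mul, ← Real.exp_add]
    congr 1
    push_cast
    ring
  have h5 : Real.exp ((1 + 8 * α) * Real.log k) ≤ Real.exp ((1 + δ / 2) * Real.log k) := by
    gcongr
    linarith
  have h6 : 1 ≤ Real.exp ((1 + δ / 2) * Real.log k) := Real.one_le_exp (by positivity)
  have h7 : poissonMSE α 4 n color ≤ 5 * Real.exp ((1 + δ / 2) * Real.log k) := by
    refine h3.trans ?_
    linarith
  rw [h4]
  nlinarith

/-- Let l = log(k/Δ). If K' l ≤ log k, then n = K' (k / log k) l and part (i) give error k²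
exp(-8l). Otherwise k ≤ K' (k / log k) l, so linearly many draws are affordable and the
interpolating regime applies for k ≥ k₁. The remaining k are finitely many. The three summands of K
serve these cases. -/
theorem exists_sampleSize_le {δ c : ℝ} (hδ : 0 < δ) (hc0 : 0 < c) (hc : c < 1 / 2) :
    ∃ K : ℝ, 0 < K ∧ ∀ (k : ℕ) (Δ : ℝ), 2 ≤ k → (k : ℝ) ^ (1 / 2 + δ) ≤ Δ → Δ ≤ c * k →
      ∃ m : ℕ, (m : ℝ) ≤ K * (k / Real.log k) * Real.log (k / Δ) ∧ SampleSizeSuffices k Δ m := by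
  obtain ⟨c', hc', hmse⟩ := exists_poissonMSE_le (α := 1 / 32) (β := 4) (by norm_num) le_rfl le_rfl
  set K' := max (8 / c') 2 with hK'
  have hK'2 : 2 ≤ K' := le_max_right _ _
  have hcK' : 8 ≤ c' * K' := by
    have : 8 / c' ≤ K' := le_max_left _ _
    rw [div_le_iff₀ hc'] at this
    linarith
  set α := min (1 / 32) (δ / 16) with hα
  have hα0 : 0 < α := by positivity
  obtain ⟨k₁, hk₁⟩ := Filter.eventually_atTop.1
    (eventually_poissonMSE_le_of_linear hδ hα0 (min_le_left _ _) (min_le_right _ _))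
  choose! f hf using fun (k : ℕ) (hk : 1 ≤ k) => exists_sampleSizeSuffices hk
  set S : ℝ := ∑ k ∈ Finset.range k₁, (f k : ℝ) with hS
  have hS0 : 0 ≤ S := Finset.sum_nonneg fun _ _ => Nat.cast_nonneg _
  have hα8 : 0 < 8 / α := by positivity
  refine ⟨(2 * K' + 28) + (16 / α * K') + 2 * S, by positivity, ?_⟩
  intro k Δ hk hΔ hΔc
  have hlog := log_natCast_pos hk
  have hk' : (1 : ℝ) ≤ k := by exact_mod_cast (by omega : 1 ≤ k)
  have hk0 : (0 : ℝ) < k := by linarith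
  have hpow : (0 : ℝ) < (k : ℝ) ^ (1 / 2 + δ) := Real.rpow_pos_of_pos hk0 _
  have hΔ0 : 0 < Δ := hpow.trans_le hΔ
  have hkΔ : (k : ℝ) ≤ Δ ^ 2 := by
    have h1 : (k : ℝ) ≤ ((k : ℝ) ^ (1 / 2 + δ)) ^ 2 := by
      rw [← Real.rpow_natCast, ← Real.rpow_mul hk0.le]
      refine Real.self_le_rpow_of_one_le hk' ?_
      push_cast
      linarith
    exact h1.trans (pow_le_pow_left₀ hpow.le hΔ 2)
  set l := Real.log (k / Δ) with hl
  have hl2 : Real.log 2 ≤ l := by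
    refine Real.log_le_log (by norm_num) ?_
    rw [le_div_iff₀ hΔ0]
    nlinarith
  have hlhalf : 1 / 2 ≤ l := by linarith [Real.log_two_gt_d9]
  have hΔexp : Δ = k * Real.exp (-l) := by
    rw [hl, Real.exp_neg, Real.exp_log (by positivity)]
    field_simp
  set T := k / Real.log k * l with hT
  have hT1 : 1 / 2 ≤ T := half_le_div_log_mul hk hlhalf
  have hT0 : 0 < T := by linarith
  have hgoal : ((2 * K' + 28) + (16 / α * K') + 2 * S) * (k / Real.log k) * l =
      (2 * K' + 28) * T + (16 / α * K') * T + 2 * S * T := by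
    rw [hT]
    ring
  have hn1 : 0 ≤ (2 * K' + 28) * T := by positivity
  have hn2 : 0 ≤ (16 / α * K') * T := by positivity
  have hn3 : 0 ≤ 2 * S * T := by positivity
  rw [hgoal]
  rcases le_or_gt (K' * l) (Real.log k) with h | h
  · set n : ℝ≥0 := ⟨K' * T, by positivity⟩ with hn
    have hnr : (n : ℝ) = K' * T := rfl
    have hnlog : n * Real.log k = K' * l * k := by
      rw [hnr, hT]
      field_simp
    refine ⟨⌈2 * n + Real.log k + 9⌉₊, ?_, ?_⟩
    · have := ceil_sampleSize_le hk (n := n) n.2 hlhalf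
      rw [hnr] at this ⊢
      linarith
    · refine sampleSizeSuffices_of_poissonMSE_le (α := 1 / 32) (β := 4) (by omega) hΔ0 hkΔ
        fun color => ?_
      have hnpos : 0 < n := by
        have : (0 : ℝ) < n := by rw [hnr]; positivity
        exact this
      have h1 := hmse k n (by omega) hnpos (by
        rw [hnlog]
        exact le_mul_of_one_le_left hk0.le (by nlinarith)) color
      refine h1.trans ?_
      have h2 : K' * l ≤ max 1 (min (n * Real.log k / k) (Real.log k)) := by
        refine le_max_of_le_right (le_min ?_ h)
        rw [hnlog, mul_div_cancel_right₀ _ hk0.ne']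
      have h3 : Real.exp (-(c' * max 1 (min (n * Real.log k / k) (Real.log k)))) ≤
          Real.exp (-l) ^ 2 * (1 / 50) := by
        -- Δ ≤ k/2 gives l ≥ log 2, and 2⁻⁶ = 1/64.
        have h4 : Real.exp (-(6 * l)) ≤ 1 / 50 := by
          have h5 : Real.exp (-(6 * l)) ≤ Real.exp (-(6 * Real.log 2)) :=
            Real.exp_le_exp.2 (by linarith)
          have h6 : Real.exp (-(6 * Real.log 2)) = 1 / 64 := by
            rw [Real.exp_neg, show (6 : ℝ) = ((6 : ℕ) : ℝ) by norm_num, Real.exp_nat_mul,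
              Real.exp_log (by norm_num)]
            norm_num
          linarith
        calc _ ≤ Real.exp (-(8 * l)) := by
              refine Real.exp_le_exp.2 (neg_le_neg ?_)
              calc 8 * l ≤ c' * K' * l := by gcongr
                _ = c' * (K' * l) := by ring
                _ ≤ _ := by gcongr
          _ = Real.exp (-l) ^ 2 * Real.exp (-(6 * l)) := by
              rw [← Real.exp_nat_mul, ← Real.exp_add]
              congr 1
              push_cast
              ring
          _ ≤ _ := by gcongr
      calc _ ≤ (k : ℝ) ^ 2 * (Real.exp (-l) ^ 2 * (1 / 50)) := by gcongr
        _ = Δ ^ 2 / 50 := by rw [hΔexp]; ring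
  rcases le_or_gt k₁ k with hkk | hkk
  · set n : ℝ≥0 := ⟨8 / α * k, by positivity⟩ with hn
    have hnr : (n : ℝ) = 8 / α * k := rfl
    refine ⟨⌈2 * n + Real.log k + 9⌉₊, ?_, ?_⟩
    · have h1 := ceil_sampleSize_le hk (n := n) n.2 hlhalf
      have h2 : (k : ℝ) ≤ K' * T := by
        rw [hT, ← mul_div_right_comm, ← mul_div_assoc, le_div_iff₀ hlog]
        nlinarith
      have h3 : 2 * (8 / α * k) ≤ 16 / α * K' * T := by
        calc 2 * (8 / α * k) = 16 / α * k := by ring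
          _ ≤ 16 / α * (K' * T) := by gcongr
          _ = _ := by ring
      have h4 : 0 ≤ K' * T := by positivity
      rw [hnr] at h1 ⊢
      linarith
    · refine sampleSizeSuffices_of_poissonMSE_le (α := α) (β := 4) (by omega) hΔ0 hkΔ
        fun color => (hk₁ k hkk n hnr color).trans ?_
      gcongr
  · refine ⟨f k, ?_, hf k (by omega) Δ hΔ0⟩
    have h1 : (f k : ℝ) ≤ S := Finset.single_le_sum (f := fun k => (f k : ℝ))
      (fun _ _ => Nat.cast_nonneg _) (Finset.mem_range.2 hkk)
    have h2 : S ≤ 2 * S * T := by nlinarith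
    linarith

end

end DistinctElements

/-! ### The main theorem -/

theorem mainTheorem1 :
    (∃ α₀ β₀ : ℝ, 0 < α₀ ∧ α₀ < β₀ ∧
      ∀ α β : ℝ, 0 < α → α ≤ α₀ → β₀ ≤ β →
        ∃ c : ℝ, 0 < c ∧
          ∀ (k : ℕ) (n : ℝ≥0), 1 ≤ k → 0 < n →
          ∀ (color : Fin k → ℕ)
            (Ω : Type*) [MeasurableSpace Ω] (μ : Measure Ω) [IsProbabilityMeasure μ]
            (N : Ω → ℕ) (Y : ℕ → Ω → Fin k),
            DistinctElements.IsPoissonSample μ k n N Y →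
            Integrable (fun ω =>
              (DistinctElements.estimator α β k n (DistinctElements.observed color N Y ω)
                - DistinctElements.numColors color) ^ 2) μ ∧
            ∫ ω, (DistinctElements.estimator α β k n (DistinctElements.observed color N Y ω)
                - DistinctElements.numColors color) ^ 2 ∂μ ≤ (k : ℝ) ^ 2 ∧
            ((k : ℝ) ≤ n * Real.log k →
              ∫ ω, (DistinctElements.estimator α β k n (DistinctElements.observed color N Y ω)
                  - DistinctElements.numColors color) ^ 2 ∂μ
                ≤ (k : ℝ) ^ 2 *
                  Real.exp (-(c * max 1 (min (n * Real.log k / k) (Real.log k)))))) ∧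
    (∀ δ c : ℝ, 0 < δ → δ < 1 / 2 → 0 < c → c < 1 / 2 →
      ∃ K : ℝ, 0 < K ∧
        ∀ (k : ℕ) (Δ : ℝ), 2 ≤ k → (k : ℝ) ^ (1 / 2 + δ) ≤ Δ → Δ ≤ c * k →
          ∃ m : ℕ, (m : ℝ) ≤ K * (k / Real.log k) * Real.log (k / Δ) ∧
            DistinctElements.SampleSizeSuffices k Δ m) := by
  refine ⟨⟨1 / 32, 4, by norm_num, by norm_num, fun α β hα hα' hβ => ?_⟩,
    fun δ c hδ _ hc0 hc => DistinctElements.exists_sampleSize_le hδ hc0 hc⟩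
  obtain ⟨c, hc, h⟩ := DistinctElements.exists_poissonMSE_le hα hα' hβ
  refine ⟨c, hc, fun k n hk hn color Ω _ μ _ N Y hs => ?_⟩
  obtain ⟨hint, heq⟩ := hs.mse_eq hk color α β
  rw [heq]
  exact ⟨hint, DistinctElements.poissonMSE_le_sq α β n color, fun hkn => h k n hk hn hkn color⟩
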